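/- Let $a<b$ be real numbers, let $c_0>0$, and write $\mathcal M(a,b)$ for the finite signed Radon measures on $(a,b)$ and $I_\varepsilon(x)=(x-\varepsilon,x+\varepsilon)$. Let $f(t)=c_0t$ for $0\le t<1$, $f(t)=c_0$ for $1\le t\le\infty$, and $\psi(t)=t^2$ for $0\le t<\frac{c_0}{2}$, $\psi(t)=c_0t-\frac{c_0^2}{4}$ for $t\ge\frac{c_0}{2}$. For $u\in BV(a,b)$ write $Du=u'\mathcal L^1+D^su$ for the Lebesgue decomposition of its distributional derivative, $u(x\pm)$ for the one-sided (essential) limits, $[u](x)=u(x+)-u(x-)$, $J_u=\{x\in(a,b):[u](x)\neq0\}$, and $D^cu$ for the restriction of $D^su$ to $(a,b)\setminus J_u$. For $0<K\le\infty$, $\varepsilon>0$ and $\gamma\in\mathcal M(a,b)$ put $$E_\varepsilon(u,\gamma)=\int_a^b|u'-g|^2\,dx+\frac1\varepsilon\int_a^b f\Big(\varepsilon\,\frac{1}{|I_\varepsilon(x)\cap(a,b)|}\int_{I_\varepsilon(x)\cap(a,b)}|g|\,dt\Big)dx$$ if $u\in W^{1,1}(a,b)$, $\|u\|_{L^\infty(a,b)}\le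 K$, $\gamma=g\mathcal L^1$ with $g\in L^1(a,b)$, and $u'-g\in L^2(a,b)$; otherwise $E_\varepsilon(u,\gamma)=\infty$. Here $u\in L^1(a,b)$ if $K<\infty$, and $u\in L^0((a,b),[-\infty,\infty])$ if $K=\infty$. For $K<\infty$, $u\in L^1(a,b)$ and $\gamma\in\mathcal M(a,b)$ put $$E(u,\gamma)=\int_a^b|u'-g|^2dx+c_0\int_a^b|g|\,dx+2\sum_{x\in J_u}f\big(\tfrac12|[u](x)|\big)+c_0|D^cu|(a,b)$$ if $u\in BV(a,b)$, $\|u\|_{L^\infty(a,b)}\le K$, $\gamma=D^su+g\mathcal L^1$ with $g\in L^1(a,b)$, and $u'-g\in L^2(a,b)$; otherwise $E(u,\gamma)=\infty$. For $K=\infty$ let $BV_{\infty,\mathcal P}(a,b)$ be the set of all $u:(a,b)\to[-\infty,\infty]$ (up to equality a.e.) of the form $u=w+\sum_{i=1}^m\alpha_i\chi_{(x_{i-1},x_i)}$ with $w\in BV(a,b)$, $a=x_0<\dots<x_m=b$ and $\alpha_i\in\{-\infty,0,\infty\}$. For such $u$ let $\mathcal F(u)$ be the interior of $\bigcup_{i:\alpha_i=0}[x_{i-1},x_i]$;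 on $\mathcal F(u)$ the quantities $u'$, $D^su$, $D^cu$ are those of $w$; and let $J_u$ be the set of $x\in(a,b)$ at which the one-sided limits $u(x\pm)\in[-\infty,\infty]$ differ. For $u\in L^0((a,b),[-\infty,\infty])$ and $\gamma\in\mathcal M(a,b)$ put $$E(u,\gamma)=\int_{\mathcal F(u)}|u'-g|^2dx+c_0\int_{\mathcal F(u)}|g|\,dx+2\sum_{x\in J_u}f\big(\tfrac12|[u](x)|\big)+c_0|D^cu|(\mathcal F(u))$$ if $u\in BV_{\infty,\mathcal P}(a,b)$, $g\in L^1(\mathcal F(u))$, $\gamma=D^su+g\mathcal L^1$ on $\mathcal F(u)$, and $u'-g\in L^2(\mathcal F(u))$; otherwise $E(u,\gamma)=\infty$. In both cases define the reduced energies $$\tilde E_\varepsilon(u)=\inf_{\gamma\in\mathcal M(a,b)}E_\varepsilon(u,\gamma),\qquad \tilde E(u)=\inf_{g\in L^1(a,b)}E(u,D^su+g\mathcal L^1),$$ where $\tilde E(u)=\infty$ if $u\notin BV(a,b)$ (for $K<\infty$), respectively $u\notin BV_{\infty,\mathcal P}(a,b)$ (for $K=\infty$); for $K=\infty$ only the restriction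 of the measure $D^su+g\mathcal L^1$ to $\mathcal F(u)$ matters. Then, as $\varepsilon\to0^+$, $\tilde E_\varepsilon$ $\Gamma$-converges to $\tilde E$: on $L^1(a,b)$ with respect to strong convergence if $0<K<\infty$, and on $L^0((a,b),[-\infty,\infty])$ with respect to convergence almost everywhere if $K=\infty$. That is, for every sequence $\varepsilon_n\to0$ with $\varepsilon_n>0$: (i) if $u_n\to u$ in the respective sense, then $\tilde E(u)\le\liminf_{n\to\infty}\tilde E_{\varepsilon_n}(u_n)$; (ii) for every $u$ there are $u_n\to u$ in the respective sense with $\limsup_{n\to\infty}\tilde E_{\varepsilon_n}(u_n)\le\tilde E(u)$. Moreover, let $0<K<\infty$ and $u\in L^1(a,b)$. If $u\in BV(a,b)$ and $\|u\|_{L^\infty(a,b)}\le K$, then the function $g^*$ with $g^*=u'-\operatorname{sign}(u')\frac{c_0}{2}$ where $|u'|>\frac{c_0}{2}$ and $g^*=0$ elsewhere belongs to $L^1(a,b)$, and $$\tilde E(u)=E(u,D^su+g^*\mathcal L^1)=F(u):=\int_a^b\psi(|u'|)\,dx+2\sum_{x\in J_u}f\big(\tfrac12|[u](x)|\big)+c_0|D^cu|(a,b);$$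 otherwise $\tilde E(u)=\infty$. -/

import Mathlib

open MeasureTheory Set Filter Topology
open scoped ENNReal

noncomputable section

namespace CohesiveFracture

/-! ### Measures, `BV`, and `W^{1,1}` on a bounded open interval -/

/-- `𝓜(a,b)`: the finite signed Borel (equivalently, Radon) measures on `(a,b)`, realised as the
signed measures on `ℝ` that are concentrated on `(a,b)`. -/
def radonMeasures (a b : ℝ) : Set (SignedMeasure ℝ) :=
  {μ | μ.restrict (Ioo a b) = μ}

/-- The integral `∫ φ dμ` against a signed measure, through its Jordan decomposition. -/
def signedIntegral (μ : SignedMeasure ℝ) (φ : ℝ → ℝ) : ℝ :=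
  (∫ t, φ t ∂μ.toJordanDecomposition.posPart) - ∫ t, φ t ∂μ.toJordanDecomposition.negPart

/-- The measure `g 𝓛¹` on `(a,b)`. -/
def density (a b : ℝ) (g : ℝ → ℝ) : SignedMeasure ℝ :=
  (volume.restrict (Ioo a b)).withDensityᵥ g

/-- `μ` is the distributional derivative of `u` on `(a,b)`:
`∫ u φ' = - ∫ φ dμ` for all `φ ∈ C¹_c(a,b)`. -/
def HasDistribDeriv (a b : ℝ) (u : ℝ → ℝ) (μ : SignedMeasure ℝ) : Prop :=
  ∀ φ : ℝ → ℝ, ContDiff ℝ 1 φ → HasCompactSupport φ → tsupport φ ⊆ Ioo a b →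
    ∫ t in Ioo a b, u t * deriv φ t = -signedIntegral μ φ

/-- `u ∈ BV(a,b)`. -/
def IsBV (a b : ℝ) (u : ℝ → ℝ) : Prop :=
  IntegrableOn u (Ioo a b) ∧ ∃ μ ∈ radonMeasures a b, HasDistribDeriv a b u μ

/-- `u ∈ W^{1,1}(a,b)`. -/
def IsW11 (a b : ℝ) (u : ℝ → ℝ) : Prop :=
  IntegrableOn u (Ioo a b) ∧
    ∃ v : ℝ → ℝ, IntegrableOn v (Ioo a b) ∧ HasDistribDeriv a b u (density a b v)

open Classical in
/-- The distributional derivative `Du ∈ 𝓜(a,b)` (unique if it exists; `0` if there is none). -/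
def distribDeriv (a b : ℝ) (u : ℝ → ℝ) : SignedMeasure ℝ :=
  if h : ∃ μ ∈ radonMeasures a b, HasDistribDeriv a b u μ then h.choose else 0

/-- `u'`, the density of the absolutely continuous part of `Du`. -/
def acDeriv (a b : ℝ) (u : ℝ → ℝ) : ℝ → ℝ :=
  (distribDeriv a b u).rnDeriv volume

/-- `Dˢu`, the singular part of `Du` with respect to the Lebesgue measure. -/
def singDeriv (a b : ℝ) (u : ℝ → ℝ) : SignedMeasure ℝ :=
  (distribDeriv a b u).singularPart volume

/-! ### One-sided limits and jumps

One-sided limits are essential limits in `[-∞,∞]`, so that they do not depend on the representative.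
For a function of bounded variation they exist at every point of `(a,b)` and agree with the
one-sided approximate limits. -/

/-- The filter of right neighbourhoods of `x`, up to null sets. -/
def essRight (x : ℝ) : Filter ℝ := 𝓝[>] x ⊓ ae volume

/-- The filter of left neighbourhoods of `x`, up to null sets. -/
def essLeft (x : ℝ) : Filter ℝ := 𝓝[<] x ⊓ ae volume

/-- The jump set `J_u` of `u : (a,b) → [-∞,∞]`: the points where both one-sided limits
exist in `[-∞,∞]` and differ, that is, where `u(x+) - u(x-)` is defined in `[-∞,∞]` and not `0`. -/
def jumpSet (a b : ℝ) (u : ℝ → EReal) : Set ℝ :=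
  {x | x ∈ Ioo a b ∧ ∃ p q : EReal,
    Tendsto u (essRight x) (𝓝 p) ∧ Tendsto u (essLeft x) (𝓝 q) ∧ p ≠ q}

/-- The size `|[u](x)| = |u(x+) - u(x-)| ∈ [0,∞]` of the jump at a point `x ∈ J_u`. -/
def jumpAbs (u : ℝ → EReal) (x : ℝ) : ℝ≥0∞ :=
  (limUnder (essRight x) u - limUnder (essLeft x) u).abs

/-- A real-valued function, read as a function with values in `[-∞,∞]`. -/
def toExt (u : ℝ → ℝ) : ℝ → EReal := fun t => (u t : EReal)

/-! ### The densities -/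

/-- `f(t) = c₀ t` for `t < 1` and `f(t) = c₀` for `1 ≤ t ≤ ∞`. -/
def f (c₀ : ℝ) (t : ℝ≥0∞) : ℝ≥0∞ :=
  if t < 1 then ENNReal.ofReal c₀ * t else ENNReal.ofReal c₀

/-- `ψ(t) = t²` for `t < c₀/2` and `ψ(t) = c₀ t - c₀²/4` for `t ≥ c₀/2`. -/
def ψ (c₀ t : ℝ) : ℝ :=
  if t < c₀ / 2 then t ^ 2 else c₀ * t - c₀ ^ 2 / 4

/-- The surface energy `2 ∑_{x ∈ J_u} f(|[u](x)| / 2)`. -/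
def surfaceEnergy (a b c₀ : ℝ) (u : ℝ → EReal) : ℝ≥0∞ :=
  2 * ∑' x : jumpSet a b u, f c₀ (jumpAbs u x / 2)

/-! ### The energies for real-valued `u`

In the definitions below, `⨅` over `g` is over densities that satisfy the conditions listed; such a
`g` is unique almost everywhere, so this is the value at that `g`, and `∞` if there is none. -/

/-- The two-field energy `E_ε(u,γ)` with the bound `‖u‖_{L^∞(a,b)} ≤ K`, where `K ∈ [0,∞]`. -/
def Eeps (a b c₀ : ℝ) (K : ℝ≥0∞) (ε : ℝ) (u : ℝ → ℝ) (γ : SignedMeasure ℝ) : ℝ≥0∞ :=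
  ⨅ (g : ℝ → ℝ)
    (_ : IsW11 a b u ∧ eLpNorm u ∞ (volume.restrict (Ioo a b)) ≤ K ∧
      IntegrableOn g (Ioo a b) ∧ γ = density a b g ∧
      MemLp (fun t => acDeriv a b u t - g t) 2 (volume.restrict (Ioo a b))),
    (∫⁻ t in Ioo a b, ‖acDeriv a b u t - g t‖ₑ ^ 2) +
      (ENNReal.ofReal ε)⁻¹ * ∫⁻ x in Ioo a b,
        f c₀ (ENNReal.ofReal ε * ⨍⁻ t in Ioo (x - ε) (x + ε) ∩ Ioo a b, ‖g t‖ₑ ∂volume)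

/-- The limit energy `E(u,γ)` with the bound `‖u‖_{L^∞(a,b)} ≤ K`. The Cantor part `Dᶜu` is the
restriction of `Dˢu` to the complement of the jump set. -/
def E (a b c₀ : ℝ) (K : ℝ≥0∞) (u : ℝ → ℝ) (γ : SignedMeasure ℝ) : ℝ≥0∞ :=
  ⨅ (g : ℝ → ℝ)
    (_ : IsBV a b u ∧ eLpNorm u ∞ (volume.restrict (Ioo a b)) ≤ K ∧
      IntegrableOn g (Ioo a b) ∧ γ = singDeriv a b u + density a b g ∧
      MemLp (fun t => acDeriv a b u t - g t) 2 (volume.restrict (Ioo a b))),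
    (∫⁻ t in Ioo a b, ‖acDeriv a b u t - g t‖ₑ ^ 2) +
      ENNReal.ofReal c₀ * (∫⁻ t in Ioo a b, ‖g t‖ₑ) +
      surfaceEnergy a b c₀ (toExt u) +
      ENNReal.ofReal c₀ * (singDeriv a b u).totalVariation (Ioo a b \ jumpSet a b (toExt u))

/-- The reduced energy `Ẽ_ε(u) = inf_{γ ∈ 𝓜(a,b)} E_ε(u,γ)`. -/
def redEeps (a b c₀ : ℝ) (K : ℝ≥0∞) (ε : ℝ) (u : ℝ → ℝ) : ℝ≥0∞ :=
  ⨅ γ ∈ radonMeasures a b, Eeps a b c₀ K ε u γ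

/-- The reduced limit energy `Ẽ(u) = inf_{g ∈ L¹(a,b)} E(u, Dˢu + g 𝓛¹)`; it is `∞` if
`u ∉ BV(a,b)`, because `E(u, ·)` is. -/
def redE (a b c₀ : ℝ) (K : ℝ≥0∞) (u : ℝ → ℝ) : ℝ≥0∞ :=
  ⨅ (g : ℝ → ℝ) (_ : IntegrableOn g (Ioo a b)),
    E a b c₀ K u (singDeriv a b u + density a b g)

/-- The one-field cohesive energy
`F(u) = ∫ ψ(|u'|) + 2 ∑_{x ∈ J_u} f(|[u](x)| / 2) + c₀ |Dᶜu|(a,b)`. -/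
def F (a b c₀ : ℝ) (u : ℝ → ℝ) : ℝ≥0∞ :=
  (∫⁻ t in Ioo a b, ENNReal.ofReal (ψ c₀ |acDeriv a b u t|)) +
    surfaceEnergy a b c₀ (toExt u) +
    ENNReal.ofReal c₀ * (singDeriv a b u).totalVariation (Ioo a b \ jumpSet a b (toExt u))

/-- The eigendeformation `g* = u' - sign(u') c₀/2` where `|u'| > c₀/2`, and `g* = 0` elsewhere. -/
def gStar (a b c₀ : ℝ) (u : ℝ → ℝ) : ℝ → ℝ := fun t =>
  if c₀ / 2 < |acDeriv a b u t| then
    acDeriv a b u t - SignType.sign (acDeriv a b u t) * (c₀ / 2)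
  else 0

/-! ### The energies for `u` with values in `[-∞,∞]` (the case `K = ∞`) -/

open Classical in
/-- `E_ε(u,γ)` for `K = ∞` and `u` with values in `[-∞,∞]`; it is finite only if `u` is
(almost everywhere equal to) a real-valued function in `W^{1,1}(a,b)`. -/
def EepsInf (a b c₀ ε : ℝ) (u : ℝ → EReal) (γ : SignedMeasure ℝ) : ℝ≥0∞ :=
  if ∀ᵐ t ∂(volume.restrict (Ioo a b)), u t ≠ ⊥ ∧ u t ≠ ⊤ then
    Eeps a b c₀ ∞ ε (fun t => (u t).toReal) γ
  else ∞

/-- A representation `u = w + ∑ αᵢ χ_{(x_{i-1}, x_i)}` (a.e.) with a partition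
`a = x₀ < ⋯ < x_m = b`, with `αᵢ ∈ {-∞, 0, ∞}` and `w ∈ BV(a,b)`. The functions `u` which have
one form the space `BV_{∞,𝓟}(a,b)`. -/
structure BVInfRep (a b : ℝ) (u : ℝ → EReal) where
  m : ℕ
  x : Fin (m + 1) → ℝ
  strictMono_x : StrictMono x
  x_zero : x 0 = a
  x_last : x (Fin.last m) = b
  α : Fin m → EReal
  α_mem : ∀ i, α i = ⊥ ∨ α i = 0 ∨ α i = ⊤
  w : ℝ → ℝ
  isBV_w : IsBV a b w
  eq_ae : ∀ i, ∀ᵐ t ∂(volume.restrict (Ioo (x i.castSucc) (x i.succ))), u t = (w t : EReal) + α i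

/-- `𝓕(u)`, the interior of the union of the closed intervals on which `αᵢ = 0`. -/
def BVInfRep.finitePart {a b : ℝ} {u : ℝ → EReal} (R : BVInfRep a b u) : Set ℝ :=
  interior (⋃ (i : Fin R.m) (_ : R.α i = 0), Icc (R.x i.castSucc) (R.x i.succ))

/-- The measure `Dˢu` on `𝓕(u)`, where `u` coincides with `w`. -/
def BVInfRep.singDeriv {a b : ℝ} {u : ℝ → EReal} (R : BVInfRep a b u) : SignedMeasure ℝ :=
  (CohesiveFracture.singDeriv a b R.w).restrict R.finitePart

/-- The limit energy `E(u,γ)` for `K = ∞`. The set `𝓕(u)`, and `u'`, `Dˢu` and `g` on it, do not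
depend on the representation of `u` (nor, up to null sets, on any choice), so `⨅` is again the
common value, and it is `∞` if `u ∉ BV_{∞,𝓟}(a,b)` or if there is no admissible `g`. -/
def EInf (a b c₀ : ℝ) (u : ℝ → EReal) (γ : SignedMeasure ℝ) : ℝ≥0∞ :=
  ⨅ (R : BVInfRep a b u) (g : ℝ → ℝ)
    (_ : IntegrableOn g R.finitePart ∧
      γ.restrict R.finitePart =
        R.singDeriv + (volume.restrict R.finitePart).withDensityᵥ g ∧
      MemLp (fun t => acDeriv a b R.w t - g t) 2 (volume.restrict R.finitePart)),
    (∫⁻ t in R.finitePart, ‖acDeriv a b R.w t - g t‖ₑ ^ 2) +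
      ENNReal.ofReal c₀ * (∫⁻ t in R.finitePart, ‖g t‖ₑ) +
      surfaceEnergy a b c₀ u +
      ENNReal.ofReal c₀ * R.singDeriv.totalVariation (R.finitePart \ jumpSet a b u)

/-- `Ẽ_ε(u) = inf_{γ ∈ 𝓜(a,b)} E_ε(u,γ)` for `K = ∞`. -/
def redEepsInf (a b c₀ ε : ℝ) (u : ℝ → EReal) : ℝ≥0∞ :=
  ⨅ γ ∈ radonMeasures a b, EepsInf a b c₀ ε u γ

/-- `Ẽ(u) = inf_{g ∈ L¹(a,b)} E(u, Dˢu + g 𝓛¹)` for `K = ∞`. Only the restriction of the measure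
`Dˢu + g 𝓛¹` to `𝓕(u)` enters in `E`; for `u ∉ BV_{∞,𝓟}(a,b)` the value is `∞`. -/
def redEInf (a b c₀ : ℝ) (u : ℝ → EReal) : ℝ≥0∞ :=
  ⨅ (R : BVInfRep a b u) (g : ℝ → ℝ) (_ : IntegrableOn g (Ioo a b)),
    EInf a b c₀ u (R.singDeriv + density a b g)

/-! ### `Γ`-convergence -/

/-- `Γ`-convergence, as `ε → 0⁺`, of the functionals `G ε` on `X` to `G₀`, with respect to a notion
`conv` of convergence of sequences in `X`: along every sequence `εₙ → 0⁺` the `liminf` inequality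
holds and recovery sequences exist. -/
def GammaConverges {X : Type*} (conv : (ℕ → X) → X → Prop)
    (G : ℝ → X → ℝ≥0∞) (G₀ : X → ℝ≥0∞) : Prop :=
  ∀ ε : ℕ → ℝ, (∀ n, 0 < ε n) → Tendsto ε atTop (𝓝 0) →
    (∀ (u : ℕ → X) (u₀ : X), conv u u₀ →
      G₀ u₀ ≤ liminf (fun n => G (ε n) (u n)) atTop) ∧
    (∀ u₀ : X, ∃ u : ℕ → X, conv u u₀ ∧
      limsup (fun n => G (ε n) (u n)) atTop ≤ G₀ u₀)

/-- `L¹(a,b)`, with its norm. -/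
abbrev L1 (a b : ℝ) := Lp ℝ 1 (volume.restrict (Ioo a b))

/-- `L⁰((a,b), [-∞,∞])`. -/
abbrev L0 (a b : ℝ) := ℝ →ₘ[volume.restrict (Ioo a b)] EReal

/-- Strong convergence of sequences in `L¹(a,b)`. -/
def convL1 (a b : ℝ) (u : ℕ → L1 a b) (u₀ : L1 a b) : Prop :=
  Tendsto u atTop (𝓝 u₀)

/-- Almost everywhere convergence (in `[-∞,∞]`) of sequences in `L⁰((a,b), [-∞,∞])`. -/
def convAE (a b : ℝ) (u : ℕ → L0 a b) (u₀ : L0 a b) : Prop :=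
  ∀ᵐ t ∂(volume.restrict (Ioo a b)), Tendsto (fun n => u n t) atTop (𝓝 (u₀ t))

end CohesiveFracture

end

noncomputable section

namespace CohesiveFracture

/-! ### Signed measures -/

section SignedMeasures

variable {α : Type*} [MeasurableSpace α]

/-! An interior window of half-width ε in which `|g|` has mass m contributes f(m/2): this is linear
in m below the threshold m = 2 and equals c₀ from there on. Pointwise, ψ(|s|) is the minimum over g
of (s − g)² + c₀|g| (`ψ_le_add`), attained by soft thresholding (`ofReal_ψ_eq`); this identifies the
reduced limit energy and g*.

Lower bound. Sampling the nonlocal integrand along a lattice of mesh 2ε with a favourable offset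
gives disjoint windows that fill (a,b) up to margins of order ε. A window of mass at least 2 costs
2c₀; the others pay c₀∫|g| in full and, together with the elastic term, control ∫ψ(|u'|)
(`exists_finset_lintegral_ψ_le`). An energy bound limits the number of heavy windows, so along a
subsequence their centres accumulate at a finite set B (`exists_subseq_finset`). Since ψ grows
linearly, variations are bounded on compact intervals off B, and on each component of (a,b) ∖ B the
limit is ∞ a.e., −∞ a.e., or finite with bounded variation (`BoundedSeq.trichotomy`): this produces
the partition in the definition of the limit space. On the finite part the duality ψ(|s|) = max over
|ξ| ≤ c₀ of ξs − ξ²/4 linearises the energy. For a fixed C¹ test function ξ supported off B,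
integration by parts moves the derivative to ξ and the limit can be taken; the supremum over ξ
recovers ∫ψ(|w'|) + c₀|Dˢw| (`lintegral_ψ_add_le`, `BoundedSeq.energy_le`). The 2c₀ already paid at
a point of B covers any jump there, and a jump s elsewhere costs 2f(s/2) ≤ c₀s.

Upper bound. Let B be the finite set of jumps of size at least 2. Infinite values are replaced by ±M
and the result is averaged forward over a length δ = ε²; the derivative of the average is the
difference quotient of the derivative measure. The competitor g is the difference quotient of Dˢu +
g*𝓛¹. The elastic strain left over is the average of u' − g*, whose L² norm does not increase
(Jensen). In the nonlocal term f ≤ c₀ is used on a set of measure at most #B(2ε + δ) around B, and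
f(t) ≤ c₀t with Fubini elsewhere (`nonlocal_le`). After division by ε each large jump costs c₀(2 +
δ/ε), which tends to 2c₀ (`redEeps_smoothing_le`, `BVInfRep.limsup_redEeps_smoothing_le`).

For K = ∞ the limit energy is an infimum over representations. Its independence of the
representation is deduced from the two bounds themselves: the lower bound holds for every
representation and the recovery sequence can be built from any other (`BVInfRep.energy_le_energy`).
-/

/-- The positive part of the Jordan decomposition. -/
abbrev posM (s : SignedMeasure α) : Measure α := s.toJordanDecomposition.posPart

/-- The negative part of the Jordan decomposition. -/
abbrev negM (s : SignedMeasure α) : Measure α := s.toJordanDecomposition.negPart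

theorem eq_posM_sub_negM (s : SignedMeasure α) :
    s = (posM s).toSignedMeasure - (negM s).toSignedMeasure :=
  (s.toSignedMeasure_toJordanDecomposition).symm

/-- Restrictions of mutually singular measures stay mutually singular, so uniqueness of the Jordan
decomposition applies. -/
theorem toJordanDecomposition_restrict (s : SignedMeasure α) {U : Set α} (hU : MeasurableSet U) :
    posM (s.restrict U) = (posM s).restrict U ∧ negM (s.restrict U) = (negM s).restrict U := by
  have h : SignedMeasure.toJordanDecomposition (s.restrict U) =
      ⟨(posM s).restrict U, (negM s).restrict U,
        s.toJordanDecomposition.mutuallySingular.mono Measure.restrict_le_self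
          Measure.restrict_le_self⟩ := by
    apply SignedMeasure.toJordanDecomposition_eq
    rw [JordanDecomposition.toSignedMeasure]
    conv_lhs => rw [eq_posM_sub_negM s]
    rw [VectorMeasure.restrict_sub, VectorMeasure.restrict_toSignedMeasure hU,
      VectorMeasure.restrict_toSignedMeasure hU]
  simp [posM, negM, h]

theorem totalVariation_singularPart_restrict (s : SignedMeasure α) (ν : Measure α) [SigmaFinite ν]
    {U : Set α} (hU : MeasurableSet U) :
    SignedMeasure.totalVariation ((s.singularPart ν).restrict U) =
      (s.singularPart ν).totalVariation.restrict U := by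
  simp only [SignedMeasure.totalVariation]
  obtain ⟨h1, h2⟩ := toJordanDecomposition_restrict (s.singularPart ν) hU
  simp only [posM, negM] at h1 h2
  rw [h1, h2, Measure.restrict_add]

theorem singularPart_restrict_signed (s : SignedMeasure α) (ν : Measure α) [SigmaFinite ν]
    {U : Set α} (hU : MeasurableSet U) :
    SignedMeasure.singularPart (s.restrict U) ν = (s.singularPart ν).restrict U := by
  obtain ⟨h1, h2⟩ := toJordanDecomposition_restrict s hU
  simp only [posM, negM] at h1 h2
  rw [SignedMeasure.singularPart, SignedMeasure.singularPart, VectorMeasure.restrict_sub,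
    VectorMeasure.restrict_toSignedMeasure hU, VectorMeasure.restrict_toSignedMeasure hU]
  simp_rw [h1, h2, Measure.singularPart_restrict _ _ hU]

theorem rnDeriv_restrict_signed (s : SignedMeasure α) (ν : Measure α) [SigmaFinite ν]
    {U : Set α} (hU : MeasurableSet U) :
    ∀ᵐ x ∂(ν.restrict U), SignedMeasure.rnDeriv (s.restrict U) ν x = s.rnDeriv ν x := by
  obtain ⟨h1, h2⟩ := toJordanDecomposition_restrict s hU
  simp only [posM, negM] at h1 h2
  rw [ae_restrict_iff' hU]
  filter_upwards [Measure.rnDeriv_restrict s.toJordanDecomposition.posPart ν hU,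
    Measure.rnDeriv_restrict s.toJordanDecomposition.negPart ν hU] with x h3 h4 hx
  simp only [SignedMeasure.rnDeriv, h1, h2, h3, h4, indicator_of_mem hx]

/-- Moves negative parts across, so that signed identities can be treated with positive measures,
for which integrals add. -/
theorem add_eq_add_of_toSignedMeasure_sub_eq {P N P' N' : Measure α} [IsFiniteMeasure P]
    [IsFiniteMeasure N] [IsFiniteMeasure P'] [IsFiniteMeasure N']
    (h : P.toSignedMeasure - N.toSignedMeasure = P'.toSignedMeasure - N'.toSignedMeasure) :
    P + N' = P' + N := by
  rw [← Measure.toSignedMeasure_eq_toSignedMeasure_iff, Measure.toSignedMeasure_add,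
    Measure.toSignedMeasure_add]
  rw [sub_eq_sub_iff_add_eq_add] at h
  exact h

end SignedMeasures

/-- Frees `signedIntegral` from the Jordan decomposition: any decomposition into finite measures
gives the same value. -/
theorem signedIntegral_eq_sub {P N : Measure ℝ} [IsFiniteMeasure P] [IsFiniteMeasure N]
    {φ : ℝ → ℝ} (hP : Integrable φ P) (hN : Integrable φ N)
    (hφ : ∀ s : SignedMeasure ℝ, Integrable φ (posM s) ∧ Integrable φ (negM s)) :
    signedIntegral (P.toSignedMeasure - N.toSignedMeasure) φ = (∫ t, φ t ∂P) - ∫ t, φ t ∂N := by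
  set s := P.toSignedMeasure - N.toSignedMeasure with hs
  have h := add_eq_add_of_toSignedMeasure_sub_eq (hs.symm.trans (eq_posM_sub_negM s))
  have h' := congrArg (fun m => ∫ t, φ t ∂m) h
  rw [integral_add_measure hP (hφ s).2, integral_add_measure (hφ s).1 hN] at h'
  rw [signedIntegral]
  linarith

theorem integrable_of_contDiff {φ : ℝ → ℝ} (h : ContDiff ℝ 1 φ) (hc : HasCompactSupport φ)
    (P : Measure ℝ) [IsFiniteMeasure P] : Integrable φ P :=
  h.continuous.integrable_of_hasCompactSupport hc

theorem signedIntegral_sub_of_contDiff {P N : Measure ℝ} [IsFiniteMeasure P] [IsFiniteMeasure N]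
    {φ : ℝ → ℝ} (h : ContDiff ℝ 1 φ) (hc : HasCompactSupport φ) :
    signedIntegral (P.toSignedMeasure - N.toSignedMeasure) φ = (∫ t, φ t ∂P) - ∫ t, φ t ∂N :=
  signedIntegral_eq_sub (integrable_of_contDiff h hc P) (integrable_of_contDiff h hc N)
    fun _ => ⟨integrable_of_contDiff h hc _, integrable_of_contDiff h hc _⟩

/-! ### Primitives of measures -/

/-- The right-continuous primitive `t ↦ μ((-∞,t])`. -/
def cumul (μ : SignedMeasure ℝ) (t : ℝ) : ℝ := μ (Iic t)

theorem cumul_eq (μ : SignedMeasure ℝ) (t : ℝ) :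
    cumul μ t = (posM μ).real (Iic t) - (negM μ).real (Iic t) := by
  rw [cumul]
  exact μ.apply_eq_posPart_real_sub_negPart_real measurableSet_Iic

theorem monotone_real_Iic (P : Measure ℝ) [IsFiniteMeasure P] :
    Monotone fun t => P.real (Iic t) :=
  fun _ _ h => measureReal_mono (Iic_subset_Iic.2 h)

theorem measurable_cumul (μ : SignedMeasure ℝ) : Measurable (cumul μ) := by
  have : cumul μ = fun t => (posM μ).real (Iic t) - (negM μ).real (Iic t) :=
    funext (cumul_eq μ)
  rw [this]
  exact (monotone_real_Iic _).measurable.sub (monotone_real_Iic _).measurable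

theorem abs_cumul_le (μ : SignedMeasure ℝ) (t : ℝ) :
    |cumul μ t| ≤ (posM μ).real univ + (negM μ).real univ := by
  rw [cumul_eq]
  have h1 : (posM μ).real (Iic t) ≤ (posM μ).real univ := measureReal_mono (subset_univ _)
  have h2 : (negM μ).real (Iic t) ≤ (negM μ).real univ := measureReal_mono (subset_univ _)
  have h3 : 0 ≤ (posM μ).real (Iic t) := measureReal_nonneg
  have h4 : 0 ≤ (negM μ).real (Iic t) := measureReal_nonneg
  rw [abs_le]; constructor <;> linarith

theorem cumul_sub (μ : SignedMeasure ℝ) {s t : ℝ} (h : s ≤ t) :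
    cumul μ t - cumul μ s = μ (Ioc s t) := by
  rw [cumul, cumul, ← Iic_union_Ioc_eq_Iic h, VectorMeasure.of_union _ measurableSet_Iic
    measurableSet_Ioc]
  · ring
  · rw [Set.disjoint_left]; intro x hx hx'; exact absurd hx'.1 (not_lt.2 hx)

theorem tendsto_real_Iic_right (P : Measure ℝ) [IsFiniteMeasure P] (x : ℝ) :
    Tendsto (fun t => P.real (Iic t)) (𝓝[>] x) (𝓝 (P.real (Iic x))) := by
  have h := tendsto_measure_biInter_gt (μ := P) (s := fun t : ℝ => Iic t) (a := x)
    (fun r _ => measurableSet_Iic.nullMeasurableSet) (fun i j _ hij => Iic_subset_Iic.2 hij)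
    ⟨x + 1, by simp, measure_ne_top _ _⟩
  have h2 : (⋂ r > x, Iic r) = Iic x := by
    ext y; simp only [mem_iInter, mem_Iic]
    exact ⟨fun H => le_of_forall_gt_imp_ge_of_dense H, fun H r hr => H.trans hr.le⟩
  rw [h2] at h
  exact (ENNReal.tendsto_toReal (measure_ne_top _ _)).comp h

theorem tendsto_real_Iic_left (P : Measure ℝ) [IsFiniteMeasure P] (x : ℝ) :
    Tendsto (fun t => P.real (Iic t)) (𝓝[<] x) (𝓝 (P.real (Iio x))) := by
  have hm := (monotone_real_Iic P).tendsto_nhdsLT x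
  obtain ⟨u, hu1, hu2, hu3⟩ := exists_seq_strictMono_tendsto x
  have h1 : Tendsto (fun n => P.real (Iic (u n))) atTop (𝓝 (P.real (Iio x))) := by
    have h := tendsto_measure_iUnion_atTop (μ := P) (s := fun n => Iic (u n))
      (fun i j hij => Iic_subset_Iic.2 (hu1.monotone hij))
    have h2 : (⋃ n, Iic (u n)) = Iio x := by
      ext y; simp only [mem_iUnion, mem_Iic, mem_Iio]
      constructor
      · rintro ⟨n, hn⟩; exact hn.trans_lt (hu2 n)
      · intro hy
        obtain ⟨n, hn⟩ := (hu3.eventually (lt_mem_nhds hy)).exists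
        exact ⟨n, hn.le⟩
    rw [h2] at h
    exact (ENNReal.tendsto_toReal (measure_ne_top _ _)).comp h
  have h3 : Tendsto u atTop (𝓝[<] x) :=
    tendsto_nhdsWithin_iff.2 ⟨hu3, Eventually.of_forall hu2⟩
  rwa [tendsto_nhds_unique (hm.comp h3) h1] at hm

theorem tendsto_cumul_right (μ : SignedMeasure ℝ) (x : ℝ) :
    Tendsto (cumul μ) (𝓝[>] x) (𝓝 (cumul μ x)) := by
  simp only [funext (cumul_eq μ)]
  exact (tendsto_real_Iic_right _ x).sub (tendsto_real_Iic_right _ x)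

theorem tendsto_cumul_left (μ : SignedMeasure ℝ) (x : ℝ) :
    Tendsto (cumul μ) (𝓝[<] x) (𝓝 (μ (Iio x))) := by
  simp only [funext (cumul_eq μ)]
  rw [μ.apply_eq_posPart_real_sub_negPart_real measurableSet_Iio]
  exact (tendsto_real_Iic_left _ x).sub (tendsto_real_Iic_left _ x)

theorem cumul_eq_Iio_add (μ : SignedMeasure ℝ) (x : ℝ) : cumul μ x = μ (Iio x) + μ {x} := by
  rw [cumul, ← Iio_union_right, VectorMeasure.of_union _ measurableSet_Iio
    (measurableSet_singleton x)]
  simp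

/-- Integration by parts against a test function. -/
theorem integral_real_Iic_mul_deriv (P : Measure ℝ) [IsFiniteMeasure P] {φ : ℝ → ℝ}
    (h : ContDiff ℝ 1 φ) (hc : HasCompactSupport φ) :
    ∫ t, P.real (Iic t) * deriv φ t = -∫ t, φ t ∂P := by
  have hd : Integrable (deriv φ) := (h.continuous_deriv le_rfl).integrable_of_hasCompactSupport
    hc.deriv
  -- Fubini: `P (Iic t)` is the integral of the indicator of `s ≤ t`, and the integral of `φ'` over
  -- `[s, ∞)` is `-φ s`.
  have h1 : ∀ t, P.real (Iic t) * deriv φ t = ∫ s, (Ici s).indicator (deriv φ) t ∂P := by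
    intro t
    have : ∀ s, (Ici s).indicator (deriv φ) t = (Iic t).indicator (fun _ => deriv φ t) s := by
      intro s; simp [indicator, mem_Ici, mem_Iic]
    simp_rw [this]
    rw [integral_indicator measurableSet_Iic]
    simp
  simp_rw [h1]
  rw [integral_integral_swap]
  · rw [← integral_neg]
    congr 1; ext s
    rw [integral_indicator measurableSet_Ici, integral_Ici_eq_integral_Ioi,
      hc.integral_Ioi_deriv_eq h]
  · have hm : MeasurableSet {p : ℝ × ℝ | p.2 ≤ p.1} :=
      measurableSet_le measurable_snd measurable_fst
    have : (Function.uncurry fun t s => (Ici s).indicator (deriv φ) t) =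
        {p : ℝ × ℝ | p.2 ≤ p.1}.indicator (fun p => deriv φ p.1) := by
      ext ⟨t, s⟩; simp [indicator, Function.uncurry]
    rw [this]
    exact (hd.comp_fst P).indicator hm

theorem integrable_real_Iic_mul_deriv (P : Measure ℝ) [IsFiniteMeasure P] {φ : ℝ → ℝ}
    (h : ContDiff ℝ 1 φ) (hc : HasCompactSupport φ) :
    Integrable fun t => P.real (Iic t) * deriv φ t := by
  refine ((h.continuous_deriv le_rfl).integrable_of_hasCompactSupport hc.deriv).bdd_mul
    (c := P.real univ) (monotone_real_Iic P).measurable.aestronglyMeasurable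
    (Eventually.of_forall fun t => ?_)
  rw [Real.norm_of_nonneg measureReal_nonneg]
  exact measureReal_mono (subset_univ _)

theorem integrable_cumul_mul_deriv (μ : SignedMeasure ℝ) {φ : ℝ → ℝ}
    (h : ContDiff ℝ 1 φ) (hc : HasCompactSupport φ) :
    Integrable fun t => cumul μ t * deriv φ t := by
  simp_rw [cumul_eq, sub_mul]
  exact (integrable_real_Iic_mul_deriv _ h hc).sub (integrable_real_Iic_mul_deriv _ h hc)

theorem integral_cumul_mul_deriv (μ : SignedMeasure ℝ) {φ : ℝ → ℝ}
    (h : ContDiff ℝ 1 φ) (hc : HasCompactSupport φ) :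
    ∫ t, cumul μ t * deriv φ t = -signedIntegral μ φ := by
  simp_rw [cumul_eq, sub_mul]
  rw [integral_sub (integrable_real_Iic_mul_deriv _ h hc)
    (integrable_real_Iic_mul_deriv _ h hc), integral_real_Iic_mul_deriv _ h hc,
    integral_real_Iic_mul_deriv _ h hc, signedIntegral]
  ring

theorem setIntegral_mul_deriv_eq {U : Set ℝ} {φ : ℝ → ℝ}
    (hs : tsupport φ ⊆ U) (w : ℝ → ℝ) :
    ∫ t in U, w t * deriv φ t = ∫ t, w t * deriv φ t := by
  apply setIntegral_eq_integral_of_forall_compl_eq_zero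
  intro t ht
  have : deriv φ t = 0 := by
    by_contra hne
    exact ht (hs (support_deriv_subset hne))
  simp [this]

/-- A function that is almost everywhere equal to a primitive of `μ` has derivative `μ`. -/
theorem hasDistribDeriv_of_ae_eq {a b : ℝ} {u : ℝ → ℝ} {μ : SignedMeasure ℝ} (c : ℝ)
    (hu : ∀ᵐ t ∂(volume.restrict (Ioo a b)), u t = c + cumul μ t) : HasDistribDeriv a b u μ := by
  intro φ h hc hs
  have hd : Integrable (deriv φ) := (h.continuous_deriv le_rfl).integrable_of_hasCompactSupport
    hc.deriv
  have h1 : ∫ t in Ioo a b, u t * deriv φ t = ∫ t in Ioo a b, (c + cumul μ t) * deriv φ t := by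
    apply integral_congr_ae
    filter_upwards [hu] with t ht
    rw [ht]
  rw [h1, setIntegral_mul_deriv_eq hs]
  simp_rw [add_mul]
  rw [integral_add (hd.const_mul c) (integrable_cumul_mul_deriv μ h hc),
    integral_cumul_mul_deriv μ h hc, integral_const_mul,
    integral_eq_zero_of_hasDerivAt_of_integrable
      (fun x => (h.differentiable one_ne_zero x).hasDerivAt) hd
      (h.continuous.integrable_of_hasCompactSupport hc), mul_zero, zero_add]

/-- The fundamental lemma of the calculus of variations for derivatives. -/
theorem exists_ae_eq_const_of_integral_mul_deriv {a b : ℝ} (hab : a < b) {w : ℝ → ℝ}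
    (hw : IntegrableOn w (Ioo a b))
    (h : ∀ φ : ℝ → ℝ, ContDiff ℝ 1 φ → HasCompactSupport φ → tsupport φ ⊆ Ioo a b →
      ∫ t in Ioo a b, w t * deriv φ t = 0) :
    ∃ c : ℝ, ∀ᵐ t ∂(volume.restrict (Ioo a b)), w t = c := by
  let η : ContDiffBump ((a + b) / 2) := ⟨(b - a) / 8, (b - a) / 4, by linarith, by linarith⟩
  let ρ : ℝ → ℝ := η.normed volume
  have hρc : HasCompactSupport ρ := η.hasCompactSupport_normed
  have hρd : ContDiff ℝ ((⊤ : ℕ∞) : WithTop ℕ∞) ρ := η.contDiff_normed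
  have hρs : tsupport ρ ⊆ Ioo a b := by
    rw [show tsupport ρ = _ from η.tsupport_normed_eq]
    intro x hx
    rw [mem_closedBall_iff_norm, Real.norm_eq_abs, abs_le,
      show η.rOut = (b - a) / 4 from rfl] at hx
    constructor <;> linarith [hx.1, hx.2]
  have hρi : ∫ t, ρ t = 1 := η.integral_normed
  refine ⟨∫ t in Ioo a b, w t * ρ t, ?_⟩
  set c := ∫ t in Ioo a b, w t * ρ t with hcdef
  have key : ∀ᵐ t, t ∈ Ioo a b → w t - c = 0 := by
    apply isOpen_Ioo.ae_eq_zero_of_integral_contDiff_smul_eq_zero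
    · exact (hw.sub (integrableOn_const (by simp))).locallyIntegrableOn
    intro ζ hζ hζc hζs
    have hζi : Integrable ζ := hζ.continuous.integrable_of_hasCompactSupport hζc
    have hρint : Integrable ρ := hρd.continuous.integrable_of_hasCompactSupport hρc
    set m := ∫ t, ζ t with hm
    -- Subtracting a multiple of the unit bump makes the mean zero, so the primitive of `θ` has
    -- compact support and is an admissible test function.
    let θ : ℝ → ℝ := fun t => ζ t - m * ρ t
    have hθc : Continuous θ := hζ.continuous.sub (hρd.continuous.const_smul m)
    have hθi : Integrable θ := hζi.sub (hρint.const_mul m)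
    have hθ0 : ∫ t, θ t = 0 := by
      simp only [θ]
      rw [integral_sub hζi (hρint.const_mul m), integral_const_mul, hρi]; simp [hm]
    let φ : ℝ → ℝ := fun x => ∫ t in Iic x, θ t
    have hφd : ∀ x, HasDerivAt φ (θ x) x := by
      intro x
      have h1 : ∀ y, φ y = φ 0 + ∫ t in (0 : ℝ)..y, θ t := by
        intro y
        rw [intervalIntegral.integral_Iic_sub_Iic hθi.integrableOn hθi.integrableOn |>.symm]
        simp [φ]
      rw [show φ = fun y => φ 0 + ∫ t in (0 : ℝ)..y, θ t from funext h1]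
      exact (intervalIntegral.integral_hasDerivAt_right (hθc.intervalIntegrable _ _)
        (hθc.stronglyMeasurableAtFilter _ _) hθc.continuousAt).const_add _
    have hder : deriv φ = θ := funext fun x => (hφd x).deriv
    have hφ1 : ContDiff ℝ 1 φ := by
      rw [contDiff_one_iff_deriv, hder]
      exact ⟨fun x => (hφd x).differentiableAt, hθc⟩
    -- a compact interval that contains both supports
    obtain ⟨p, q, hpq, hsub⟩ : ∃ p q, Icc p q ⊆ Ioo a b ∧ tsupport ζ ∪ tsupport ρ ⊆ Icc p q := by
      have hK : IsCompact (tsupport ζ ∪ tsupport ρ) := hζc.isCompact.union hρc.isCompact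
      have hKs : tsupport ζ ∪ tsupport ρ ⊆ Ioo a b := union_subset hζs hρs
      rcases (tsupport ζ ∪ tsupport ρ).eq_empty_or_nonempty with he | hne
      · exact ⟨1, 0, by simp, by simp [he]⟩
      · exact ⟨sInf _, sSup _, fun x hx => ⟨(hKs (hK.sInf_mem hne)).1.trans_le hx.1,
          hx.2.trans_lt (hKs (hK.sSup_mem hne)).2⟩,
          fun x hx => ⟨csInf_le hK.bddBelow hx, le_csSup hK.bddAbove hx⟩⟩
    have hθz : ∀ t, t ∉ Icc p q → θ t = 0 := by
      intro t ht
      have h1 : ζ t = 0 := image_eq_zero_of_notMem_tsupport fun H => ht (hsub (Or.inl H))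
      have h2 : ρ t = 0 := image_eq_zero_of_notMem_tsupport fun H => ht (hsub (Or.inr H))
      simp [θ, h1, h2]
    have hφz : ∀ x, x ∉ Icc p q → φ x = 0 := by
      intro x hx
      rw [mem_Icc, not_and_or, not_le, not_le] at hx
      rcases hx with hx | hx
      · apply setIntegral_eq_zero_of_forall_eq_zero
        intro t ht
        exact hθz t fun H => absurd (H.1.trans ht) (not_le.2 hx)
      · have : φ x = ∫ t, θ t := by
          apply setIntegral_eq_integral_of_forall_compl_eq_zero
          intro t ht
          exact hθz t fun H => ht (H.2.trans hx.le)
        rw [this, hθ0]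
    have hφs : tsupport φ ⊆ Icc p q :=
      closure_minimal (fun x hx => by_contra fun H => hx (hφz x H)) isClosed_Icc
    have h0 := h φ hφ1 (isCompact_Icc.of_isClosed_subset (isClosed_tsupport _) hφs)
      (hφs.trans hpq)
    rw [hder] at h0
    have hbd : ∀ g : ℝ → ℝ, Continuous g → HasCompactSupport g →
        IntegrableOn (fun t => w t * g t) (Ioo a b) := by
      intro g hg hgc
      obtain ⟨C, hC⟩ := hg.bounded_above_of_compact_support hgc
      exact Integrable.mul_bdd (c := C) hw hg.aestronglyMeasurable (Eventually.of_forall hC)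
    have h1 : ∫ t in Ioo a b, w t * ζ t = m * c := by
      have : ∀ t, w t * θ t = w t * ζ t - m * (w t * ρ t) := fun t => by simp only [θ]; ring
      simp_rw [this] at h0
      rw [integral_sub (hbd _ hζ.continuous hζc) ((hbd _ hρd.continuous hρc).const_mul m),
        integral_const_mul] at h0
      linarith
    have h2 : ∫ t, ζ t • (w t - c) = ∫ t in Ioo a b, (w t * ζ t - c * ζ t) := by
      rw [← setIntegral_eq_integral_of_forall_compl_eq_zero (s := Ioo a b)]
      · congr 1; ext t; simp only [smul_eq_mul]; ring
      · intro t ht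
        rw [image_eq_zero_of_notMem_tsupport fun H => ht (hζs H)]; simp
    rw [h2, integral_sub (hbd _ hζ.continuous hζc) (hζi.integrableOn.const_mul c), h1,
      integral_const_mul, setIntegral_eq_integral_of_forall_compl_eq_zero]
    · ring
    · intro t ht
      exact image_eq_zero_of_notMem_tsupport fun H => ht (hζs H)
  rw [ae_restrict_iff' measurableSet_Ioo]
  filter_upwards [key] with t ht hts
  linarith [ht hts]

/-- A function with derivative `μ` is almost everywhere equal to a primitive of `μ`. -/
theorem HasDistribDeriv.exists_ae_eq {a b : ℝ} (hab : a < b) {u : ℝ → ℝ} {μ : SignedMeasure ℝ}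
    (hu : IntegrableOn u (Ioo a b)) (h : HasDistribDeriv a b u μ) :
    ∃ c : ℝ, ∀ᵐ t ∂(volume.restrict (Ioo a b)), u t = c + cumul μ t := by
  have hμi : IntegrableOn (cumul μ) (Ioo a b) :=
    Measure.integrableOn_of_bounded (M := (posM μ).real univ + (negM μ).real univ) (by simp)
      (measurable_cumul μ).aestronglyMeasurable (Eventually.of_forall fun t => abs_cumul_le μ t)
  obtain ⟨c, hc⟩ := exists_ae_eq_const_of_integral_mul_deriv hab (w := fun t => u t - cumul μ t)
    (hu.sub hμi) (by
      intro φ hφ hφc hφs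
      have h1 := h φ hφ hφc hφs
      have h2 := integral_cumul_mul_deriv μ hφ hφc
      rw [← setIntegral_mul_deriv_eq hφs] at h2
      obtain ⟨C, hC⟩ := (hφ.continuous_deriv le_rfl).bounded_above_of_compact_support hφc.deriv
      have hm : AEStronglyMeasurable (deriv φ) (volume.restrict (Ioo a b)) :=
        (hφ.continuous_deriv le_rfl).aestronglyMeasurable
      simp_rw [sub_mul]
      rw [integral_sub (Integrable.mul_bdd (c := C) hu hm (Eventually.of_forall hC))
        (Integrable.mul_bdd (c := C) hμi hm (Eventually.of_forall hC)), h1, h2]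
      ring)
  exact ⟨c, by filter_upwards [hc] with t ht; linarith⟩

/-! ### One-sided neighbourhoods up to null sets -/

/-- A null set cannot contain a right neighbourhood. This makes essential one-sided limits unique.
-/
instance essRight_neBot (x : ℝ) : (essRight x).NeBot := by
  rw [essRight, inf_neBot_iff]
  intro s hs t ht
  obtain ⟨u, hu, hsu⟩ := mem_nhdsGT_iff_exists_Ioo_subset.1 hs
  by_contra hne
  have h0 : volume (Ioo x u) = 0 := by
    refine measure_mono_null (fun y hy => ?_) ht
    intro hyt
    exact hne ⟨y, hsu hy, hyt⟩
  rw [Real.volume_Ioo, ENNReal.ofReal_eq_zero] at h0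
  have : x < u := hu
  linarith

instance essLeft_neBot (x : ℝ) : (essLeft x).NeBot := by
  rw [essLeft, inf_neBot_iff]
  intro s hs t ht
  obtain ⟨u, hu, hsu⟩ := mem_nhdsLT_iff_exists_Ioo_subset.1 hs
  by_contra hne
  have h0 : volume (Ioo u x) = 0 := by
    refine measure_mono_null (fun y hy => ?_) ht
    intro hyt
    exact hne ⟨y, hsu hy, hyt⟩
  rw [Real.volume_Ioo, ENNReal.ofReal_eq_zero] at h0
  have : u < x := hu
  linarith

theorem eventually_essRight {x q : ℝ} (hq : x < q) {p : ℝ → Prop}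
    (h : ∀ᵐ t ∂(volume.restrict (Ioo x q)), p t) : ∀ᶠ t in essRight x, p t := by
  rw [ae_restrict_iff' measurableSet_Ioo] at h
  have h1 : ∀ᶠ t in essRight x, t ∈ Ioo x q :=
    (inf_le_left : essRight x ≤ 𝓝[>] x) (Ioo_mem_nhdsGT hq)
  have h2 : ∀ᶠ t in essRight x, t ∈ Ioo x q → p t := (inf_le_right : essRight x ≤ ae volume) h
  filter_upwards [h1, h2] with t h3 h4 using h4 h3

theorem eventually_essLeft {x q : ℝ} (hq : q < x) {p : ℝ → Prop}
    (h : ∀ᵐ t ∂(volume.restrict (Ioo q x)), p t) : ∀ᶠ t in essLeft x, p t := by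
  rw [ae_restrict_iff' measurableSet_Ioo] at h
  have h1 : ∀ᶠ t in essLeft x, t ∈ Ioo q x :=
    (inf_le_left : essLeft x ≤ 𝓝[<] x) (Ioo_mem_nhdsLT hq)
  have h2 : ∀ᶠ t in essLeft x, t ∈ Ioo q x → p t := (inf_le_right : essLeft x ≤ ae volume) h
  filter_upwards [h1, h2] with t h3 h4 using h4 h3

theorem ae_restrict_mono {s t : Set ℝ} (h : s ⊆ t) {p : ℝ → Prop}
    (hp : ∀ᵐ x ∂(volume.restrict t), p x) : ∀ᵐ x ∂(volume.restrict s), p x :=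
  ae_mono (Measure.restrict_mono h le_rfl) hp

/-! ### Uniqueness and locality of the distributional derivative -/

theorem restrict_eq_restrict_of_add {μ₁ μ₂ : SignedMeasure ℝ} {U : Set ℝ} (hU : MeasurableSet U)
    (h : (posM μ₁ + negM μ₂).restrict U = (posM μ₂ + negM μ₁).restrict U) :
    μ₁.restrict U = μ₂.restrict U := by
  ext A hA
  rw [VectorMeasure.restrict_apply _ hU hA, VectorMeasure.restrict_apply _ hU hA,
    μ₁.apply_eq_posPart_real_sub_negPart_real (hA.inter hU),
    μ₂.apply_eq_posPart_real_sub_negPart_real (hA.inter hU)]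
  have h1 := congrArg (fun m : Measure ℝ => m.real A) h
  simp only [measureReal_restrict_apply hA] at h1
  rw [measureReal_add_apply, measureReal_add_apply] at h1
  linarith

theorem add_restrict_eq_of_restrict_eq {μ₁ μ₂ : SignedMeasure ℝ} {U : Set ℝ}
    (hU : MeasurableSet U) (h : μ₁.restrict U = μ₂.restrict U) :
    (posM μ₁ + negM μ₂).restrict U = (posM μ₂ + negM μ₁).restrict U := by
  ext A hA
  have h1 := congrArg (fun m : SignedMeasure ℝ => m A) h
  simp only [VectorMeasure.restrict_apply _ hU hA] at h1
  rw [μ₁.apply_eq_posPart_real_sub_negPart_real (hA.inter hU),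
    μ₂.apply_eq_posPart_real_sub_negPart_real (hA.inter hU)] at h1
  rw [Measure.restrict_apply hA, Measure.restrict_apply hA,
    ← measureReal_eq_measureReal_iff, measureReal_add_apply, measureReal_add_apply]
  simp only [posM, negM]
  linarith

/-- Right continuity upgrades the almost everywhere identity to every point, so both measures agree
on half-open intervals with endpoints inside. These generate the Borel sets, and the open interval
is a countable union of them; the comparison is made for the positive measures `P₁ + N₂` and `P₂ +
N₁`. -/
theorem restrict_Ioo_eq_of_cumul_eq {μ₁ μ₂ : SignedMeasure ℝ} {p q c₁ c₂ : ℝ}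
    (h : ∀ᵐ t ∂(volume.restrict (Ioo p q)), c₁ + cumul μ₁ t = c₂ + cumul μ₂ t) :
    μ₁.restrict (Ioo p q) = μ₂.restrict (Ioo p q) := by
  have h1 : ∀ x ∈ Ioo p q, c₁ + cumul μ₁ x = c₂ + cumul μ₂ x := by
    intro x hx
    have e1 : Tendsto (fun t => c₁ + cumul μ₁ t) (essRight x) (𝓝 (c₁ + cumul μ₁ x)) :=
      ((tendsto_cumul_right μ₁ x).mono_left inf_le_left).const_add _
    have e2 : Tendsto (fun t => c₂ + cumul μ₂ t) (essRight x) (𝓝 (c₂ + cumul μ₂ x)) :=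
      ((tendsto_cumul_right μ₂ x).mono_left inf_le_left).const_add _
    refine tendsto_nhds_unique_of_eventuallyEq e1 e2 (eventually_essRight hx.2 ?_)
    exact ae_restrict_mono (Ioo_subset_Ioo_left hx.1.le) h
  have h2 : ∀ s t, p < s → s ≤ t → t < q →
      (posM μ₁ + negM μ₂) (Ioc s t) = (posM μ₂ + negM μ₁) (Ioc s t) := by
    intro s t hs hst ht
    have e1 := cumul_sub μ₁ hst
    have e2 := cumul_sub μ₂ hst
    have e3 := h1 s ⟨hs, hst.trans_lt ht⟩
    have e4 := h1 t ⟨hs.trans_le hst, ht⟩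
    rw [μ₁.apply_eq_posPart_real_sub_negPart_real measurableSet_Ioc] at e1
    rw [μ₂.apply_eq_posPart_real_sub_negPart_real measurableSet_Ioc] at e2
    rw [← measureReal_eq_measureReal_iff, measureReal_add_apply, measureReal_add_apply]
    simp only [posM, negM]
    linarith
  have h3 : ∀ s t, p < s → t < q →
      (posM μ₁ + negM μ₂).restrict (Ioc s t) = (posM μ₂ + negM μ₁).restrict (Ioc s t) := by
    intro s t hs ht
    apply Measure.ext_of_Ioc
    intro x y _
    rw [Measure.restrict_apply measurableSet_Ioc, Measure.restrict_apply measurableSet_Ioc,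
      Ioc_inter_Ioc]
    rcases le_total (x ⊔ s) (y ⊓ t) with hle | hle
    · exact h2 _ _ (hs.trans_le le_sup_right) hle (inf_le_right.trans_lt ht)
    · simp [Ioc_eq_empty (not_lt.2 hle)]
  apply restrict_eq_restrict_of_add measurableSet_Ioo
  rcases le_or_gt q p with hqp | hpq
  · simp [Ioo_eq_empty (not_lt.2 hqp)]
  obtain ⟨s, hs1, hs2, hs3⟩ := exists_seq_strictAnti_tendsto p
  obtain ⟨t, ht1, ht2, ht3⟩ := exists_seq_strictMono_tendsto q
  have hU : Ioo p q = ⋃ n, Ioc (s n) (t n) := by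
    ext x
    simp only [mem_iUnion]
    constructor
    · intro hx
      obtain ⟨n, hn1, hn2⟩ := ((hs3.eventually (gt_mem_nhds hx.1)).and
        (ht3.eventually (lt_mem_nhds hx.2))).exists
      exact ⟨n, hn1, hn2.le⟩
    · rintro ⟨n, hn⟩
      exact ⟨(hs2 n).trans hn.1, hn.2.trans_lt (ht2 n)⟩
  rw [hU, Measure.restrict_iUnion_congr]
  exact fun n => h3 _ _ (hs2 n) (ht2 n)

/-- Lindelöf: countably many of the local intervals cover `U`. -/
theorem restrict_eq_of_forall_mem {μ₁ μ₂ : SignedMeasure ℝ} {U : Set ℝ} (hU : IsOpen U)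
    (h : ∀ x ∈ U, ∃ p q, x ∈ Ioo p q ∧ μ₁.restrict (Ioo p q) = μ₂.restrict (Ioo p q)) :
    μ₁.restrict U = μ₂.restrict U := by
  choose! p q hpq hμ using h
  obtain ⟨t, htU, htc, ht⟩ := TopologicalSpace.countable_cover_nhdsWithin
    (f := fun x => Ioo (p x) (q x)) (s := U)
    fun x hx => mem_nhdsWithin_of_mem_nhds (Ioo_mem_nhds (hpq x hx).1 (hpq x hx).2)
  apply restrict_eq_restrict_of_add hU.measurableSet
  have h1 : (posM μ₁ + negM μ₂).restrict (⋃ x ∈ t, Ioo (p x) (q x)) =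
      (posM μ₂ + negM μ₁).restrict (⋃ x ∈ t, Ioo (p x) (q x)) := by
    rw [Measure.restrict_biUnion_congr htc]
    exact fun x hx => add_restrict_eq_of_restrict_eq measurableSet_Ioo (hμ x (htU hx))
  rw [← Measure.restrict_restrict_of_subset ht, h1, Measure.restrict_restrict_of_subset ht]

theorem IsBV.distribDeriv_mem {a b : ℝ} {u : ℝ → ℝ} (h : IsBV a b u) :
    distribDeriv a b u ∈ radonMeasures a b := by
  rw [distribDeriv, dif_pos h.2]; exact h.2.choose_spec.1

theorem IsBV.hasDistribDeriv {a b : ℝ} {u : ℝ → ℝ} (h : IsBV a b u) :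
    HasDistribDeriv a b u (distribDeriv a b u) := by
  rw [distribDeriv, dif_pos h.2]; exact h.2.choose_spec.2

theorem IsBV.exists_ae_eq {a b : ℝ} (hab : a < b) {u : ℝ → ℝ} (h : IsBV a b u) :
    ∃ c : ℝ, ∀ᵐ t ∂(volume.restrict (Ioo a b)), u t = c + cumul (distribDeriv a b u) t :=
  h.hasDistribDeriv.exists_ae_eq hab h.1

/-- Uniqueness, which makes the choice in `distribDeriv` harmless: two derivatives have primitives
that differ by a constant, so they agree on the interval, and both are concentrated there. -/
theorem distribDeriv_eq {a b : ℝ} (hab : a < b) {u : ℝ → ℝ} {μ : SignedMeasure ℝ}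
    (hu : IntegrableOn u (Ioo a b)) (hμ : μ ∈ radonMeasures a b) (h : HasDistribDeriv a b u μ) :
    distribDeriv a b u = μ := by
  have hbv : IsBV a b u := ⟨hu, μ, hμ, h⟩
  obtain ⟨c₁, h₁⟩ := hbv.exists_ae_eq hab
  obtain ⟨c₂, h₂⟩ := h.exists_ae_eq hab hu
  have h3 : (distribDeriv a b u).restrict (Ioo a b) = μ.restrict (Ioo a b) := by
    apply restrict_Ioo_eq_of_cumul_eq (c₁ := c₁) (c₂ := c₂)
    filter_upwards [h₁, h₂] with t h3 h4
    rw [← h3, h4]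
  rw [← show (distribDeriv a b u).restrict (Ioo a b) = _ from hbv.distribDeriv_mem, h3]
  exact hμ

theorem distribDeriv_restrict_eq {a b : ℝ} (hab : a < b) {u₁ u₂ : ℝ → ℝ} (h₁ : IsBV a b u₁)
    (h₂ : IsBV a b u₂) {U : Set ℝ} (hU : IsOpen U) (hUab : U ⊆ Ioo a b)
    (h : ∀ᵐ t ∂(volume.restrict U), u₁ t = u₂ t) :
    (distribDeriv a b u₁).restrict U = (distribDeriv a b u₂).restrict U := by
  obtain ⟨c₁, e₁⟩ := h₁.exists_ae_eq hab
  obtain ⟨c₂, e₂⟩ := h₂.exists_ae_eq hab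
  apply restrict_eq_of_forall_mem hU
  intro x hx
  obtain ⟨p, q, hpq, hs⟩ := mem_nhds_iff_exists_Ioo_subset.1 (hU.mem_nhds hx)
  refine ⟨p, q, hpq, restrict_Ioo_eq_of_cumul_eq (c₁ := c₁) (c₂ := c₂) ?_⟩
  filter_upwards [ae_restrict_mono hs h, ae_restrict_mono (hs.trans hUab) e₁,
    ae_restrict_mono (hs.trans hUab) e₂] with t h1 h2 h3
  rw [← h2, h1, h3]

section Congruence

variable {a b : ℝ} {u₁ u₂ : ℝ → ℝ}

theorem hasDistribDeriv_congr (h : ∀ᵐ t ∂(volume.restrict (Ioo a b)), u₁ t = u₂ t) :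
    HasDistribDeriv a b u₁ = HasDistribDeriv a b u₂ := by
  ext μ
  refine forall_congr' fun φ => ?_
  rw [integral_congr_ae (g := fun t => u₂ t * deriv φ t)]
  filter_upwards [h] with t ht
  rw [ht]

theorem distribDeriv_congr (h : ∀ᵐ t ∂(volume.restrict (Ioo a b)), u₁ t = u₂ t) :
    distribDeriv a b u₁ = distribDeriv a b u₂ := by
  unfold distribDeriv
  rw [hasDistribDeriv_congr h]

theorem isBV_congr (h : ∀ᵐ t ∂(volume.restrict (Ioo a b)), u₁ t = u₂ t) :
    IsBV a b u₁ ↔ IsBV a b u₂ := by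
  rw [IsBV, IsBV, hasDistribDeriv_congr h, integrableOn_congr_fun_ae h]

theorem isW11_congr (h : ∀ᵐ t ∂(volume.restrict (Ioo a b)), u₁ t = u₂ t) :
    IsW11 a b u₁ ↔ IsW11 a b u₂ := by
  rw [IsW11, IsW11, hasDistribDeriv_congr h, integrableOn_congr_fun_ae h]

end Congruence

/-! ### Examples of functions of bounded variation -/

theorem isBV_of_cumul {a b : ℝ} {u : ℝ → ℝ} {μ : SignedMeasure ℝ} (hμ : μ ∈ radonMeasures a b)
    (c : ℝ) (hu : ∀ᵐ t ∂(volume.restrict (Ioo a b)), u t = c + cumul μ t) : IsBV a b u := by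
  refine ⟨?_, μ, hμ, hasDistribDeriv_of_ae_eq c hu⟩
  rw [integrableOn_congr_fun_ae hu]
  exact (integrableOn_const (by simp)).add (Measure.integrableOn_of_bounded
    (M := (posM μ).real univ + (negM μ).real univ) (by simp)
    (measurable_cumul μ).aestronglyMeasurable (Eventually.of_forall fun t => abs_cumul_le μ t))

theorem cumul_sub_measure (μ ν : SignedMeasure ℝ) (t : ℝ) :
    cumul (μ - ν) t = cumul μ t - cumul ν t := rfl

theorem IsBV.sub {a b : ℝ} (hab : a < b) {u v : ℝ → ℝ} (hu : IsBV a b u) (hv : IsBV a b v) :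
    IsBV a b (fun t => u t - v t) := by
  obtain ⟨c₁, e₁⟩ := hu.exists_ae_eq hab
  obtain ⟨c₂, e₂⟩ := hv.exists_ae_eq hab
  refine isBV_of_cumul (μ := distribDeriv a b u - distribDeriv a b v) ?_ (c₁ - c₂) ?_
  · rw [radonMeasures, mem_ofPred_eq, VectorMeasure.restrict_sub]
    rw [show _ = _ from hu.distribDeriv_mem, show _ = _ from hv.distribDeriv_mem]
  · filter_upwards [e₁, e₂] with t h1 h2
    rw [cumul_sub_measure, h1, h2]; ring

theorem isBV_zero (a b : ℝ) : IsBV a b (fun _ => 0) :=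
  isBV_of_cumul (μ := 0) (by simp [radonMeasures]) 0 (by simp [cumul])

theorem IsBV.add {a b : ℝ} (hab : a < b) {u v : ℝ → ℝ} (hu : IsBV a b u) (hv : IsBV a b v) :
    IsBV a b (fun t => u t + v t) := by
  have := hu.sub hab ((isBV_zero a b).sub hab hv)
  simpa using this

theorem isBV_sum {a b : ℝ} (hab : a < b) {ι : Type*} (s : Finset ι) (u : ι → ℝ → ℝ)
    (h : ∀ i ∈ s, IsBV a b (u i)) : IsBV a b (fun t => ∑ i ∈ s, u i t) := by
  classical
  induction s using Finset.induction_on with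
  | empty => simpa using isBV_zero a b
  | insert i s hi ih =>
    simp only [Finset.sum_insert hi]
    exact (h i (Finset.mem_insert_self _ _)).add hab
      (ih fun j hj => h j (Finset.mem_insert_of_mem hj))

/-- The derivative is the Stieltjes measure of the right-continuous modification, which differs from
`p` only at countably many points. -/
theorem isBV_of_monotone {a b : ℝ} {p : ℝ → ℝ} (hp : Monotone p) : IsBV a b p := by
  set S := hp.stieltjesFunction with hS
  set P := S.measure.restrict (Ioo a b) with hP
  have : IsFiniteMeasure P := by
    constructor
    rw [hP, Measure.restrict_apply_univ]
    refine (measure_mono Ioo_subset_Ioc_self).trans_lt ?_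
    rw [S.measure_Ioc]
    exact ENNReal.ofReal_lt_top
  refine isBV_of_cumul (μ := P.toSignedMeasure) ?_ (S a) ?_
  · rw [radonMeasures, mem_ofPred_eq, VectorMeasure.restrict_toSignedMeasure measurableSet_Ioo]
    congr 1
    rw [hP, Measure.restrict_restrict measurableSet_Ioo, inter_self]
  · rw [ae_restrict_iff' measurableSet_Ioo]
    filter_upwards [hp.countable_not_continuousAt.ae_notMem volume] with t ht hts
    have h1 : p t = S t := by
      rw [not_not] at ht
      rw [hS, hp.stieltjesFunction_eq]
      exact (ht.tendsto.mono_left nhdsWithin_le_nhds |> tendsto_nhds_unique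
        (hp.tendsto_rightLim t)).symm
    rw [h1, cumul, Measure.toSignedMeasure_apply_measurable measurableSet_Iic, hP,
      measureReal_restrict_apply measurableSet_Iic]
    have : Iic t ∩ Ioo a b = Ioc a t := by
      ext x; simp only [mem_inter_iff, mem_Iic, mem_Ioo, mem_Ioc]
      exact ⟨fun h => ⟨h.2.1, h.1⟩, fun h => ⟨h.2, h.1, h.2.trans_lt hts.2⟩⟩
    rw [this, measureReal_def, S.measure_Ioc,
      ENNReal.toReal_ofReal (sub_nonneg.2 (S.mono hts.1.le))]
    ring

/-- Cutting a nonnegative increasing function to `(c, ∞)` or to `[d, ∞)` keeps it increasing, and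
the cut to `(c, d)` is the difference of the two. -/
theorem isBV_indicator_of_monotone {a b : ℝ} (hab : a < b) {p : ℝ → ℝ} (hp : Monotone p)
    (h0 : ∀ t, 0 ≤ p t) (c d : ℝ) : IsBV a b ((Ioo c d).indicator p) := by
  rcases le_or_gt d c with hdc | hcd
  · rw [Ioo_eq_empty (not_lt.2 hdc), indicator_empty]
    exact isBV_zero a b
  have h1 : Monotone ((Ioi c).indicator p) := by
    intro s t hst
    by_cases hs : s ∈ Ioi c
    · rw [indicator_of_mem hs, indicator_of_mem (show t ∈ Ioi c from lt_of_lt_of_le hs hst)]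
      exact hp hst
    · rw [indicator_of_notMem hs]
      exact indicator_nonneg (fun x _ => h0 x) t
  have h2 : Monotone ((Ici d).indicator p) := by
    intro s t hst
    by_cases hs : s ∈ Ici d
    · rw [indicator_of_mem hs, indicator_of_mem (show t ∈ Ici d from le_trans hs hst)]
      exact hp hst
    · rw [indicator_of_notMem hs]
      exact indicator_nonneg (fun x _ => h0 x) t
  convert (isBV_of_monotone h1).sub hab (isBV_of_monotone h2) using 1
  ext t
  by_cases h3 : c < t <;> by_cases h4 : d ≤ t
  · simp [indicator, h3, h4]
  · simp [indicator, h3, h4, not_le.1 h4]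
  · exact absurd (hcd.trans_le h4) h3
  · simp [indicator, h3, h4]

theorem isBV_indicator_sub {a b : ℝ} (hab : a < b) {p q : ℝ → ℝ} (hp : Monotone p)
    (hq : Monotone q) {C : ℝ} (hpC : ∀ t, -C ≤ p t) (hqC : ∀ t, -C ≤ q t) (c d : ℝ) :
    IsBV a b ((Ioo c d).indicator fun t => p t - q t) := by
  have h := (isBV_indicator_of_monotone hab (p := fun t => p t + C) (hp.add_const C)
    (fun t => by linarith [hpC t]) c d).sub hab
    (isBV_indicator_of_monotone hab (p := fun t => q t + C) (hq.add_const C)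
    (fun t => by linarith [hqC t]) c d)
  convert h using 1
  ext t
  by_cases ht : t ∈ Ioo c d
  · simp [indicator_of_mem ht]
  · simp [indicator_of_notMem ht]

theorem IsBV.indicator_Ioo {a b : ℝ} (hab : a < b) {u : ℝ → ℝ} (hu : IsBV a b u) (c d : ℝ) :
    IsBV a b ((Ioo c d).indicator u) := by
  obtain ⟨k, e⟩ := hu.exists_ae_eq hab
  set μ := distribDeriv a b u
  have h := isBV_indicator_sub hab (p := fun t => k + (posM μ).real (Iic t))
    (q := fun t => (negM μ).real (Iic t)) ((monotone_real_Iic _).const_add k)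
    (monotone_real_Iic _) (C := |k|)
    (fun t => by
      have : 0 ≤ (posM μ).real (Iic t) := measureReal_nonneg
      linarith [neg_abs_le k])
    (fun t => by
      have : 0 ≤ (negM μ).real (Iic t) := measureReal_nonneg
      linarith [abs_nonneg k]) c d
  refine (isBV_congr ?_).1 h
  filter_upwards [e] with t ht
  by_cases hts : t ∈ Ioo c d
  · rw [indicator_of_mem hts, indicator_of_mem hts, ht, cumul_eq]; ring
  · rw [indicator_of_notMem hts, indicator_of_notMem hts]

theorem isBV_const {a b : ℝ} (c : ℝ) : IsBV a b fun _ => c :=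
  isBV_of_monotone monotone_const

/-! ### Sobolev functions -/

theorem density_apply {a b : ℝ} {g : ℝ → ℝ} (hg : IntegrableOn g (Ioo a b)) {A : Set ℝ}
    (hA : MeasurableSet A) : density a b g A = ∫ t in A ∩ Ioo a b, g t := by
  rw [density, withDensityᵥ_apply hg hA, Measure.restrict_restrict hA]

theorem density_mem_radonMeasures (a b : ℝ) (g : ℝ → ℝ) : density a b g ∈ radonMeasures a b := by
  rw [radonMeasures, mem_ofPred_eq]
  by_cases hg : IntegrableOn g (Ioo a b)
  · ext A hA
    rw [VectorMeasure.restrict_apply _ measurableSet_Ioo hA,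
      density_apply hg (hA.inter measurableSet_Ioo), density_apply hg hA, inter_assoc, inter_self]
  · have hg' : ¬Integrable g (volume.restrict (Ioo a b)) := hg
    rw [density, Measure.withDensityᵥ, dif_neg hg', VectorMeasure.restrict_zero]

theorem rnDeriv_density {a b : ℝ} {g : ℝ → ℝ} (hg : IntegrableOn g (Ioo a b)) :
    ∀ᵐ t ∂(volume.restrict (Ioo a b)), (density a b g).rnDeriv volume t = g t := by
  have hi : Integrable ((Ioo a b).indicator g) := hg.integrable_indicator measurableSet_Ioo
  have h := SignedMeasure.eq_rnDeriv (s := density a b g) (μ := volume) 0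
    ((Ioo a b).indicator g) hi (VectorMeasure.MutuallySingular.zero_left) (by
      rw [zero_add]
      ext A hA
      rw [density_apply hg hA, withDensityᵥ_apply hi hA, setIntegral_indicator measurableSet_Ioo])
  rw [ae_restrict_iff' measurableSet_Ioo]
  filter_upwards [h] with t ht hts
  rw [← ht, indicator_of_mem hts]

theorem measurable_acDeriv (a b : ℝ) (u : ℝ → ℝ) : Measurable (acDeriv a b u) :=
  SignedMeasure.measurable_rnDeriv _ _

theorem integrable_acDeriv (a b : ℝ) (u : ℝ → ℝ) : Integrable (acDeriv a b u) :=
  SignedMeasure.integrable_rnDeriv _ _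

theorem density_congr {a b : ℝ} {g₁ g₂ : ℝ → ℝ}
    (h : ∀ᵐ t ∂(volume.restrict (Ioo a b)), g₁ t = g₂ t) : density a b g₁ = density a b g₂ :=
  WithDensityᵥEq.congr_ae h

theorem isBV_and_acDeriv_of_hasDistribDeriv_density {a b : ℝ} (hab : a < b) {u v : ℝ → ℝ}
    (hu : IntegrableOn u (Ioo a b)) (hv : IntegrableOn v (Ioo a b))
    (h : HasDistribDeriv a b u (density a b v)) :
    IsBV a b u ∧ (∀ᵐ t ∂(volume.restrict (Ioo a b)), acDeriv a b u t = v t) ∧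
      distribDeriv a b u = density a b (acDeriv a b u) := by
  have h1 := distribDeriv_eq hab hu (density_mem_radonMeasures a b v) h
  have h2 : ∀ᵐ t ∂(volume.restrict (Ioo a b)), acDeriv a b u t = v t := by
    rw [acDeriv, h1]; exact rnDeriv_density hv
  refine ⟨⟨hu, _, density_mem_radonMeasures a b v, h⟩, h2, ?_⟩
  rw [h1, density_congr h2]

theorem IsW11.isBV {a b : ℝ} (hab : a < b) {u : ℝ → ℝ} (h : IsW11 a b u) : IsBV a b u := by
  obtain ⟨hu, v, hv, hd⟩ := h
  exact (isBV_and_acDeriv_of_hasDistribDeriv_density hab hu hv hd).1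

theorem IsW11.distribDeriv_eq {a b : ℝ} (hab : a < b) {u : ℝ → ℝ} (h : IsW11 a b u) :
    distribDeriv a b u = density a b (acDeriv a b u) := by
  obtain ⟨hu, v, hv, hd⟩ := h
  exact (isBV_and_acDeriv_of_hasDistribDeriv_density hab hu hv hd).2.2

theorem cumul_density_sub {a b : ℝ} {v : ℝ → ℝ} (hv : IntegrableOn v (Ioo a b)) {s t : ℝ}
    (hs : a < s) (hst : s ≤ t) (ht : t < b) :
    cumul (density a b v) t - cumul (density a b v) s = ∫ x in Ioc s t, v x := by
  rw [cumul_sub _ hst, density_apply hv measurableSet_Ioc, inter_eq_left.2]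
  exact fun x hx => ⟨hs.trans hx.1, hx.2.trans_lt ht⟩

theorem signedIntegral_density {a b : ℝ} {v : ℝ → ℝ} (hvm : Measurable v)
    (hv : IntegrableOn v (Ioo a b)) {φ : ℝ → ℝ} (h : ContDiff ℝ 1 φ) (hc : HasCompactSupport φ) :
    signedIntegral (density a b v) φ = ∫ t in Ioo a b, φ t * v t := by
  have hf1 := isFiniteMeasure_withDensity_ofReal hv.2
  have hf2 := isFiniteMeasure_withDensity_ofReal hv.neg.2
  rw [density, withDensityᵥ_eq_withDensity_pos_part_sub_withDensity_neg_part hv]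
  have := hf2
  rw [signedIntegral_sub_of_contDiff h hc,
    integral_withDensity_eq_integral_toReal_smul (by fun_prop) (by simp),
    integral_withDensity_eq_integral_toReal_smul (by fun_prop) (by simp)]
  obtain ⟨C, hC⟩ := h.continuous.bounded_above_of_compact_support hc
  have hm : AEStronglyMeasurable φ (volume.restrict (Ioo a b)) :=
    h.continuous.aestronglyMeasurable
  rw [← integral_sub]
  · congr 1; ext t
    simp only [smul_eq_mul, ENNReal.toReal_ofReal']
    rcases le_total 0 (v t) with h0 | h0
    · rw [max_eq_left h0, max_eq_right (by linarith)]; ring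
    · rw [max_eq_right h0, max_eq_left (by linarith)]; ring
  · simp only [smul_eq_mul, ENNReal.toReal_ofReal']
    exact Integrable.mul_bdd (c := C) hv.pos_part hm (Eventually.of_forall hC)
  · simp only [smul_eq_mul, ENNReal.toReal_ofReal']
    exact Integrable.mul_bdd (c := C) hv.neg_part hm (Eventually.of_forall hC)

/-! ### The densities `f` and `ψ` -/

theorem f_le (c₀ : ℝ) (t : ℝ≥0∞) : f c₀ t ≤ ENNReal.ofReal c₀ := by
  rw [f]; split_ifs with h
  · exact mul_le_of_le_one_right' h.le
  · exact le_rfl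

theorem f_le_mul (c₀ : ℝ) (t : ℝ≥0∞) : f c₀ t ≤ ENNReal.ofReal c₀ * t := by
  rw [f]; split_ifs with h
  · exact le_rfl
  · exact le_mul_of_one_le_right' (not_lt.1 h)

theorem f_eq_min (c₀ : ℝ) (t : ℝ≥0∞) : f c₀ t = ENNReal.ofReal c₀ * min t 1 := by
  rw [f]; split_ifs with h
  · rw [min_eq_left h.le]
  · rw [min_eq_right (not_lt.1 h), mul_one]

theorem f_of_one_le (c₀ : ℝ) {t : ℝ≥0∞} (h : 1 ≤ t) : f c₀ t = ENNReal.ofReal c₀ := by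
  rw [f, if_neg (not_lt.2 h)]

theorem f_of_lt_one (c₀ : ℝ) {t : ℝ≥0∞} (h : t < 1) : f c₀ t = ENNReal.ofReal c₀ * t := by
  rw [f, if_pos h]

theorem f_mono (c₀ : ℝ) : Monotone (f c₀) := by
  intro s t h
  rw [f_eq_min, f_eq_min]
  gcongr

theorem measurable_f (c₀ : ℝ) : Measurable (f c₀) := (f_mono c₀).measurable

theorem continuous_ψ (c₀ : ℝ) : Continuous (ψ c₀) := by
  have h : ψ c₀ = fun t => if c₀ / 2 ≤ t then c₀ * t - c₀ ^ 2 / 4 else t ^ 2 := by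
    ext t
    rw [ψ]
    by_cases ht : t < c₀ / 2
    · rw [if_pos ht, if_neg (not_le.2 ht)]
    · rw [if_neg ht, if_pos (not_lt.1 ht)]
  rw [h]
  refine Continuous.if_le (by fun_prop) (by fun_prop) (by fun_prop) (by fun_prop) ?_
  intro t ht
  rw [← ht]; ring

theorem le_ψ (c₀ t : ℝ) : c₀ * t - c₀ ^ 2 / 4 ≤ ψ c₀ t := by
  rw [ψ]; split_ifs
  · nlinarith [sq_nonneg (t - c₀ / 2)]
  · exact le_rfl

/-- The easy half of the duality between `ψ` and `ξ ^ 2 / 4` on `|ξ| ≤ c₀`; `clip_mul_sub` exhibits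
the maximiser. -/
theorem mul_sub_le_ψ {c₀ : ℝ} {ξ : ℝ} (hξ : |ξ| ≤ c₀) (s : ℝ) :
    ξ * s - ξ ^ 2 / 4 ≤ ψ c₀ |s| := by
  have h1 : ξ * s ≤ |ξ| * |s| := by rw [← abs_mul]; exact le_abs_self _
  have h2 : ξ ^ 2 = |ξ| ^ 2 := (sq_abs ξ).symm
  rw [ψ]; split_ifs with h
  · nlinarith [sq_nonneg (|s| - |ξ| / 2)]
  · have : c₀ / 2 ≤ |s| := not_lt.1 h
    nlinarith [abs_nonneg ξ]

/-- `ψ(|·|)` is the infimal convolution of the square and `c₀|·|`, and this is the half that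
eliminates `g`. Below the threshold use `|s| < c₀ / 2`, above it complete the square. -/
theorem ψ_le_add {c₀ : ℝ} (hc₀ : 0 < c₀) (s g : ℝ) : ψ c₀ |s| ≤ (s - g) ^ 2 + c₀ * |g| := by
  have h1 : |s| ≤ |s - g| + |g| := by
    have := abs_add_le (s - g) g
    simpa using this
  have h2 : (s - g) ^ 2 = |s - g| ^ 2 := (sq_abs _).symm
  rw [ψ, h2]
  split_ifs with h
  · nlinarith [abs_nonneg g, abs_nonneg (s - g), abs_nonneg s, sq_nonneg (|s| - |s - g|)]
  · nlinarith [sq_nonneg (|s - g| - c₀ / 2)]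

theorem ofReal_ψ_le {c₀ : ℝ} (hc₀ : 0 < c₀) (s g : ℝ) :
    ENNReal.ofReal (ψ c₀ |s|) ≤ ‖s - g‖ₑ ^ 2 + ENNReal.ofReal c₀ * ‖g‖ₑ := by
  refine (ENNReal.ofReal_le_ofReal (ψ_le_add hc₀ s g)).trans_eq ?_
  rw [ENNReal.ofReal_add (sq_nonneg _) (by positivity), ENNReal.ofReal_mul hc₀.le,
    ← Real.enorm_eq_ofReal_abs, ← sq_abs, ENNReal.ofReal_pow (abs_nonneg _),
    ← Real.enorm_eq_ofReal_abs]

/-! ### The nonlocal term and its lower bound -/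

theorem measurable_lintegral_window (a b ε : ℝ) {h : ℝ → ℝ≥0∞} (hh : Measurable h) :
    Measurable fun x => ∫⁻ t in Ioo (x - ε) (x + ε) ∩ Ioo a b, h t := by
  have hm : MeasurableSet {p : ℝ × ℝ | p.1 - ε < p.2 ∧ p.2 < p.1 + ε ∧ a < p.2 ∧ p.2 < b} := by
    exact (measurableSet_lt (f := fun p : ℝ × ℝ => p.1 - ε) (g := fun p => p.2) (by fun_prop)
      (by fun_prop)).inter ((measurableSet_lt (f := fun p : ℝ × ℝ => p.2) (g := fun p => p.1 + ε)
      (by fun_prop) (by fun_prop)).inter ((measurableSet_lt (f := fun _ : ℝ × ℝ => a)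
      (g := fun p => p.2) (by fun_prop) (by fun_prop)).inter (measurableSet_lt
      (f := fun p : ℝ × ℝ => p.2) (g := fun _ => b) (by fun_prop) (by fun_prop))))
  have h1 : ∀ x, ∫⁻ t in Ioo (x - ε) (x + ε) ∩ Ioo a b, h t = ∫⁻ t,
      {p : ℝ × ℝ | p.1 - ε < p.2 ∧ p.2 < p.1 + ε ∧ a < p.2 ∧ p.2 < b}.indicator
        (fun p => h p.2) (x, t) := by
    intro x
    rw [← lintegral_indicator (measurableSet_Ioo.inter measurableSet_Ioo)]
    congr 1; ext t
    simp only [indicator, mem_inter_iff, mem_Ioo, mem_ofPred_eq, and_assoc]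
  simp_rw [h1]
  exact Measurable.lintegral_prod_right' ((hh.comp measurable_snd).indicator hm)

theorem measurable_average_window (a b ε : ℝ) {h : ℝ → ℝ≥0∞} (hh : Measurable h) :
    Measurable fun x => ⨍⁻ t in Ioo (x - ε) (x + ε) ∩ Ioo a b, h t ∂volume := by
  simp_rw [setLAverage_eq]
  refine (measurable_lintegral_window a b ε hh).div ?_
  have := measurable_lintegral_window a b ε (h := fun _ => 1) measurable_const
  simpa using this

/-- An unclipped window has length `2ε`; this is the origin of the factor one half in the limiting
surface energy. -/
theorem mul_average_window_eq {a b ε x : ℝ} (hε : 0 < ε) (h1 : a + ε ≤ x) (h2 : x ≤ b - ε)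
    (h : ℝ → ℝ≥0∞) :
    ENNReal.ofReal ε * ⨍⁻ t in Ioo (x - ε) (x + ε) ∩ Ioo a b, h t ∂volume =
      (∫⁻ t in Ioo (x - ε) (x + ε), h t) / 2 := by
  have h3 : Ioo (x - ε) (x + ε) ∩ Ioo a b = Ioo (x - ε) (x + ε) :=
    inter_eq_left.2 (Ioo_subset_Ioo (by linarith) (by linarith))
  rw [h3, setLAverage_eq, Real.volume_Ioo, show x + ε - (x - ε) = ε * 2 by ring,
    ENNReal.ofReal_mul hε.le, ENNReal.div_eq_inv_mul, ENNReal.div_eq_inv_mul,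
    ENNReal.mul_inv (Or.inr (by simp)) (Or.inr (by simp)), ← mul_assoc, ← mul_assoc,
    ENNReal.mul_inv_cancel (by simpa using hε) (by simp), one_mul]
  simp

/-- The nonlocal term of the energy. -/
def nonlocal (a b c₀ ε : ℝ) (g : ℝ → ℝ) : ℝ≥0∞ :=
  (ENNReal.ofReal ε)⁻¹ * ∫⁻ x in Ioo a b,
    f c₀ (ENNReal.ofReal ε * ⨍⁻ t in Ioo (x - ε) (x + ε) ∩ Ioo a b, ‖g t‖ₑ ∂volume)

theorem nonlocal_congr {a b : ℝ} (c₀ ε : ℝ) {g₁ g₂ : ℝ → ℝ}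
    (h : ∀ᵐ t ∂(volume.restrict (Ioo a b)), g₁ t = g₂ t) :
    nonlocal a b c₀ ε g₁ = nonlocal a b c₀ ε g₂ := by
  rw [nonlocal, nonlocal]
  congr 2; ext x; congr 2
  apply laverage_congr
  filter_upwards [ae_restrict_mono inter_subset_right h] with t ht
  rw [ht]

theorem lintegral_biUnion_finset_le {ι : Type*} (s : Finset ι) (A : ι → Set ℝ) (h : ℝ → ℝ≥0∞) :
    ∫⁻ t in ⋃ k ∈ s, A k, h t ≤ ∑ k ∈ s, ∫⁻ t in A k, h t := by
  classical
  induction s using Finset.induction_on with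
  | empty => simp
  | insert k s hk ih =>
    rw [Finset.set_biUnion_insert, Finset.sum_insert hk]
    exact (lintegral_union_le _ _ _).trans (by gcongr)

/-- Averaging over a lattice of mesh `2ε`. -/
theorem exists_sum_le_lintegral {ε : ℝ} (hε : 0 < ε) {Φ : ℝ → ℝ≥0∞} (hΦ : Measurable Φ) (p : ℝ)
    (M : ℕ) : ∃ y ∈ Ico p (p + 2 * ε),
      ENNReal.ofReal (2 * ε) * ∑ k ∈ Finset.range M, Φ (y + 2 * k * ε) ≤
        ∫⁻ x in Ico p (p + 2 * M * ε), Φ x := by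
  have hvol : volume (Ico p (p + 2 * ε)) = ENNReal.ofReal (2 * ε) := by
    rw [Real.volume_Ico]; congr 1; ring
  have h0 : ENNReal.ofReal (2 * ε) ≠ 0 := by simp [hε]
  -- Some offset does no worse than the mean over one period, and the translates of that period tile
  -- the range of integration.
  obtain ⟨y, hy, hle⟩ := exists_le_setLAverage (μ := volume) (s := Ico p (p + 2 * ε))
    (f := fun y => ∑ k ∈ Finset.range M, Φ (y + 2 * k * ε)) (by rw [hvol]; exact h0)
    (by rw [hvol]; exact ENNReal.ofReal_ne_top) (by fun_prop)
  refine ⟨y, hy, ?_⟩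
  rw [setLAverage_eq, hvol, ENNReal.le_div_iff_mul_le (Or.inl h0) (Or.inl ENNReal.ofReal_ne_top),
    mul_comm] at hle
  refine hle.trans ?_
  rw [lintegral_finsetSum _ (fun k _ => by fun_prop)]
  have h1 : ∀ k : ℕ, ∫⁻ y in Ico p (p + 2 * ε), Φ (y + 2 * k * ε) =
      ∫⁻ x in Ico (p + 2 * k * ε) (p + 2 * (k + 1 : ℕ) * ε), Φ x := by
    intro k
    rw [← (measurePreserving_add_right volume (2 * (k : ℝ) * ε)).setLIntegral_comp_preimage
      measurableSet_Ico hΦ, preimage_add_const_Ico]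
    congr 3
    · ring
    · push_cast; ring
  simp_rw [h1]
  have hmono : Monotone fun k : ℕ => p + 2 * k * ε := by
    intro i j hij
    have : (i : ℝ) ≤ j := by exact_mod_cast hij
    simp only
    nlinarith
  rw [← lintegral_biUnion_finset]
  · apply lintegral_mono_set
    intro x hx
    simp only [mem_iUnion, Finset.mem_range, exists_prop] at hx
    obtain ⟨k, hk, hx⟩ := hx
    refine ⟨le_trans ?_ hx.1, hx.2.trans_le (hmono (Nat.succ_le_of_lt hk))⟩
    have := hmono (Nat.zero_le k)
    simpa using this
  · intro i _ j _ hij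
    exact (hmono.pairwise_disjoint_on_Ico_succ) hij
  · exact fun _ _ => measurableSet_Ico

theorem exists_lattice_index {p x ε : ℝ} (hε : 0 < ε) (hx : p ≤ x) {M : ℕ}
    (hxM : x < p + 2 * M * ε) :
    ∃ k < M, x ∈ Ico (p + 2 * k * ε) (p + 2 * k * ε + 2 * ε) := by
  have h2 : (0 : ℝ) < 2 * ε := by linarith
  refine ⟨⌊(x - p) / (2 * ε)⌋₊, ?_, ?_, ?_⟩
  · rw [Nat.floor_lt (by apply div_nonneg <;> linarith), div_lt_iff₀ h2]
    linarith
  · have := Nat.floor_le (a := (x - p) / (2 * ε)) (by apply div_nonneg <;> linarith)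
    rw [le_div_iff₀ h2] at this
    linarith
  · have := Nat.lt_floor_add_one ((x - p) / (2 * ε))
    rw [div_lt_iff₀ h2] at this
    linarith

/-- Away from finitely many windows the energy controls `∫ ψ(|v|)`, and each window costs at
least `2 c₀`. -/
theorem exists_finset_lintegral_ψ_le {a b c₀ ε : ℝ} (hc₀ : 0 < c₀) (hε : 0 < ε) {v g : ℝ → ℝ}
    (hg : Measurable g) :
    ∃ T : Finset ℝ, (∀ t ∈ T, t ∈ Ioo a b) ∧ ∀ A, MeasurableSet A →
      A ⊆ Ioo (a + 4 * ε) (b - 4 * ε) → (∀ t ∈ T, ∀ x ∈ A, ε < |x - t|) →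
      (∫⁻ t in A, ENNReal.ofReal (ψ c₀ |v t|)) + 2 * ENNReal.ofReal c₀ * T.card ≤
        (∫⁻ t in Ioo a b, ‖v t - g t‖ₑ ^ 2) + nonlocal a b c₀ ε g := by
  classical
  -- In a short interval the margins `4ε` leave only the empty set.
  by_cases hlarge : b - a < 2 * ε
  · refine ⟨∅, by simp, fun A _ hAs _ => ?_⟩
    have : A = ∅ := by
      rw [Ioo_eq_empty (by linarith)] at hAs
      exact subset_empty_iff.1 hAs
    simp [this]
  rw [not_lt] at hlarge
  have h2 : (0 : ℝ) < 2 * ε := by linarith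
  set C := ENNReal.ofReal c₀ with hC
  set G : ℝ → ℝ≥0∞ := fun t => ‖g t‖ₑ with hG
  have hGm : Measurable G := hg.enorm
  set Φ : ℝ → ℝ≥0∞ := fun x => f c₀ (ENNReal.ofReal ε *
    ⨍⁻ t in Ioo (x - ε) (x + ε) ∩ Ioo a b, ‖g t‖ₑ ∂volume) with hΦ
  have hΦm : Measurable Φ :=
    (measurable_f c₀).comp ((measurable_average_window a b ε hGm).const_mul _)
  -- With `y` in `[a + ε, a + 3ε)` this `M` keeps every window inside `(a,b)`, while the windows
  -- still cover everything at distance `4ε` from the ends.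
  set M := ⌊(b - a - 2 * ε) / (2 * ε)⌋₊ with hM
  have hM1 : 2 * (M : ℝ) * ε ≤ b - a - 2 * ε := by
    have := Nat.floor_le (a := (b - a - 2 * ε) / (2 * ε)) (by apply div_nonneg <;> linarith)
    rw [le_div_iff₀ h2] at this
    linarith
  have hM2 : b - a - 2 * ε < 2 * (M : ℝ) * ε + 2 * ε := by
    have := Nat.lt_floor_add_one ((b - a - 2 * ε) / (2 * ε))
    rw [div_lt_iff₀ h2] at this
    linarith
  obtain ⟨y, hy, hle⟩ := exists_sum_le_lintegral hε hΦm (a + ε) M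
  have hpos : ∀ k ∈ Finset.range M, a + ε ≤ y + 2 * k * ε ∧ y + 2 * k * ε ≤ b - ε := by
    intro k hk
    have hk' : (k : ℝ) + 1 ≤ M := by exact_mod_cast Nat.succ_le_of_lt (Finset.mem_range.1 hk)
    have hk0 : (0 : ℝ) ≤ k := k.cast_nonneg
    constructor
    · nlinarith [hy.1]
    · nlinarith [hy.2]
  set m : ℕ → ℝ≥0∞ := fun k => ∫⁻ t in Ioo (y + 2 * k * ε - ε) (y + 2 * k * ε + ε), G t with hm
  have hΦk : ∀ k ∈ Finset.range M, Φ (y + 2 * k * ε) = f c₀ (m k / 2) := by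
    intro k hk
    simp only [hΦ]
    rw [mul_average_window_eq hε (hpos k hk).1 (hpos k hk).2]
  set bad := (Finset.range M).filter fun k => 2 ≤ m k with hbad
  set good := (Finset.range M).filter fun k => ¬2 ≤ m k with hgood
  have hinj : Function.Injective fun k : ℕ => y + 2 * (k : ℝ) * ε := by
    intro i j hij
    have h3 : (i : ℝ) * (2 * ε) = j * (2 * ε) := by simp only at hij; linarith
    exact_mod_cast mul_right_cancel₀ h2.ne' h3
  -- Twice `f (m / 2)` is `2c₀` for a window of mass at least 2 and exactly `c₀ m` otherwise. The
  -- factor 2 is the mesh `2ε` divided by `ε`.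
  have hsum : (∑ k ∈ good, C * m k) + 2 * C * bad.card ≤ nonlocal a b c₀ ε g := by
    have e1 : (∑ k ∈ good, C * m k) + 2 * C * bad.card =
        2 * ∑ k ∈ Finset.range M, Φ (y + 2 * k * ε) := by
      rw [Finset.sum_congr rfl hΦk, ← Finset.sum_filter_add_sum_filter_not (Finset.range M)
        (fun k => 2 ≤ m k), mul_add, add_comm]
      congr 1
      · rw [Finset.sum_congr rfl (g := fun _ => C)]
        · rw [Finset.sum_const, nsmul_eq_mul]; ring
        · intro k hk
          apply f_of_one_le
          rw [ENNReal.le_div_iff_mul_le (by simp) (by simp), one_mul]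
          exact (Finset.mem_filter.1 hk).2
      · rw [Finset.mul_sum]
        apply Finset.sum_congr rfl
        intro k hk
        rw [f_of_lt_one, ← mul_assoc, mul_comm 2, mul_assoc,
          ENNReal.mul_div_cancel (by simp) (by simp)]
        rw [ENNReal.div_lt_iff (by simp) (by simp), one_mul]
        exact not_le.1 (Finset.mem_filter.1 hk).2
    have e2 : ∫⁻ x in Ico (a + ε) (a + ε + 2 * M * ε), Φ x ≤ ∫⁻ x in Ioo a b, Φ x :=
      lintegral_mono_set fun x hx => ⟨by linarith [hx.1], by linarith [hx.2]⟩
    rw [e1, nonlocal]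
    have e3 := hle.trans e2
    rw [show (2 : ℝ) * ε = ε * 2 by ring, ENNReal.ofReal_mul hε.le, mul_assoc] at e3
    have e4 : ENNReal.ofReal ε ≠ 0 := by simpa using hε
    calc 2 * ∑ k ∈ Finset.range M, Φ (y + 2 * k * ε)
        = (ENNReal.ofReal ε)⁻¹ * (ENNReal.ofReal ε * (ENNReal.ofReal 2 *
            ∑ k ∈ Finset.range M, Φ (y + 2 * k * ε))) := by
          rw [← mul_assoc, ENNReal.inv_mul_cancel e4 (by simp), one_mul]; simp
      _ ≤ _ := by gcongr
  refine ⟨bad.image fun k : ℕ => y + 2 * (k : ℝ) * ε, ?_, ?_⟩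
  · intro t ht
    obtain ⟨k, hk, rfl⟩ := Finset.mem_image.1 ht
    have := hpos k (Finset.mem_filter.1 hk).1
    exact ⟨by linarith [this.1], by linarith [this.2]⟩
  intro A hA hAs hAT
  rw [Finset.card_image_of_injective _ hinj]
  -- A point at distance more than `ε` from every bad centre must lie in a good window.
  have hcover : A ⊆ ⋃ k ∈ good, Ico (y + 2 * k * ε - ε) (y + 2 * k * ε + ε) := by
    intro x hx
    obtain ⟨k, hk, hxk⟩ := exists_lattice_index (p := y - ε) (x := x) (M := M) hε
      (by linarith [(hAs hx).1, hy.2]) (by linarith [(hAs hx).2, hy.1])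
    have hxk' : x ∈ Ico (y + 2 * k * ε - ε) (y + 2 * k * ε + ε) :=
      ⟨by linarith [hxk.1], by linarith [hxk.2]⟩
    simp only [mem_iUnion]
    refine ⟨k, Finset.mem_filter.2 ⟨Finset.mem_range.2 hk, fun hb => ?_⟩, hxk'⟩
    have := hAT _ (Finset.mem_image_of_mem _ (Finset.mem_filter.2 ⟨Finset.mem_range.2 hk, hb⟩)) x hx
    rw [lt_abs] at this
    rcases this with h | h
    · linarith [hxk'.2]
    · linarith [hxk'.1]
  have hAg : ∫⁻ t in A, G t ≤ ∑ k ∈ good, m k := by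
    refine (lintegral_mono_set hcover).trans ?_
    refine (lintegral_biUnion_finset_le good _ G).trans (Finset.sum_le_sum fun k _ => ?_)
    exact (setLIntegral_congr Ioo_ae_eq_Ico).ge
  have hA1 : ∫⁻ t in A, ENNReal.ofReal (ψ c₀ |v t|) ≤
      (∫⁻ t in Ioo a b, ‖v t - g t‖ₑ ^ 2) + C * ∫⁻ t in A, G t := by
    calc ∫⁻ t in A, ENNReal.ofReal (ψ c₀ |v t|)
        ≤ ∫⁻ t in A, (‖v t - g t‖ₑ ^ 2 + C * G t) :=
          lintegral_mono fun t => ofReal_ψ_le hc₀ (v t) (g t)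
      _ = (∫⁻ t in A, ‖v t - g t‖ₑ ^ 2) + C * ∫⁻ t in A, G t := by
          rw [lintegral_add_right _ (hGm.const_mul C), lintegral_const_mul _ hGm]
      _ ≤ _ := by
          gcongr
          exact hAs.trans (Ioo_subset_Ioo (by linarith) (by linarith))
  calc (∫⁻ t in A, ENNReal.ofReal (ψ c₀ |v t|)) + 2 * C * bad.card
      ≤ (∫⁻ t in Ioo a b, ‖v t - g t‖ₑ ^ 2) + C * (∑ k ∈ good, m k) + 2 * C * bad.card := by
        gcongr
        exact hA1.trans (by gcongr)
    _ = (∫⁻ t in Ioo a b, ‖v t - g t‖ₑ ^ 2) + ((∑ k ∈ good, C * m k) + 2 * C * bad.card) := by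
        rw [Finset.mul_sum, add_assoc]
    _ ≤ _ := by gcongr

/-! ### Compactness of the windows -/

/-- The dummy value `a` is used when the cardinality is wrong, so that every set of the sequence
yields a point of the compact cube `[a,b]^m`. -/
theorem exists_fin_enum (T : Finset ℝ) {a b : ℝ} (hab : a < b) (hT : ∀ t ∈ T, t ∈ Ioo a b) (m : ℕ) :
    ∃ e : Fin m → ℝ, (∀ i, e i ∈ Icc a b) ∧ (T.card = m → ∀ t ∈ T, ∃ i, e i = t) := by
  by_cases h : T.card = m
  · subst h
    refine ⟨fun i => (T.equivFin.symm i : ℝ), fun i => Ioo_subset_Icc_self (hT _ (Subtype.mem _)),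
      fun _ t ht => ⟨T.equivFin ⟨t, ht⟩, by simp⟩⟩
  · exact ⟨fun _ => a, fun _ => ⟨le_rfl, hab.le⟩, fun h' => absurd h' h⟩

/-- Each bad window costs `2c₀`, so their number is bounded. Along a subsequence it is a constant
`m` and the centres converge in `[a,b]^m`. A compact set off the limits is eventually far from all
windows. -/
theorem exists_subseq_finset {a b c₀ : ℝ} (hab : a < b) (hc₀ : 0 < c₀) {c : ℝ≥0∞} (hc : c ≠ ∞)
    {ε : ℕ → ℝ} (hε0 : Tendsto ε atTop (𝓝 0)) (v : ℕ → ℝ → ℝ)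
    (T : ℕ → Finset ℝ) (hT : ∀ k, ∀ t ∈ T k, t ∈ Ioo a b)
    (h : ∀ k A, MeasurableSet A → A ⊆ Ioo (a + 4 * ε k) (b - 4 * ε k) →
      (∀ t ∈ T k, ∀ x ∈ A, ε k < |x - t|) →
      (∫⁻ t in A, ENNReal.ofReal (ψ c₀ |v k t|)) + 2 * ENNReal.ofReal c₀ * (T k).card ≤ c) :
    ∃ (B : Finset ℝ) (φ : ℕ → ℕ), StrictMono φ ∧ (∀ t ∈ B, t ∈ Ioo a b) ∧
      ∀ A, IsCompact A → A ⊆ Ioo a b \ B → ∀ᶠ k in atTop,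
        (∫⁻ t in A, ENNReal.ofReal (ψ c₀ |v (φ k) t|)) + 2 * ENNReal.ofReal c₀ * B.card ≤ c := by
  classical
  have hC0 : 2 * ENNReal.ofReal c₀ ≠ 0 := by simp [hc₀]
  have hC1 : 2 * ENNReal.ofReal c₀ ≠ ∞ := ENNReal.mul_ne_top (by simp) ENNReal.ofReal_ne_top
  obtain ⟨N, hN⟩ : ∃ N : ℕ, ∀ k, (T k).card ≤ N := by
    obtain ⟨N, hN⟩ := ENNReal.exists_nat_gt (ENNReal.div_ne_top hc hC0)
    refine ⟨N, fun k => ?_⟩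
    -- The empty set isolates the cost of the windows.
    have h1 := h k ∅ MeasurableSet.empty (by simp) (by simp)
    simp only [Measure.restrict_empty, lintegral_zero_measure, zero_add] at h1
    have h2 : ((T k).card : ℝ≥0∞) ≤ c / (2 * ENNReal.ofReal c₀) := by
      rw [ENNReal.le_div_iff_mul_le (Or.inl hC0) (Or.inl hC1), mul_comm]; exact h1
    exact_mod_cast (h2.trans_lt hN).le
  obtain ⟨m, -, φ₁, hφ₁, hm⟩ := (Set.finite_Iic N).isCompact.tendsto_subseq
    (x := fun k => (T k).card) hN
  have hm' : ∀ᶠ k in atTop, (T (φ₁ k)).card = m := by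
    rw [nhds_discrete, tendsto_pure] at hm; exact hm
  choose e he1 he2 using fun k => exists_fin_enum (T (φ₁ k)) hab (hT _) m
  obtain ⟨l, -, φ₂, hφ₂, hl⟩ := (isCompact_univ_pi fun _ : Fin m => isCompact_Icc
    (a := a) (b := b)).tendsto_subseq (x := e) (fun k i _ => he1 k i)
  -- Centres may merge in the limit or escape to the endpoints; both only decrease the count, and
  -- the inequality survives.
  set B := (Finset.univ.image l).filter fun t => t ∈ Ioo a b with hB
  have hBm : B.card ≤ m := (Finset.card_filter_le _ _).trans
    (Finset.card_image_le.trans (by simp))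
  refine ⟨B, φ₁ ∘ φ₂, hφ₁.comp hφ₂, fun t ht => (Finset.mem_filter.1 ht).2, ?_⟩
  intro A hA hAB
  have hAU : A ⊆ Ioo a b \ range l := by
    intro x hx
    refine ⟨(hAB hx).1, ?_⟩
    rintro ⟨i, rfl⟩
    exact (hAB hx).2 (Finset.mem_coe.2 (Finset.mem_filter.2 ⟨Finset.mem_image_of_mem _
      (Finset.mem_univ i), (hAB hx).1⟩))
  obtain ⟨δ, hδ, hδA⟩ := hA.exists_thickening_subset_open
    (isOpen_Ioo.sdiff (Set.finite_range l).isClosed) hAU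
  have hball : ∀ x ∈ A, ∀ y, |y - x| < δ → y ∈ Ioo a b \ range l := by
    intro x hx y hy
    exact hδA (Metric.mem_thickening_iff.2 ⟨x, hx, by rwa [Real.dist_eq]⟩)
  have hl' : ∀ᶠ k in atTop, ∀ i, |e (φ₂ k) i - l i| < δ / 2 := by
    rw [eventually_all]
    intro i
    have h1 := (tendsto_pi_nhds.1 hl) i
    have h2 := Metric.tendsto_nhds.1 h1 (δ / 2) (by linarith)
    filter_upwards [h2] with k hk
    simpa [Real.dist_eq] using hk
  have hε' : ∀ᶠ k in atTop, ε (φ₁ (φ₂ k)) < δ / 8 :=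
    ((hε0.comp hφ₁.tendsto_atTop).comp hφ₂.tendsto_atTop).eventually
      (gt_mem_nhds (by linarith))
  filter_upwards [hl', hε', hφ₂.tendsto_atTop.eventually hm'] with k h1 h2 h3
  refine le_trans ?_ (h (φ₁ (φ₂ k)) A hA.measurableSet ?_ ?_)
  · rw [h3]
    simp only [Function.comp_apply]
    gcongr
  · intro x hx
    have h4 := (hball x hx (x - δ / 2) (by rw [abs_lt]; constructor <;> linarith)).1
    have h5 := (hball x hx (x + δ / 2) (by rw [abs_lt]; constructor <;> linarith)).1
    constructor
    · linarith [h4.1]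
    · linarith [h5.2]
  · intro t ht x hx
    obtain ⟨i, rfl⟩ := he2 (φ₂ k) h3 t ht
    have h4 : δ ≤ |l i - x| := by
      by_contra hlt
      exact (hball x hx (l i) (not_le.1 hlt)).2 (mem_range_self i)
    have h5 : |l i - x| ≤ |e (φ₂ k) i - l i| + |x - e (φ₂ k) i| := by
      rw [← abs_neg (e (φ₂ k) i - l i), ← abs_neg (x - e (φ₂ k) i)]
      refine (abs_add_le _ _).trans' (le_of_eq ?_)
      congr 1; ring
    linarith [h1 i]

theorem exists_of_redEeps_lt {a b c₀ ε : ℝ} {K c : ℝ≥0∞} (hc₀ : 0 < c₀) (hε : 0 < ε) {u : ℝ → ℝ}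
    (h : redEeps a b c₀ K ε u < c) :
    IsW11 a b u ∧ eLpNorm u ∞ (volume.restrict (Ioo a b)) ≤ K ∧
      ∃ T : Finset ℝ, (∀ t ∈ T, t ∈ Ioo a b) ∧ ∀ A, MeasurableSet A →
      A ⊆ Ioo (a + 4 * ε) (b - 4 * ε) → (∀ t ∈ T, ∀ x ∈ A, ε < |x - t|) →
      (∫⁻ t in A, ENNReal.ofReal (ψ c₀ |acDeriv a b u t|)) +
        2 * ENNReal.ofReal c₀ * T.card ≤ c := by
  simp only [redEeps, Eeps, iInf_lt_iff] at h
  obtain ⟨γ, hγ, g, ⟨h1, h2, h3, h4, h5⟩, hlt⟩ := h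
  refine ⟨h1, h2, ?_⟩
  have hg : ∀ᵐ t ∂(volume.restrict (Ioo a b)), g t = h3.1.mk g t := h3.1.ae_eq_mk
  obtain ⟨T, hT, H⟩ := exists_finset_lintegral_ψ_le (a := a) (b := b) (v := acDeriv a b u) hc₀ hε
    (g := h3.1.mk g) h3.1.stronglyMeasurable_mk.measurable
  refine ⟨T, hT, fun A hA hAs hAT => (H A hA hAs hAT).trans (le_of_eq_of_le ?_ hlt.le)⟩
  rw [← nonlocal_congr c₀ ε hg, nonlocal]
  congr 1
  apply lintegral_congr_ae
  filter_upwards [hg] with t ht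
  rw [ht]

/-! ### Limits of sequences with bounded energy -/

theorem eVariationOn_cumul_density_le {a b : ℝ} {v : ℝ → ℝ} (hv : IntegrableOn v (Ioo a b))
    (k s t : ℝ) (hs : a < s) (ht : t < b) :
    eVariationOn (fun x => k + cumul (density a b v) x) (Icc s t) ≤ ∫⁻ x in Icc s t, ‖v x‖ₑ := by
  apply iSup_le
  rintro ⟨n, x, hx, hxs⟩
  have h1 : ∀ i, edist (k + cumul (density a b v) (x (i + 1))) (k + cumul (density a b v) (x i)) ≤
      ∫⁻ y in Ioc (x i) (x (i + 1)), ‖v y‖ₑ := by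
    intro i
    rw [edist_eq_enorm_sub, add_sub_add_left_eq_sub, cumul_density_sub hv (hs.trans_le (hxs i).1)
      (hx i.le_succ) ((hxs (i + 1)).2.trans_lt ht)]
    exact enorm_integral_le_lintegral_enorm _
  refine (Finset.sum_le_sum fun i _ => h1 i).trans ?_
  rw [← lintegral_biUnion_finset]
  · apply lintegral_mono_set
    intro y hy
    simp only [mem_iUnion, exists_prop] at hy
    obtain ⟨i, -, hy⟩ := hy
    exact ⟨(hxs i).1.trans hy.1.le, hy.2.trans (hxs (i + 1)).2⟩
  · exact fun i _ j _ hij => (hx.pairwise_disjoint_on_Ioc_succ) hij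
  · exact fun _ _ => measurableSet_Ioc

/-- Linear growth of `ψ` turns an energy bound into a bound on the variation. -/
theorem enorm_mul_le_ψ {c₀ : ℝ} (hc₀ : 0 < c₀) (s : ℝ) :
    ENNReal.ofReal c₀ * ‖s‖ₑ ≤ ENNReal.ofReal (ψ c₀ |s|) + ENNReal.ofReal (c₀ ^ 2 / 4) := by
  rw [Real.enorm_eq_ofReal_abs, ← ENNReal.ofReal_mul hc₀.le]
  refine le_trans ?_ ENNReal.ofReal_add_le
  exact ENNReal.ofReal_le_ofReal (by linarith [le_ψ c₀ |s|])

/-- A sequence of primitives `k₀ + ∫ v` whose energy is bounded away from a finite set `B` and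
which converges almost everywhere to `u`. -/
structure BoundedSeq (a b c₀ : ℝ) (c : ℝ≥0∞) (B : Finset ℝ) (u : ℝ → EReal) (v : ℕ → ℝ → ℝ)
    (k₀ : ℕ → ℝ) : Prop where
  hab : a < b
  hc₀ : 0 < c₀
  hc : c ≠ ∞
  meas : ∀ k, Measurable (v k)
  int : ∀ k, IntegrableOn (v k) (Ioo a b)
  mem : ∀ t ∈ B, t ∈ Ioo a b
  bound : ∀ A, IsCompact A → A ⊆ Ioo a b \ B → ∀ᶠ k in atTop,
    (∫⁻ t in A, ENNReal.ofReal (ψ c₀ |v k t|)) + 2 * ENNReal.ofReal c₀ * B.card ≤ c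
  conv : ∀ᵐ t ∂(volume.restrict (Ioo a b)),
    Tendsto (fun k => ((k₀ k + cumul (density a b (v k)) t : ℝ) : EReal)) atTop (𝓝 (u t))

namespace BoundedSeq

variable {a b c₀ : ℝ} {c : ℝ≥0∞} {B : Finset ℝ} {u : ℝ → EReal} {v : ℕ → ℝ → ℝ} {k₀ : ℕ → ℝ}

/-- The bound for the total variations. -/
def varBound (a b c₀ : ℝ) (c : ℝ≥0∞) : ℝ≥0∞ :=
  (c + ENNReal.ofReal (c₀ ^ 2 / 4) * ENNReal.ofReal (b - a)) / ENNReal.ofReal c₀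

theorem varBound_ne_top (h : BoundedSeq a b c₀ c B u v k₀) : varBound a b c₀ c ≠ ∞ := by
  refine ENNReal.div_ne_top (ENNReal.add_ne_top.2 ⟨h.hc, ?_⟩) (by simp [h.hc₀])
  exact ENNReal.mul_ne_top ENNReal.ofReal_ne_top ENNReal.ofReal_ne_top

theorem eventually_lintegral_le (h : BoundedSeq a b c₀ c B u v k₀) {A : Set ℝ} (hA : IsCompact A)
    (hAB : A ⊆ Ioo a b \ B) : ∀ᶠ k in atTop, ∫⁻ t in A, ‖v k t‖ₑ ≤ varBound a b c₀ c := by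
  filter_upwards [h.bound A hA hAB] with k hk
  rw [varBound, ENNReal.le_div_iff_mul_le (Or.inl (by simp [h.hc₀])) (Or.inl ENNReal.ofReal_ne_top),
    mul_comm, ← lintegral_const_mul _ (h.meas k).enorm]
  calc ∫⁻ t in A, ENNReal.ofReal c₀ * ‖v k t‖ₑ
      ≤ ∫⁻ t in A, (ENNReal.ofReal (ψ c₀ |v k t|) + ENNReal.ofReal (c₀ ^ 2 / 4)) :=
        lintegral_mono fun t => enorm_mul_le_ψ h.hc₀ _
    _ = (∫⁻ t in A, ENNReal.ofReal (ψ c₀ |v k t|)) + ENNReal.ofReal (c₀ ^ 2 / 4) * volume A := by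
        rw [lintegral_add_right _ measurable_const, lintegral_const, Measure.restrict_apply_univ]
    _ ≤ _ := by
        gcongr
        · exact le_self_add.trans hk
        · rw [← Real.volume_Ioo]
          exact measure_mono (hAB.trans sdiff_subset)

theorem eventually_eVariationOn_le (h : BoundedSeq a b c₀ c B u v k₀) {s t : ℝ}
    (hst : s ≤ t) (hB : Icc s t ⊆ Ioo a b \ B) :
    ∀ᶠ k in atTop, eVariationOn (fun x => k₀ k + cumul (density a b (v k)) x) (Icc s t) ≤
      varBound a b c₀ c := by
  filter_upwards [h.eventually_lintegral_le isCompact_Icc hB] with k hk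
  exact (eVariationOn_cumul_density_le (h.int k) _ s t (hB (left_mem_Icc.2 hst)).1.1
    (hB (right_mem_Icc.2 hst)).1.2).trans hk

theorem eventually_abs_sub_le (h : BoundedSeq a b c₀ c B u v k₀) {s t : ℝ}
    (hst : s ≤ t) (hB : Icc s t ⊆ Ioo a b \ B) :
    ∀ᶠ k in atTop, ∀ x ∈ Icc s t, ∀ y ∈ Icc s t,
      |(k₀ k + cumul (density a b (v k)) x) - (k₀ k + cumul (density a b (v k)) y)| ≤
      (varBound a b c₀ c).toReal := by
  filter_upwards [h.eventually_eVariationOn_le hst hB] with k hk x hx y hy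
  have h1 := (eVariationOn.edist_le (fun x => k₀ k + cumul (density a b (v k)) x) hx hy).trans hk
  rw [edist_dist, Real.dist_eq] at h1
  exact (ENNReal.ofReal_le_iff_le_toReal h.varBound_ne_top).1 h1

/-- The points of convergence. -/
def convSet (u : ℝ → EReal) (a b : ℝ) (v : ℕ → ℝ → ℝ) (k₀ : ℕ → ℝ) : Set ℝ :=
  {t | Tendsto (fun k => ((k₀ k + cumul (density a b (v k)) t : ℝ) : EReal)) atTop (𝓝 (u t))}

theorem ae_mem_convSet (h : BoundedSeq a b c₀ c B u v k₀) {U : Set ℝ} (hU : U ⊆ Ioo a b) :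
    ∀ᵐ t ∂(volume.restrict U), t ∈ convSet u a b v k₀ :=
  ae_restrict_mono hU h.conv

/-- Between `x` and `y` the oscillation of the sequence is eventually bounded, so divergence at one
point forces it at the other. -/
theorem eq_top_of_eq_top (h : BoundedSeq a b c₀ c B u v k₀) {p q : ℝ}
    (hB : Ioo p q ⊆ Ioo a b \ B) {x y : ℝ} (hx : x ∈ Ioo p q) (hy : y ∈ Ioo p q)
    (hxS : x ∈ convSet u a b v k₀) (hyS : y ∈ convSet u a b v k₀) (hux : u x = ⊤) : u y = ⊤ := by
  have h1 : Icc (min x y) (max x y) ⊆ Ioo a b \ B :=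
    fun z hz => hB ⟨(lt_min hx.1 hy.1).trans_le hz.1, hz.2.trans_lt (max_lt hx.2 hy.2)⟩
  have h2 := h.eventually_abs_sub_le (min_le_max) h1
  rw [convSet, mem_ofPred_eq] at hxS hyS
  rw [hux, EReal.tendsto_coe_nhds_top_iff] at hxS
  refine tendsto_nhds_unique hyS ?_
  rw [EReal.tendsto_coe_nhds_top_iff]
  refine tendsto_atTop_mono' _ ?_ (tendsto_atTop_add_const_right _
    (-(varBound a b c₀ c).toReal) hxS)
  filter_upwards [h2] with k hk
  have := (abs_le.1 (hk x ⟨min_le_left _ _, le_max_left _ _⟩ y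
    ⟨min_le_right _ _, le_max_right _ _⟩)).2
  linarith

theorem eq_bot_of_eq_bot (h : BoundedSeq a b c₀ c B u v k₀) {p q : ℝ}
    (hB : Ioo p q ⊆ Ioo a b \ B) {x y : ℝ} (hx : x ∈ Ioo p q) (hy : y ∈ Ioo p q)
    (hxS : x ∈ convSet u a b v k₀) (hyS : y ∈ convSet u a b v k₀) (hux : u x = ⊥) : u y = ⊥ := by
  have h1 : Icc (min x y) (max x y) ⊆ Ioo a b \ B :=
    fun z hz => hB ⟨(lt_min hx.1 hy.1).trans_le hz.1, hz.2.trans_lt (max_lt hx.2 hy.2)⟩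
  have h2 := h.eventually_abs_sub_le (min_le_max) h1
  rw [convSet, mem_ofPred_eq] at hxS hyS
  rw [hux, EReal.tendsto_coe_nhds_bot_iff] at hxS
  refine tendsto_nhds_unique hyS ?_
  rw [EReal.tendsto_coe_nhds_bot_iff]
  refine tendsto_atBot_mono' _ ?_ (tendsto_atBot_add_const_right _
    ((varBound a b c₀ c).toReal) hxS)
  filter_upwards [h2] with k hk
  have := (abs_le.1 (hk x ⟨min_le_left _ _, le_max_left _ _⟩ y
    ⟨min_le_right _ _, le_max_right _ _⟩)).1
  linarith

theorem tendsto_toReal_of_mem {x : ℝ} (h1 : u x ≠ ⊤) (h2 : u x ≠ ⊥)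
    (hx : x ∈ convSet u a b v k₀) :
    Tendsto (fun k => k₀ k + cumul (density a b (v k)) x) atTop (𝓝 (u x).toReal) :=
  (EReal.tendsto_toReal h1 h2).comp hx

/-- Each sum over a finite chain of convergence points is a limit of the corresponding sums of the
sequence. The bound does not depend on the compact subinterval, hence it holds on the whole open
interval. -/
theorem eVariationOn_toReal_le (h : BoundedSeq a b c₀ c B u v k₀) {p q : ℝ}
    (hB : Ioo p q ⊆ Ioo a b \ B)
    (hne : ∀ x ∈ convSet u a b v k₀ ∩ Ioo p q, u x ≠ ⊤ ∧ u x ≠ ⊥) :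
    eVariationOn (fun x => (u x).toReal) (convSet u a b v k₀ ∩ Ioo p q) ≤ varBound a b c₀ c := by
  apply iSup_le
  rintro ⟨n, x, hx, hxs⟩
  have hIcc : Icc (x 0) (x n) ⊆ Ioo p q := fun z hz =>
    ⟨(hxs 0).2.1.trans_le hz.1, hz.2.trans_lt (hxs n).2.2⟩
  have h1 := h.eventually_eVariationOn_le (hx (Nat.zero_le n)) (hIcc.trans hB)
  have h2 : ∀ i, Tendsto (fun k => k₀ k + cumul (density a b (v k)) (x i)) atTop
      (𝓝 (u (x i)).toReal) := fun i =>
    tendsto_toReal_of_mem (hne _ (hxs i)).1 (hne _ (hxs i)).2 (hxs i).1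
  have h3 : Tendsto (fun k => ∑ i ∈ Finset.range n,
      edist (k₀ k + cumul (density a b (v k)) (x (i + 1)))
        (k₀ k + cumul (density a b (v k)) (x i))) atTop
      (𝓝 (∑ i ∈ Finset.range n, edist (u (x (i + 1))).toReal (u (x i)).toReal)) :=
    tendsto_finsetSum _ fun i _ => (h2 (i + 1)).edist (h2 i)
  refine le_of_tendsto h3 ?_
  filter_upwards [h1] with k hk
  refine le_trans ?_ hk
  exact eVariationOn.sum_le_of_monotoneOn_Iic (f := fun y => k₀ k + cumul (density a b (v k)) y)
    (s := Icc (x 0) (x n)) (hx.monotoneOn _) fun i hi => ⟨hx (Nat.zero_le i), hx hi⟩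

end BoundedSeq

/-- For use with `S` a set of convergence points, not an interval. The Jordan parts are bounded on
`S` by the variation, which permits monotone extension to the line. -/
theorem exists_monotone_sub_of_boundedVariationOn {w : ℝ → ℝ} {S : Set ℝ}
    (h : BoundedVariationOn w S) : ∃ (p q : ℝ → ℝ) (C : ℝ), Monotone p ∧ Monotone q ∧
      (∀ t, -C ≤ p t) ∧ (∀ t, -C ≤ q t) ∧ ∀ t ∈ S, w t = p t - q t := by
  rcases S.eq_empty_or_nonempty with rfl | ⟨z, hz⟩
  · exact ⟨0, 0, 0, monotone_const, monotone_const, by simp, by simp, by simp⟩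
  obtain ⟨p, q, hp, hq, hpq, hvar⟩ :=
    h.locallyBoundedVariationOn.exists_monotoneOn_sub_monotoneOn'
  set V := (eVariationOn w S).toReal
  have hbd : ∀ x ∈ S, |p x - p z| ≤ V ∧ |q x - q z| ≤ V := by
    intro x hx
    have h1 := hvar z hz x hx
    have h2 : |variationOnFromTo w S z x| ≤ V := variationOnFromTo.abs_le_eVariationOn h
    rw [← h1, abs_le] at h2
    rw [abs_le, abs_le]
    rcases le_total z x with hzx | hxz
    · have := hp hz hx hzx
      have := hq hz hx hzx
      refine ⟨⟨?_, ?_⟩, ?_, ?_⟩ <;> linarith [h2.1, h2.2]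
    · have := hp hx hz hxz
      have := hq hx hz hxz
      refine ⟨⟨?_, ?_⟩, ?_, ?_⟩ <;> linarith [h2.1, h2.2]
  have hext : ∀ r : ℝ → ℝ, MonotoneOn r S → (∀ x ∈ S, |r x - r z| ≤ V) →
      ∃ r' : ℝ → ℝ, Monotone r' ∧ (∀ t, r z - V ≤ r' t) ∧ ∀ t ∈ S, r t = r' t := by
    intro r hr hrV
    obtain ⟨g, hg, hge⟩ := hr.exists_monotone_extension
      ⟨r z - V, by rintro _ ⟨x, hx, rfl⟩; linarith [(abs_le.1 (hrV x hx)).1]⟩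
      ⟨r z + V, by rintro _ ⟨x, hx, rfl⟩; linarith [(abs_le.1 (hrV x hx)).2]⟩
    -- The maximum keeps monotonicity, provides a global lower bound, and changes nothing on `S`.
    refine ⟨fun t => max (r z - V) (g t), fun s t hst => max_le_max le_rfl (hg hst),
      fun t => le_max_left _ _, fun t ht => ?_⟩
    simp only
    rw [← hge ht, max_eq_right]
    linarith [(abs_le.1 (hrV t ht)).1]
  obtain ⟨p', hp', hp1, hp2⟩ := hext p hp fun x hx => (hbd x hx).1
  obtain ⟨q', hq', hq1, hq2⟩ := hext q hq fun x hx => (hbd x hx).2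
  refine ⟨p', q', max (V - p z) (V - q z), hp', hq', fun t => ?_, fun t => ?_, fun t ht => ?_⟩
  · linarith [hp1 t, le_max_left (V - p z) (V - q z)]
  · linarith [hq1 t, le_max_right (V - p z) (V - q z)]
  · rw [← hp2 t ht, ← hq2 t ht, hpq]; rfl

/-- An infinite limit at one convergence point spreads over the interval. If there is none, the
limit has bounded variation on the convergence points, which have full measure. -/
theorem BoundedSeq.trichotomy {a b c₀ : ℝ} {c : ℝ≥0∞} {B : Finset ℝ} {u : ℝ → EReal}
    {v : ℕ → ℝ → ℝ} {k₀ : ℕ → ℝ} (h : BoundedSeq a b c₀ c B u v k₀) {p q : ℝ}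
    (hB : Ioo p q ⊆ Ioo a b \ B) :
    (∀ᵐ t ∂(volume.restrict (Ioo p q)), u t = ⊤) ∨ (∀ᵐ t ∂(volume.restrict (Ioo p q)), u t = ⊥) ∨
    ((∀ᵐ t ∂(volume.restrict (Ioo p q)), u t ≠ ⊤ ∧ u t ≠ ⊥) ∧
      IsBV a b ((Ioo p q).indicator fun t => (u t).toReal)) := by
  have hU : Ioo p q ⊆ Ioo a b := hB.trans sdiff_subset
  have hS := h.ae_mem_convSet hU
  by_cases h1 : ∃ x ∈ BoundedSeq.convSet u a b v k₀ ∩ Ioo p q, u x = ⊤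
  · obtain ⟨x, ⟨hxS, hx⟩, hux⟩ := h1
    left
    filter_upwards [hS, self_mem_ae_restrict measurableSet_Ioo] with y hyS hy
    exact h.eq_top_of_eq_top hB hx hy hxS hyS hux
  by_cases h2 : ∃ x ∈ BoundedSeq.convSet u a b v k₀ ∩ Ioo p q, u x = ⊥
  · obtain ⟨x, ⟨hxS, hx⟩, hux⟩ := h2
    right; left
    filter_upwards [hS, self_mem_ae_restrict measurableSet_Ioo] with y hyS hy
    exact h.eq_bot_of_eq_bot hB hx hy hxS hyS hux
  push Not at h1 h2
  right; right
  have hne : ∀ x ∈ BoundedSeq.convSet u a b v k₀ ∩ Ioo p q, u x ≠ ⊤ ∧ u x ≠ ⊥ :=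
    fun x hx => ⟨h1 x hx, h2 x hx⟩
  refine ⟨?_, ?_⟩
  · filter_upwards [hS, self_mem_ae_restrict measurableSet_Ioo] with y hyS hy
    exact hne y ⟨hyS, hy⟩
  · have hbv : BoundedVariationOn (fun x => (u x).toReal)
        (BoundedSeq.convSet u a b v k₀ ∩ Ioo p q) :=
      ne_top_of_le_ne_top h.varBound_ne_top (h.eVariationOn_toReal_le hB hne)
    obtain ⟨P, Q, C, hP, hQ, hPC, hQC, hw⟩ := exists_monotone_sub_of_boundedVariationOn hbv
    refine (isBV_congr ?_).1 (isBV_indicator_sub h.hab hP hQ hPC hQC p q)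
    filter_upwards [h.ae_mem_convSet le_rfl] with t ht
    by_cases hts : t ∈ Ioo p q
    · rw [indicator_of_mem hts, indicator_of_mem hts, hw t ⟨ht, hts⟩]
    · rw [indicator_of_notMem hts, indicator_of_notMem hts]

/-- Where `u` is finite the sequence is locally bounded. -/
theorem BoundedSeq.eventually_bounded {a b c₀ : ℝ} {c : ℝ≥0∞} {B : Finset ℝ} {u : ℝ → EReal}
    {v : ℕ → ℝ → ℝ} {k₀ : ℕ → ℝ} (h : BoundedSeq a b c₀ c B u v k₀) {p q : ℝ} (hpq : p < q)
    (hB : Icc p q ⊆ Ioo a b \ B)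
    (hfin : ∀ᵐ t ∂(volume.restrict (Ioo p q)), u t ≠ ⊤ ∧ u t ≠ ⊥) :
    ∃ M : ℝ, ∀ᶠ k in atTop, ∀ y ∈ Icc p q, |k₀ k + cumul (density a b (v k)) y| ≤ M := by
  have hU : Ioo p q ⊆ Ioo a b := (Ioo_subset_Icc_self.trans hB).trans sdiff_subset
  have hne : (ae (volume.restrict (Ioo p q))).NeBot := by
    rw [ae_neBot, Ne, Measure.restrict_eq_zero, Real.volume_Ioo, ENNReal.ofReal_eq_zero]
    linarith
  obtain ⟨x, ⟨hx1, hx2⟩, hxS, hx⟩ := (hfin.and ((h.ae_mem_convSet hU).and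
    (self_mem_ae_restrict measurableSet_Ioo))).exists
  have h2 : Tendsto (fun k => |k₀ k + cumul (density a b (v k)) x|) atTop
      (𝓝 |(u x).toReal|) := (BoundedSeq.tendsto_toReal_of_mem hx1 hx2 hxS).abs
  refine ⟨|(u x).toReal| + 1 + (varBound a b c₀ c).toReal, ?_⟩
  filter_upwards [h2.eventually (gt_mem_nhds (lt_add_one _)),
    h.eventually_abs_sub_le hpq.le hB] with k hk1 hk2 y hy
  have h3 := hk2 y hy x (Ioo_subset_Icc_self hx)
  have h4 := abs_sub_abs_le_abs_sub (k₀ k + cumul (density a b (v k)) y)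
    (k₀ k + cumul (density a b (v k)) x)
  linarith

/-! ### Partitions -/

section Partition

variable {m : ℕ} {x : Fin (m + 1) → ℝ}

theorem exists_mem_Ico_partition {t : ℝ} (h0 : x 0 ≤ t) (h1 : t < x (Fin.last m)) :
    ∃ i : Fin m, x i.castSucc ≤ t ∧ t < x i.succ := by
  by_contra! H
  exact absurd (Fin.induction (motive := fun j => x j ≤ t) h0 H (Fin.last m)) (not_le.2 h1)

theorem exists_mem_Ioc_partition {t : ℝ} (h0 : x 0 < t) (h1 : t ≤ x (Fin.last m)) :
    ∃ i : Fin m, x i.castSucc < t ∧ t ≤ x i.succ := by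
  by_contra! H
  exact absurd (Fin.induction (motive := fun j => x j < t) h0 H (Fin.last m)) (not_lt.2 h1)

theorem eq_of_mem_Ioo_of_mem_Icc (hx : StrictMono x) {i j : Fin m} {t : ℝ}
    (hi : t ∈ Ioo (x i.castSucc) (x i.succ)) (hj : t ∈ Icc (x j.castSucc) (x j.succ)) : i = j := by
  have h1 : i.castSucc < j.succ := hx.lt_iff_lt.1 (hi.1.trans_le hj.2)
  have h2 : j.castSucc < i.succ := hx.lt_iff_lt.1 (hj.1.trans_lt hi.2)
  rw [Fin.castSucc_lt_succ_iff] at h1 h2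
  exact le_antisymm h1 h2

theorem sum_indicator_partition (hx : StrictMono x) (w : Fin m → ℝ → ℝ) {i : Fin m} {t : ℝ}
    (hi : t ∈ Ioo (x i.castSucc) (x i.succ)) :
    ∑ j, (Ioo (x j.castSucc) (x j.succ)).indicator (w j) t = w i t := by
  rw [Finset.sum_eq_single i, indicator_of_mem hi]
  · intro j _ hj
    apply indicator_of_notMem
    intro hmem
    exact hj (eq_of_mem_Ioo_of_mem_Icc hx hi (Ioo_subset_Icc_self hmem)).symm
  · simp

theorem ae_of_forall_partition {P : ℝ → Prop}
    (h : ∀ i : Fin m, ∀ᵐ t ∂(volume.restrict (Ioo (x i.castSucc) (x i.succ))), P t) :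
    ∀ᵐ t ∂(volume.restrict (Ioo (x 0) (x (Fin.last m)))), P t := by
  have h' : ∀ᵐ t, ∀ i : Fin m, t ∈ Ioo (x i.castSucc) (x i.succ) → P t := by
    rw [ae_all_iff]
    exact fun i => (ae_restrict_iff' measurableSet_Ioo).1 (h i)
  rw [ae_restrict_iff' measurableSet_Ioo]
  filter_upwards [h', (Set.finite_range x).countable.ae_notMem volume] with t ht hr hts
  obtain ⟨i, hi1, hi2⟩ := exists_mem_Ico_partition hts.1.le hts.2
  exact ht i ⟨lt_of_le_of_ne hi1 fun h => hr ⟨_, h⟩, hi2⟩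

theorem isBV_of_partition {a b : ℝ} (hab : a < b) (hx : StrictMono x) (h0 : x 0 = a)
    (h1 : x (Fin.last m) = b) {u : ℝ → ℝ} (w : Fin m → ℝ → ℝ)
    (hw : ∀ i, IsBV a b ((Ioo (x i.castSucc) (x i.succ)).indicator (w i)))
    (hu : ∀ i, ∀ᵐ t ∂(volume.restrict (Ioo (x i.castSucc) (x i.succ))), u t = w i t) :
    IsBV a b u := by
  refine (isBV_congr ?_).1 (isBV_sum hab Finset.univ
    (fun i => (Ioo (x i.castSucc) (x i.succ)).indicator (w i)) fun i _ => hw i)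
  subst h0 h1
  apply ae_of_forall_partition
  intro i
  filter_upwards [hu i, self_mem_ae_restrict measurableSet_Ioo] with t ht hts
  rw [sum_indicator_partition hx w hts, ht]

/-- The nodes are `a`, `b` and the points of `B` in increasing order, so no point of `B` lies
strictly between consecutive nodes. -/
theorem exists_partition {a b : ℝ} (hab : a < b) (B : Finset ℝ) (hB : ∀ t ∈ B, t ∈ Ioo a b) :
    ∃ (m : ℕ) (x : Fin (m + 1) → ℝ), StrictMono x ∧ x 0 = a ∧ x (Fin.last m) = b ∧
      ∀ i : Fin m, Ioo (x i.castSucc) (x i.succ) ⊆ Ioo a b \ B := by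
  classical
  set L := insert a (insert b B) with hL
  have hc : L.card = (B.card + 1) + 1 := by
    rw [hL, Finset.card_insert_of_notMem, Finset.card_insert_of_notMem]
    · exact fun h => lt_irrefl _ (hB b h).2
    · rw [Finset.mem_insert, not_or]
      exact ⟨hab.ne, fun h => lt_irrefl _ (hB a h).1⟩
  have hLab : ∀ t ∈ L, a ≤ t ∧ t ≤ b := by
    intro t ht
    rw [hL, Finset.mem_insert, Finset.mem_insert] at ht
    rcases ht with rfl | rfl | ht
    · exact ⟨le_rfl, hab.le⟩
    · exact ⟨hab.le, le_rfl⟩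
    · exact ⟨(hB t ht).1.le, (hB t ht).2.le⟩
  set x := L.orderEmbOfFin hc with hx
  have hmem : ∀ i, x i ∈ L := fun i => L.orderEmbOfFin_mem hc i
  have hsurj : ∀ t ∈ L, ∃ i, x i = t := by
    intro t ht
    have : t ∈ Set.range x := by rw [hx, Finset.range_orderEmbOfFin]; exact ht
    exact this
  refine ⟨B.card + 1, x, x.strictMono, ?_, ?_, ?_⟩
  · obtain ⟨i, hi⟩ := hsurj a (by simp [hL])
    exact le_antisymm (hi ▸ x.monotone (Fin.zero_le i)) (hLab _ (hmem _)).1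
  · obtain ⟨i, hi⟩ := hsurj b (by simp [hL])
    exact le_antisymm (hLab _ (hmem _)).2 (hi ▸ x.monotone (Fin.le_last i))
  · intro i t ht
    refine ⟨⟨(hLab _ (hmem _)).1.trans_lt ht.1, ht.2.trans_le (hLab _ (hmem _)).2⟩, fun htB => ?_⟩
    obtain ⟨j, rfl⟩ := hsurj t (by simp [hL, Finset.mem_coe.1 htB])
    have h1 := x.lt_iff_lt.1 ht.1
    have h2 := x.lt_iff_lt.1 ht.2
    rw [Fin.lt_def] at h1 h2
    simp only [Fin.val_castSucc, Fin.val_succ] at h1 h2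
    omega

end Partition

/-- The trichotomy on the components of `(a,b) ∖ B` supplies the values `α`. For `w` the function
`toReal ∘ u` serves on all pieces, since `EReal.toReal` sends both infinities to 0. -/
theorem BoundedSeq.nonempty_rep {a b c₀ : ℝ} {c : ℝ≥0∞} {B : Finset ℝ} {u : ℝ → EReal}
    {v : ℕ → ℝ → ℝ} {k₀ : ℕ → ℝ} (h : BoundedSeq a b c₀ c B u v k₀) :
    Nonempty (BVInfRep a b u) := by
  obtain ⟨m, x, hx, h0, h1, hI⟩ := exists_partition h.hab B h.mem
  have key : ∀ i : Fin m, ∃ α : EReal, (α = ⊥ ∨ α = 0 ∨ α = ⊤) ∧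
      (∀ᵐ t ∂(volume.restrict (Ioo (x i.castSucc) (x i.succ))), u t = ((u t).toReal : EReal) + α) ∧
      IsBV a b ((Ioo (x i.castSucc) (x i.succ)).indicator fun t => (u t).toReal) := by
    intro i
    have hz : ∀ z : EReal, z.toReal = 0 →
        (∀ᵐ t ∂(volume.restrict (Ioo (x i.castSucc) (x i.succ))), u t = z) →
        IsBV a b ((Ioo (x i.castSucc) (x i.succ)).indicator fun t => (u t).toReal) := by
      intro z hz huz
      refine (isBV_congr ?_).1 (isBV_zero a b)
      rw [ae_restrict_iff' measurableSet_Ioo] at huz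
      filter_upwards [ae_restrict_of_ae huz] with t ht
      by_cases hts : t ∈ Ioo (x i.castSucc) (x i.succ)
      · rw [indicator_of_mem hts, ht hts, hz]
      · rw [indicator_of_notMem hts]
    rcases h.trichotomy (hI i) with ht | ht | ⟨ht, hbv⟩
    · refine ⟨⊤, Or.inr (Or.inr rfl), ?_, hz ⊤ EReal.toReal_top ht⟩
      filter_upwards [ht] with t ht
      rw [ht, EReal.coe_add_top]
    · refine ⟨⊥, Or.inl rfl, ?_, hz ⊥ EReal.toReal_bot ht⟩
      filter_upwards [ht] with t ht
      rw [ht, EReal.add_bot]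
    · refine ⟨0, Or.inr (Or.inl rfl), ?_, hbv⟩
      filter_upwards [ht] with t ht
      rw [add_zero, EReal.coe_toReal ht.1 ht.2]
  choose α hα1 hα2 hα3 using key
  exact ⟨⟨m, x, hx, h0, h1, α, hα1, fun t => (u t).toReal,
    isBV_of_partition h.hab hx h0 h1 (fun _ t => (u t).toReal) hα3
      fun i => Eventually.of_forall fun t => rfl, hα2⟩⟩

/-! ### Local structure of `BV_{∞,𝓟}` -/

namespace BVInfRep

variable {a b : ℝ} {u : ℝ → EReal} (R : BVInfRep a b u)

theorem isOpen_finitePart : IsOpen R.finitePart := isOpen_interior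

theorem mem_Icc_of_mem (i : Fin R.m) {t : ℝ} (ht : t ∈ Icc (R.x i.castSucc) (R.x i.succ)) :
    t ∈ Icc a b := by
  constructor
  · rw [← R.x_zero]; exact (R.strictMono_x.monotone (Fin.zero_le _)).trans ht.1
  · rw [← R.x_last]; exact ht.2.trans (R.strictMono_x.monotone (Fin.le_last _))

theorem finitePart_subset : R.finitePart ⊆ Ioo a b := by
  rw [← interior_Icc]
  apply interior_mono
  intro t ht
  simp only [mem_iUnion] at ht
  obtain ⟨i, -, ht⟩ := ht
  exact R.mem_Icc_of_mem i ht

theorem exists_right {t : ℝ} (ht : t ∈ Ioo a b) :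
    ∃ i : Fin R.m, R.x i.castSucc ≤ t ∧ t < R.x i.succ :=
  exists_mem_Ico_partition (by rw [R.x_zero]; exact ht.1.le) (by rw [R.x_last]; exact ht.2)

theorem exists_left {t : ℝ} (ht : t ∈ Ioo a b) :
    ∃ i : Fin R.m, R.x i.castSucc < t ∧ t ≤ R.x i.succ :=
  exists_mem_Ioc_partition (by rw [R.x_zero]; exact ht.1) (by rw [R.x_last]; exact ht.2.le)

theorem α_eq_zero_of_mem_Ioo {t : ℝ} (ht : t ∈ R.finitePart) {i : Fin R.m}
    (hi : t ∈ Ioo (R.x i.castSucc) (R.x i.succ)) : R.α i = 0 := by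
  have h := interior_subset ht
  simp only [mem_iUnion] at h
  obtain ⟨j, hj, htj⟩ := h
  rwa [eq_of_mem_Ioo_of_mem_Icc R.strictMono_x hi htj]

/-- Here `i` is the piece just to the right of `t` and `j` the piece just to the left; they coincide
unless `t` is a node. -/
theorem mem_finitePart {t : ℝ} {i j : Fin R.m} (hi : R.α i = 0) (hj : R.α j = 0)
    (h1 : R.x i.castSucc ≤ t ∧ t < R.x i.succ) (h2 : R.x j.castSucc < t ∧ t ≤ R.x j.succ) :
    t ∈ R.finitePart := by
  refine mem_interior.2 ⟨Ioo (R.x j.castSucc) (R.x i.succ), fun s hs => ?_, isOpen_Ioo,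
    ⟨h2.1, h1.2⟩⟩
  simp only [mem_iUnion]
  rcases le_total s t with hst | hst
  · exact ⟨j, hj, hs.1.le, hst.trans h2.2⟩
  · exact ⟨i, hi, h1.1.trans hst, hs.2.le⟩

theorem α_right_eq_zero {t : ℝ} (ht : t ∈ R.finitePart) {i : Fin R.m}
    (h1 : R.x i.castSucc ≤ t ∧ t < R.x i.succ) : R.α i = 0 := by
  have h : R.finitePart ∩ Ioo t (R.x i.succ) ∈ 𝓝[>] t :=
    inter_mem (mem_nhdsWithin_of_mem_nhds (R.isOpen_finitePart.mem_nhds ht)) (Ioo_mem_nhdsGT h1.2)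
  obtain ⟨s, hs1, hs2⟩ := Filter.nonempty_of_mem h
  exact R.α_eq_zero_of_mem_Ioo hs1 ⟨h1.1.trans_lt hs2.1, hs2.2⟩

theorem α_left_eq_zero {t : ℝ} (ht : t ∈ R.finitePart) {i : Fin R.m}
    (h1 : R.x i.castSucc < t ∧ t ≤ R.x i.succ) : R.α i = 0 := by
  have h : R.finitePart ∩ Ioo (R.x i.castSucc) t ∈ 𝓝[<] t :=
    inter_mem (mem_nhdsWithin_of_mem_nhds (R.isOpen_finitePart.mem_nhds ht)) (Ioo_mem_nhdsLT h1.1)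
  obtain ⟨s, hs1, hs2⟩ := Filter.nonempty_of_mem h
  exact R.α_eq_zero_of_mem_Ioo hs1 ⟨hs2.1, hs2.2.trans_le h1.2⟩

theorem ae_eq_on_finitePart : ∀ᵐ t ∂(volume.restrict R.finitePart), u t = (R.w t : EReal) := by
  have h : ∀ᵐ t ∂(volume.restrict (Ioo a b)), t ∈ R.finitePart → u t = (R.w t : EReal) := by
    have := ae_of_forall_partition (x := R.x)
      (P := fun t => t ∈ R.finitePart → u t = (R.w t : EReal)) (by
        intro i
        filter_upwards [R.eq_ae i, self_mem_ae_restrict measurableSet_Ioo] with t ht hts htF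
        rw [ht, R.α_eq_zero_of_mem_Ioo htF hts, add_zero])
    rwa [R.x_zero, R.x_last] at this
  have h2 := ae_restrict_mono R.finitePart_subset h
  filter_upwards [h2, self_mem_ae_restrict R.isOpen_finitePart.measurableSet] with t h3 h4 using
    h3 h4

theorem tendsto_right {t : ℝ} (ht : t ∈ Ioo a b) {i : Fin R.m}
    (h1 : R.x i.castSucc ≤ t ∧ t < R.x i.succ) {k : ℝ}
    (hk : ∀ᵐ t ∂(volume.restrict (Ioo a b)), R.w t = k + cumul (distribDeriv a b R.w) t) :
    Tendsto u (essRight t) (𝓝 (((k + cumul (distribDeriv a b R.w) t : ℝ) : EReal) + R.α i)) := by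
  have hu : ∀ᶠ s in essRight t,
      u s = ((k + cumul (distribDeriv a b R.w) s : ℝ) : EReal) + R.α i := by
    apply eventually_essRight (lt_min h1.2 ht.2)
    filter_upwards [ae_restrict_mono (Ioo_subset_Ioo h1.1 (min_le_left _ _)) (R.eq_ae i),
      ae_restrict_mono (Ioo_subset_Ioo ht.1.le (min_le_right _ _)) hk] with s h2 h3
    rw [h2, h3]
  refine Tendsto.congr' (EventuallyEq.symm hu) ?_
  have h4 : Tendsto (fun s => ((k + cumul (distribDeriv a b R.w) s : ℝ) : EReal)) (essRight t)
      (𝓝 ((k + cumul (distribDeriv a b R.w) t : ℝ) : EReal)) :=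
    EReal.tendsto_coe.2 (((tendsto_cumul_right _ t).mono_left inf_le_left).const_add k)
  exact (EReal.continuousAt_add (Or.inl (EReal.coe_ne_top _))
    (Or.inl (EReal.coe_ne_bot _))).tendsto.comp (h4.prodMk_nhds tendsto_const_nhds)

theorem tendsto_left {t : ℝ} (ht : t ∈ Ioo a b) {i : Fin R.m}
    (h1 : R.x i.castSucc < t ∧ t ≤ R.x i.succ) {k : ℝ}
    (hk : ∀ᵐ t ∂(volume.restrict (Ioo a b)), R.w t = k + cumul (distribDeriv a b R.w) t) :
    Tendsto u (essLeft t)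
      (𝓝 (((k + distribDeriv a b R.w (Iio t) : ℝ) : EReal) + R.α i)) := by
  have hu : ∀ᶠ s in essLeft t,
      u s = ((k + cumul (distribDeriv a b R.w) s : ℝ) : EReal) + R.α i := by
    apply eventually_essLeft (max_lt h1.1 ht.1)
    filter_upwards [ae_restrict_mono (Ioo_subset_Ioo (le_max_left _ _) h1.2) (R.eq_ae i),
      ae_restrict_mono (Ioo_subset_Ioo (le_max_right _ _) ht.2.le) hk] with s h2 h3
    rw [h2, h3]
  refine Tendsto.congr' (EventuallyEq.symm hu) ?_
  have h4 : Tendsto (fun s => ((k + cumul (distribDeriv a b R.w) s : ℝ) : EReal)) (essLeft t)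
      (𝓝 ((k + distribDeriv a b R.w (Iio t) : ℝ) : EReal)) :=
    EReal.tendsto_coe.2 (((tendsto_cumul_left _ t).mono_left inf_le_left).const_add k)
  exact (EReal.continuousAt_add (Or.inl (EReal.coe_ne_top _))
    (Or.inl (EReal.coe_ne_bot _))).tendsto.comp (h4.prodMk_nhds tendsto_const_nhds)

end BVInfRep

/-! ### Atoms of the derivative -/

theorem singularPart_singleton (P : Measure ℝ) [IsFiniteMeasure P] (x : ℝ) :
    P.singularPart volume {x} = P {x} := by
  conv_rhs => rw [P.haveLebesgueDecomposition_add volume]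
  rw [Measure.add_apply, withDensity_apply _ (measurableSet_singleton x)]
  simp

/-- Lebesgue measure charges no point, and by mutual singularity only one Jordan part can charge a
given point. -/
theorem totalVariation_singularPart_singleton (μ : SignedMeasure ℝ) (x : ℝ) :
    (μ.singularPart volume).totalVariation {x} = ‖μ {x}‖ₑ := by
  rw [SignedMeasure.singularPart_totalVariation, Measure.add_apply, singularPart_singleton,
    singularPart_singleton, μ.apply_eq_posPart_real_sub_negPart_real (measurableSet_singleton x)]
  obtain ⟨s, -, hs1, hs2⟩ := μ.toJordanDecomposition.mutuallySingular
  by_cases hx : x ∈ s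
  · have h : μ.toJordanDecomposition.posPart {x} = 0 :=
      measure_mono_null (singleton_subset_iff.2 hx) hs1
    rw [h, measureReal_def, h, zero_add, ENNReal.toReal_zero, zero_sub, enorm_neg, measureReal_def,
      Real.enorm_of_nonneg ENNReal.toReal_nonneg, ENNReal.ofReal_toReal (measure_ne_top _ _)]
  · have h : μ.toJordanDecomposition.negPart {x} = 0 :=
      measure_mono_null (singleton_subset_iff.2 hx) hs2
    rw [h, add_zero, measureReal_def, measureReal_def, h, ENNReal.toReal_zero, sub_zero,
      Real.enorm_of_nonneg ENNReal.toReal_nonneg, ENNReal.ofReal_toReal (measure_ne_top _ _)]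

/-- The total variation of the singular part of the derivative. -/
abbrev singVar (a b : ℝ) (w : ℝ → ℝ) : Measure ℝ := (singDeriv a b w).totalVariation

theorem singVar_singleton (a b : ℝ) (w : ℝ → ℝ) (x : ℝ) :
    singVar a b w {x} = ‖distribDeriv a b w {x}‖ₑ :=
  totalVariation_singularPart_singleton _ x

instance (a b : ℝ) (w : ℝ → ℝ) : IsFiniteMeasure (singVar a b w) := by
  unfold singVar SignedMeasure.totalVariation
  infer_instance

theorem jumpAbs_eq {u : ℝ → EReal} {x : ℝ} {p q : EReal} (hp : Tendsto u (essRight x) (𝓝 p))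
    (hq : Tendsto u (essLeft x) (𝓝 q)) : jumpAbs u x = (p - q).abs := by
  rw [jumpAbs, hp.limUnder_eq, hq.limUnder_eq]

theorem mem_jumpSet_iff {a b : ℝ} {u : ℝ → EReal} {x : ℝ} {p q : EReal} (hx : x ∈ Ioo a b)
    (hp : Tendsto u (essRight x) (𝓝 p)) (hq : Tendsto u (essLeft x) (𝓝 q)) :
    x ∈ jumpSet a b u ↔ p ≠ q := by
  constructor
  · rintro ⟨-, p', q', hp', hq', hne⟩
    rwa [tendsto_nhds_unique hp hp', tendsto_nhds_unique hq hq']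
  · exact fun hne => ⟨hx, p, q, hp, hq, hne⟩

theorem countable_atoms (σ : Measure ℝ) [IsFiniteMeasure σ] : {x | σ {x} ≠ 0}.Countable := by
  have h := Measure.countable_meas_level_set_pos (μ := σ) (g := id) measurable_id
  refine h.mono fun x hx => ?_
  simpa [pos_iff_ne_zero] using hx

/-! ### Jumps and surface energy in terms of a representation. -/

namespace BVInfRep

variable {a b : ℝ} {u : ℝ → EReal} (R : BVInfRep a b u)

theorem tendsto_of_mem_finitePart (hab : a < b) {x : ℝ} (hx : x ∈ R.finitePart) :
    ∃ p q : ℝ, Tendsto u (essRight x) (𝓝 (p : EReal)) ∧ Tendsto u (essLeft x) (𝓝 (q : EReal)) ∧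
      p - q = distribDeriv a b R.w {x} := by
  obtain ⟨k, hk⟩ := R.isBV_w.exists_ae_eq hab
  have hx' := R.finitePart_subset hx
  obtain ⟨i, hi⟩ := R.exists_right hx'
  obtain ⟨j, hj⟩ := R.exists_left hx'
  have h1 := R.tendsto_right hx' hi hk
  have h2 := R.tendsto_left hx' hj hk
  rw [R.α_right_eq_zero hx hi, add_zero] at h1
  rw [R.α_left_eq_zero hx hj, add_zero] at h2
  refine ⟨_, _, h1, h2, ?_⟩
  rw [cumul_eq_Iio_add]; ring

theorem mem_jumpSet_iff (hab : a < b) {x : ℝ} (hx : x ∈ R.finitePart) :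
    x ∈ jumpSet a b u ↔ singVar a b R.w {x} ≠ 0 := by
  obtain ⟨p, q, hp, hq, hpq⟩ := R.tendsto_of_mem_finitePart hab hx
  rw [CohesiveFracture.mem_jumpSet_iff (R.finitePart_subset hx) hp hq, singVar_singleton, ← hpq,
    Ne, Ne, EReal.coe_eq_coe_iff, enorm_eq_zero, sub_eq_zero]

theorem jumpAbs_of_mem_finitePart (hab : a < b) {x : ℝ} (hx : x ∈ R.finitePart) :
    jumpAbs u x = singVar a b R.w {x} := by
  obtain ⟨p, q, hp, hq, hpq⟩ := R.tendsto_of_mem_finitePart hab hx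
  rw [jumpAbs_eq hp hq, singVar_singleton, ← hpq, ← EReal.coe_sub, EReal.abs_def,
    Real.enorm_eq_ofReal_abs]

/-- A real number plus `α` determines which of −∞, 0, ∞ the value `α` is. -/
theorem α_eq_of_notMem_jumpSet (hab : a < b) {x : ℝ} (hx : x ∈ Ioo a b) (hJ : x ∉ jumpSet a b u)
    {i j : Fin R.m} (hi : R.x i.castSucc ≤ x ∧ x < R.x i.succ)
    (hj : R.x j.castSucc < x ∧ x ≤ R.x j.succ) : R.α i = R.α j := by
  obtain ⟨k, hk⟩ := R.isBV_w.exists_ae_eq hab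
  have h1 := R.tendsto_right hx hi hk
  have h2 := R.tendsto_left hx hj hk
  rw [CohesiveFracture.mem_jumpSet_iff hx h1 h2, not_not] at hJ
  rcases R.α_mem i with h3 | h3 | h3 <;> rcases R.α_mem j with h4 | h4 | h4 <;>
    rw [h3, h4] at hJ ⊢ <;> simp [-EReal.coe_add] at hJ

/-- Outside the finite part at least one of the two adjacent pieces is infinite, and at a jump the
two infinities cannot be the same. -/
theorem jumpAbs_eq_top (hab : a < b) {x : ℝ} (hJ : x ∈ jumpSet a b u) (hx : x ∉ R.finitePart) :
    jumpAbs u x = ⊤ := by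
  obtain ⟨k, hk⟩ := R.isBV_w.exists_ae_eq hab
  obtain ⟨i, hi⟩ := R.exists_right hJ.1
  obtain ⟨j, hj⟩ := R.exists_left hJ.1
  have h1 := R.tendsto_right hJ.1 hi hk
  have h2 := R.tendsto_left hJ.1 hj hk
  have h0 := R.mem_finitePart (t := x) (i := i) (j := j)
  rw [CohesiveFracture.mem_jumpSet_iff hJ.1 h1 h2] at hJ
  rw [jumpAbs_eq h1 h2]
  rcases R.α_mem i with h3 | h3 | h3 <;> rcases R.α_mem j with h4 | h4 | h4 <;>
    simp [-EReal.coe_add, h3, h4, hi, hj, hx] at hJ h0 ⊢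

theorem jumpSet_sdiff_subset (hab : a < b) : jumpSet a b u \ R.finitePart ⊆ range R.x := by
  rintro x ⟨hJ, hx⟩
  by_contra hr
  obtain ⟨k, hk⟩ := R.isBV_w.exists_ae_eq hab
  obtain ⟨i, hi⟩ := R.exists_right hJ.1
  obtain ⟨j, hj⟩ := R.exists_left hJ.1
  have hij : i = j := eq_of_mem_Ioo_of_mem_Icc R.strictMono_x
    ⟨lt_of_le_of_ne hi.1 fun h => hr ⟨_, h⟩, hi.2⟩ ⟨hj.1.le, hj.2⟩
  subst hij
  have h1 := R.tendsto_right hJ.1 hi hk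
  have h2 := R.tendsto_left hJ.1 hj hk
  have h0 := R.mem_finitePart (t := x) (i := i) (j := i)
  rw [CohesiveFracture.mem_jumpSet_iff hJ.1 h1 h2] at hJ
  rcases R.α_mem i with h3 | h3 | h3 <;> simp [-EReal.coe_add, h3, hi, hj, hx] at hJ h0

theorem singDeriv_totalVariation :
    R.singDeriv.totalVariation = (singVar a b R.w).restrict R.finitePart :=
  totalVariation_singularPart_restrict _ _ R.isOpen_finitePart.measurableSet

/-- The limit energy in terms of a representation. -/
def energy (c₀ : ℝ) : ℝ≥0∞ :=
  (∫⁻ t in R.finitePart, ENNReal.ofReal (ψ c₀ |acDeriv a b R.w t|)) + surfaceEnergy a b c₀ u +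
    ENNReal.ofReal c₀ * R.singDeriv.totalVariation (R.finitePart \ jumpSet a b u)

theorem countable_jumpSet_inter (R : BVInfRep a b u) (hab : a < b) :
    (jumpSet a b u ∩ R.finitePart).Countable :=
  (countable_atoms (singVar a b R.w)).mono fun _ hx => (R.mem_jumpSet_iff hab hx.2).1 hx.1

theorem countable_jumpSet (R : BVInfRep a b u) (hab : a < b) : (jumpSet a b u).Countable := by
  refine ((R.countable_jumpSet_inter hab).union
    ((Set.finite_range R.x).countable.mono (R.jumpSet_sdiff_subset hab))).mono fun x hx => ?_
  by_cases h : x ∈ R.finitePart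
  · exact Or.inl ⟨hx, h⟩
  · exact Or.inr ⟨hx, h⟩

theorem singDeriv_totalVariation_sdiff (hab : a < b) :
    R.singDeriv.totalVariation (R.finitePart \ jumpSet a b u) =
      singVar a b R.w (R.finitePart \ jumpSet a b u) := by
  rw [R.singDeriv_totalVariation, Measure.restrict_apply
    (R.isOpen_finitePart.measurableSet.diff (R.countable_jumpSet hab).measurableSet),
    inter_eq_left.2 sdiff_subset]

theorem two_mul_f_half_le (c₀ : ℝ) (s : ℝ≥0∞) : 2 * f c₀ (s / 2) ≤ ENNReal.ofReal c₀ * s := by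
  calc 2 * f c₀ (s / 2) ≤ 2 * (ENNReal.ofReal c₀ * (s / 2)) := by gcongr; exact f_le_mul _ _
    _ = ENNReal.ofReal c₀ * s := by
      rw [mul_left_comm, ENNReal.mul_div_cancel (by simp) (by simp)]

/-- For the lower bound: a jump in `B` costs at most `2c₀`, any other at most `c₀` times its size,
and that size is the atom of `|Dˢw|`. -/
theorem surfaceEnergy_add_le (hab : a < b) (c₀ : ℝ) (B : Finset ℝ)
    (hB : jumpSet a b u \ R.finitePart ⊆ B) :
    surfaceEnergy a b c₀ u + ENNReal.ofReal c₀ *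
        R.singDeriv.totalVariation (R.finitePart \ jumpSet a b u) ≤
      2 * ENNReal.ofReal c₀ * B.card + ENNReal.ofReal c₀ * singVar a b R.w (R.finitePart \ B) := by
  classical
  set C := ENNReal.ofReal c₀
  set σ := singVar a b R.w
  set J := jumpSet a b u with hJ
  rw [R.singDeriv_totalVariation_sdiff hab]
  have hJm : MeasurableSet J := (R.countable_jumpSet hab).measurableSet
  have hBm : MeasurableSet (B : Set ℝ) := B.measurableSet
  have hF := R.isOpen_finitePart.measurableSet
  have h1 : surfaceEnergy a b c₀ u ≤ 2 * C * B.card + C * σ (J \ B) := by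
    rw [surfaceEnergy, ← ENNReal.tsum_mul_left]
    have hsplit : J = (J ∩ B) ∪ (J \ B) := (inter_union_sdiff J B).symm
    have e1 : ∑' x : J, 2 * f c₀ (jumpAbs u x / 2) =
        (∑' x : ↑(J ∩ B), 2 * f c₀ (jumpAbs u x / 2)) +
          ∑' x : ↑(J \ B), 2 * f c₀ (jumpAbs u x / 2) := by
      conv_lhs => rw [hsplit]
      exact Summable.tsum_union_disjoint (f := fun x => 2 * f c₀ (jumpAbs u x / 2))
        (disjoint_sdiff_inter.symm) ENNReal.summable ENNReal.summable
    rw [e1]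
    gcongr
    · calc ∑' x : ↑(J ∩ B), 2 * f c₀ (jumpAbs u x / 2)
          ≤ ∑' x : ↑(J ∩ B), 2 * C := ENNReal.tsum_le_tsum fun x => by gcongr; exact f_le _ _
        _ ≤ ∑' x : ↑(B : Set ℝ), 2 * C :=
            ENNReal.tsum_mono_subtype (fun _ => 2 * C) inter_subset_right
        _ = 2 * C * B.card := by simp [mul_comm]
    · calc ∑' x : ↑(J \ B), 2 * f c₀ (jumpAbs u x / 2)
          ≤ ∑' x : ↑(J \ B), C * σ {(x : ℝ)} := by
            refine ENNReal.tsum_le_tsum fun x => ?_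
            have hxF : (x : ℝ) ∈ R.finitePart := by
              by_contra h
              exact x.2.2 (hB ⟨x.2.1, h⟩)
            rw [← R.jumpAbs_of_mem_finitePart hab hxF]
            exact two_mul_f_half_le _ _
        _ = C * ∑' x : ↑(J \ B), σ {(x : ℝ)} := ENNReal.tsum_mul_left
        _ ≤ C * σ (⋃ x : ↑(J \ B), {(x : ℝ)}) := by
            gcongr
            refine tsum_meas_le_meas_iUnion_of_disjoint _ (fun _ => measurableSet_singleton _) ?_
            intro x y hxy
            simp only [Function.onFun, disjoint_singleton]
            exact fun h => hxy (Subtype.ext h)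
        _ = C * σ (J \ B) := by rw [iUnion_singleton_eq_range, Subtype.range_coe]
  -- A point of the finite part outside the jump set is not an atom, so the finitely many points of
  -- `B` can be removed.
  have h2 : σ (R.finitePart \ J) ≤ σ ((R.finitePart \ B) \ J) := by
    have h3 : σ ((R.finitePart \ J) ∩ B) = 0 := by
      refine measure_mono_null (t := ⋃ x ∈ (R.finitePart \ J) ∩ B, {x})
        (fun x hx => by simpa using hx) ?_
      rw [measure_biUnion_null_iff (B.countable_toSet.mono inter_subset_right)]
      intro x hx
      by_contra hne
      exact hx.1.2 ((R.mem_jumpSet_iff hab hx.1.1).2 hne)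
    rw [← measure_inter_add_sdiff (R.finitePart \ J) hBm, h3, zero_add]
    exact measure_mono fun x hx => ⟨⟨hx.1.1, hx.2⟩, hx.1.2⟩
  calc surfaceEnergy a b c₀ u + C * σ (R.finitePart \ J)
      ≤ 2 * C * B.card + C * σ (J \ B) + C * σ ((R.finitePart \ B) \ J) := by gcongr
    _ = 2 * C * B.card + C * (σ (J \ B) + σ ((R.finitePart \ B) \ J)) := by rw [mul_add, add_assoc]
    _ ≤ 2 * C * B.card + C * (σ ((R.finitePart \ B) ∩ J) + σ ((R.finitePart \ B) \ J)) := by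
        gcongr
        intro x hx
        refine ⟨⟨?_, hx.2⟩, hx.1⟩
        by_contra h
        exact hx.2 (hB ⟨hx.1, h⟩)
    _ = _ := by rw [measure_inter_add_sdiff _ hJm]

/-- A finite measure has only finitely many atoms of mass at least 2; jumps outside the finite part
sit at nodes. -/
theorem finite_bigJumps (R : BVInfRep a b u) (hab : a < b) :
    {x ∈ jumpSet a b u | 2 ≤ jumpAbs u x}.Finite := by
  have h1 : {x : ℝ | 2 ≤ singVar a b R.w {x}}.Finite := by
    refine Measure.finite_const_le_meas_of_disjoint_iUnion (singVar a b R.w)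
      (by simp : (0 : ℝ≥0∞) < 2)
      (fun _ => measurableSet_singleton _) (fun x y hxy => ?_) (measure_ne_top _ _)
    simpa [Function.onFun] using hxy
  refine (h1.union (Set.finite_range R.x)).subset fun x hx => ?_
  by_cases h : x ∈ R.finitePart
  · left
    have := hx.2
    rwa [R.jumpAbs_of_mem_finitePart hab h] at this
  · exact Or.inr (R.jumpSet_sdiff_subset hab ⟨hx.1, h⟩)

/-- For the upper bound: 2 is exactly the size at which `f` saturates, so with this `B` both
estimates of a jump's cost are equalities. -/
theorem le_surfaceEnergy_add (hab : a < b) (c₀ : ℝ) (B : Finset ℝ)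
    (hB : (B : Set ℝ) = {x ∈ jumpSet a b u | 2 ≤ jumpAbs u x}) :
    2 * ENNReal.ofReal c₀ * B.card + ENNReal.ofReal c₀ * singVar a b R.w (R.finitePart \ B) ≤
      surfaceEnergy a b c₀ u + ENNReal.ofReal c₀ *
        R.singDeriv.totalVariation (R.finitePart \ jumpSet a b u) := by
  classical
  set C := ENNReal.ofReal c₀
  set σ := singVar a b R.w
  set J := jumpSet a b u with hJ
  rw [R.singDeriv_totalVariation_sdiff hab]
  have hBJ : (B : Set ℝ) ⊆ J := by rw [hB]; exact fun x hx => hx.1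
  have hJB : J \ B ⊆ R.finitePart := by
    intro x hx
    by_contra h
    refine hx.2 ?_
    rw [hB]
    exact ⟨hx.1, by rw [R.jumpAbs_eq_top hab hx.1 h]; exact le_top⟩
  have h1 : 2 * C * B.card + C * σ (J \ B) ≤ surfaceEnergy a b c₀ u := by
    rw [surfaceEnergy, ← ENNReal.tsum_mul_left]
    have e1 : ∑' x : J, 2 * f c₀ (jumpAbs u x / 2) =
        (∑' x : ↑(B : Set ℝ), 2 * f c₀ (jumpAbs u x / 2)) +
          ∑' x : ↑(J \ B), 2 * f c₀ (jumpAbs u x / 2) := by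
      conv_lhs => rw [← union_sdiff_cancel hBJ]
      exact Summable.tsum_union_disjoint (f := fun x => 2 * f c₀ (jumpAbs u x / 2))
        disjoint_sdiff_right ENNReal.summable ENNReal.summable
    rw [e1]
    gcongr
    · calc 2 * C * B.card = ∑' x : ↑(B : Set ℝ), 2 * C := by simp [mul_comm]
        _ ≤ _ := by
          refine ENNReal.tsum_le_tsum fun x => ?_
          have hx : (x : ℝ) ∈ {x ∈ J | 2 ≤ jumpAbs u x} := by rw [← hB]; exact x.2
          rw [f_of_one_le]
          rw [ENNReal.le_div_iff_mul_le (by simp) (by simp), one_mul]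
          exact hx.2
    · calc C * σ (J \ B) ≤ C * ∑' x : ↑(J \ B), σ {(x : ℝ)} := by
            gcongr
            have hc : (J \ B).Countable := (R.countable_jumpSet hab).mono sdiff_subset
            have := hc.to_subtype
            conv_lhs => rw [← Subtype.range_coe (s := J \ B), ← iUnion_singleton_eq_range]
            exact measure_iUnion_le _
        _ = ∑' x : ↑(J \ B), C * σ {(x : ℝ)} := ENNReal.tsum_mul_left.symm
        _ ≤ _ := by
          refine ENNReal.tsum_le_tsum fun x => ?_
          rw [← R.jumpAbs_of_mem_finitePart hab (hJB x.2)]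
          have hx : ¬ 2 ≤ jumpAbs u x := by
            intro h
            exact x.2.2 ((Set.ext_iff.1 hB _).2 ⟨x.2.1, h⟩)
          rw [f_of_lt_one, mul_left_comm, ENNReal.mul_div_cancel (by simp) (by simp)]
          rw [ENNReal.div_lt_iff (by simp) (by simp), one_mul]
          exact not_le.1 hx
  calc 2 * C * B.card + C * σ (R.finitePart \ B)
      ≤ 2 * C * B.card + C * (σ (J \ B) + σ (R.finitePart \ J)) := by
        gcongr
        refine (measure_mono fun x hx => ?_).trans (measure_union_le _ _)
        by_cases h : x ∈ J
        · exact Or.inl ⟨h, hx.2⟩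
        · exact Or.inr ⟨hx.1, h⟩
    _ = 2 * C * B.card + C * σ (J \ B) + C * σ (R.finitePart \ J) := by rw [mul_add, add_assoc]
    _ ≤ _ := by gcongr

end BVInfRep

/-! ### Duality -/

/-- Smooth approximation that respects the bound: write `ξ₀ = c₀ sin (η / c₀)`, approximate `η` in
L¹ by a smooth function, cut off, and apply the sine again. The sine is 1-Lipschitz and restores
`|ξ| ≤ c₀` automatically. -/
theorem exists_contDiff_lintegral_sub_le (ρ : Measure ℝ) [IsFiniteMeasure ρ] {U : Set ℝ}
    (hU : IsOpen U) {c₀ : ℝ} (hc₀ : 0 < c₀) {ξ₀ : ℝ → ℝ} (hm : Measurable ξ₀)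
    (hξ : ∀ t, |ξ₀ t| ≤ c₀) {δ : ℝ} (hδ : 0 < δ) :
    ∃ ξ : ℝ → ℝ, ContDiff ℝ 1 ξ ∧ HasCompactSupport ξ ∧ tsupport ξ ⊆ U ∧ (∀ t, |ξ t| ≤ c₀) ∧
      ∫⁻ t in U, ‖ξ t - ξ₀ t‖ₑ ∂ρ ≤ ENNReal.ofReal δ := by
  -- Off `K` the integrand is at most `2c₀`, so this choice leaves an error `δ / 2` there.
  obtain ⟨K, hKU, hK, hKδ⟩ := hU.measurableSet.exists_isCompact_sdiff_lt (μ := ρ)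
    (measure_ne_top _ _) (ε := ENNReal.ofReal (δ / (4 * c₀)))
    (by simpa using by positivity)
  have hKm := hK.measurableSet
  set η : ℝ → ℝ := fun t => c₀ * Real.arcsin (ξ₀ t / c₀) with hη
  have hηm : Measurable η := (Real.continuous_arcsin.measurable.comp (hm.div_const _)).const_mul _
  have hηξ : ∀ t, c₀ * Real.sin (η t / c₀) = ξ₀ t := by
    intro t
    have h := abs_le.1 (hξ t)
    rw [hη]
    simp only
    rw [mul_div_cancel_left₀ _ hc₀.ne', Real.sin_arcsin, mul_div_cancel₀ _ hc₀.ne']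
    · rw [le_div_iff₀ hc₀]; linarith
    · rw [div_le_one hc₀]; exact h.2
  have hηL : MemLp (K.indicator η) 1 ρ := by
    refine MemLp.of_bound (hηm.indicator hKm).aestronglyMeasurable (c₀ * (Real.pi / 2)) (.of_forall
      fun t => ?_)
    refine (norm_indicator_le_norm_self _ _).trans ?_
    rw [hη, norm_mul, Real.norm_of_nonneg hc₀.le]
    gcongr
    exact abs_le.2 ⟨Real.neg_pi_div_two_le_arcsin _, Real.arcsin_le_pi_div_two _⟩
  obtain ⟨g, hgc, hg, hgL⟩ := hηL.exist_eLpNorm_sub_le (by simp) le_rfl (half_pos hδ)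
  obtain ⟨K', hK', hKK', hK'U⟩ := exists_compact_between hK hU hKU
  obtain ⟨χ, hχ0, hχ1, -⟩ := exists_contMDiffMap_zero_one_of_isClosed (n := 1)
    (modelWithCornersSelf ℝ ℝ) isOpen_interior.isClosed_compl hK.isClosed
    (s := (interior K')ᶜ) (t := K) (disjoint_compl_left_iff_subset.2 hKK')
  have hχ : ContDiff ℝ 1 χ := χ.contMDiff.contDiff
  set ξ : ℝ → ℝ := fun t => c₀ * Real.sin (χ t * g t / c₀) with hξdef
  have hsupp : tsupport ξ ⊆ K' := by
    refine closure_minimal (fun t ht => ?_) hK'.isClosed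
    by_contra h
    refine ht ?_
    have : χ t = 0 := hχ0 (fun h' => h (interior_subset h'))
    simp [hξdef, this]
  have hle : ∀ t, |ξ t| ≤ c₀ := by
    intro t
    rw [hξdef, abs_mul, abs_of_pos hc₀]
    exact mul_le_of_le_one_right hc₀.le (Real.abs_sin_le_one _)
  refine ⟨ξ, ?_, hK'.of_isClosed_subset (isClosed_tsupport _) hsupp, hsupp.trans hK'U, hle, ?_⟩
  · have hg1 : ContDiff ℝ 1 g := hg.of_le (by exact_mod_cast le_top)
    exact contDiff_const.mul (Real.contDiff_sin.comp ((hχ.mul hg1).div_const _))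
  have hsplit : U = K ∪ (U \ K) := (union_sdiff_cancel hKU).symm
  have h1 : ∫⁻ t in K, ‖ξ t - ξ₀ t‖ₑ ∂ρ ≤ ENNReal.ofReal (δ / 2) := by
    calc ∫⁻ t in K, ‖ξ t - ξ₀ t‖ₑ ∂ρ ≤ ∫⁻ t in K, ‖(K.indicator η - g) t‖ₑ ∂ρ := by
          refine setLIntegral_mono' hKm fun t ht => ?_
          have hξt : ξ t = c₀ * Real.sin (g t / c₀) := by simp [hξdef, hχ1 ht]
          rw [← hηξ t, hξt, Pi.sub_apply, indicator_of_mem ht]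
          rw [enorm_le_iff_norm_le, ← mul_sub, norm_mul, Real.norm_of_nonneg hc₀.le]
          calc c₀ * ‖Real.sin (g t / c₀) - Real.sin (η t / c₀)‖
              ≤ c₀ * ‖g t / c₀ - η t / c₀‖ := by
                gcongr
                simpa [Real.dist_eq] using Real.lipschitzWith_sin.dist_le_mul (g t / c₀) (η t / c₀)
            _ = ‖η t - g t‖ := by
                rw [← sub_div, norm_div, Real.norm_of_nonneg hc₀.le, mul_div_cancel₀ _ hc₀.ne',
                  norm_sub_rev]
      _ ≤ ∫⁻ t, ‖(K.indicator η - g) t‖ₑ ∂ρ := setLIntegral_le_lintegral _ _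
      _ = eLpNorm (K.indicator η - g) 1 ρ := eLpNorm_one_eq_lintegral_enorm.symm
      _ ≤ _ := hgL
  have h2 : ∫⁻ t in U \ K, ‖ξ t - ξ₀ t‖ₑ ∂ρ ≤ ENNReal.ofReal (δ / 2) := by
    calc ∫⁻ t in U \ K, ‖ξ t - ξ₀ t‖ₑ ∂ρ ≤ ∫⁻ t in U \ K, ENNReal.ofReal (2 * c₀) ∂ρ := by
          refine lintegral_mono fun t => ?_
          rw [← ofReal_norm]
          refine ENNReal.ofReal_le_ofReal ((norm_sub_le _ _).trans ?_)
          have := hle t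
          have := hξ t
          simp only [Real.norm_eq_abs]
          linarith
      _ = ENNReal.ofReal (2 * c₀) * ρ (U \ K) := by rw [setLIntegral_const]
      _ ≤ ENNReal.ofReal (2 * c₀) * ENNReal.ofReal (δ / (4 * c₀)) := by gcongr
      _ = ENNReal.ofReal (δ / 2) := by
          rw [← ENNReal.ofReal_mul (by positivity)]
          congr 1
          field_simp
          norm_num
  calc ∫⁻ t in U, ‖ξ t - ξ₀ t‖ₑ ∂ρ
      ≤ (∫⁻ t in K, ‖ξ t - ξ₀ t‖ₑ ∂ρ) + ∫⁻ t in U \ K, ‖ξ t - ξ₀ t‖ₑ ∂ρ := by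
        conv_lhs => rw [hsplit]
        exact lintegral_union_le _ _ _
    _ ≤ ENNReal.ofReal (δ / 2) + ENNReal.ofReal (δ / 2) := add_le_add h1 h2
    _ = ENNReal.ofReal δ := by
        rw [← ENNReal.ofReal_add (by positivity) (by positivity), add_halves]

/-- The maximiser of `ξ v - ξ ^ 2 / 4` over `|ξ| ≤ c₀` is `2v` clipped to `[-c₀, c₀]`. -/
theorem clip_mul_sub {c₀ : ℝ} (hc₀ : 0 < c₀) (v : ℝ) :
    max (-c₀) (min c₀ (2 * v)) * v - max (-c₀) (min c₀ (2 * v)) ^ 2 / 4 = ψ c₀ |v| := by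
  unfold ψ
  rcases le_total 0 v with hv | hv
  · rw [abs_of_nonneg hv, max_eq_right (le_min (by linarith) (by linarith))]
    split_ifs with h
    · rw [min_eq_right (by linarith)]; ring
    · rw [min_eq_left (by linarith)]
  · rw [abs_of_nonpos hv, min_eq_right (by linarith)]
    split_ifs with h
    · rw [max_eq_right (by linarith)]; ring
    · rw [max_eq_left (by linarith)]; ring

theorem integrableOn_of_abs_le {ρ : Measure ℝ} {U : Set ℝ} (hρ : ρ U ≠ ∞) {ξ : ℝ → ℝ}
    (hm : Measurable ξ) {C : ℝ} (h : ∀ t, |ξ t| ≤ C) : IntegrableOn ξ U ρ :=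
  IntegrableOn.of_bound hρ.lt_top hm.aestronglyMeasurable C (.of_forall h)

theorem setIntegral_sub_le_of_lintegral {ρ : Measure ℝ} {U : Set ℝ} (hρ : ρ U ≠ ∞) {ξ η : ℝ → ℝ}
    (hξm : Measurable ξ) (hηm : Measurable η) {C : ℝ} (hξ : ∀ t, |ξ t| ≤ C) (hη : ∀ t, |η t| ≤ C)
    {δ : ℝ} (hδ : 0 ≤ δ) (h : ∫⁻ t in U, ‖ξ t - η t‖ₑ ∂ρ ≤ ENNReal.ofReal δ) :
    |(∫ t in U, ξ t ∂ρ) - ∫ t in U, η t ∂ρ| ≤ δ := by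
  rw [← integral_sub (integrableOn_of_abs_le hρ hξm hξ) (integrableOn_of_abs_le hρ hηm hη),
    ← ENNReal.ofReal_le_ofReal_iff hδ, ← Real.norm_eq_abs, ofReal_norm]
  exact (enorm_integral_le_lintegral_enorm _).trans h

theorem setIntegral_eq_singularPart_add (P : Measure ℝ) [IsFiniteMeasure P] {U : Set ℝ}
    (hU : MeasurableSet U) {ξ : ℝ → ℝ} (hξm : Measurable ξ) {C : ℝ} (hξ : ∀ t, |ξ t| ≤ C) :
    IntegrableOn (fun t => (P.rnDeriv volume t).toReal * ξ t) U ∧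
    ∫ t in U, ξ t ∂P = (∫ t in U, ξ t ∂(P.singularPart volume)) +
      ∫ t in U, (P.rnDeriv volume t).toReal * ξ t := by
  have hi : IntegrableOn (fun t => (P.rnDeriv volume t).toReal * ξ t) U :=
    (Integrable.mul_bdd (c := C) Measure.integrable_toReal_rnDeriv hξm.aestronglyMeasurable
      (.of_forall hξ)).integrableOn
  refine ⟨hi, ?_⟩
  have hP : P.restrict U = (P.singularPart volume).restrict U +
      (volume.withDensity (P.rnDeriv volume)).restrict U := by
    rw [← Measure.restrict_add, ← Measure.haveLebesgueDecomposition_add P volume]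
  have h2 : IntegrableOn ξ U (volume.withDensity (P.rnDeriv volume)) :=
    integrableOn_of_abs_le (measure_ne_top _ _) hξm hξ
  rw [hP, integral_add_measure (integrableOn_of_abs_le (measure_ne_top _ _) hξm hξ) h2]
  congr 1
  rw [restrict_withDensity hU, integral_withDensity_eq_integral_toReal_smul
    (Measure.measurable_rnDeriv _ _)]
  · rfl
  · exact ae_restrict_of_ae (Measure.rnDeriv_lt_top _ _)

/-- The optimal dual function is the clipped `2v` for the absolutely continuous part and `±c₀`, with
the sign of the measure, for the singular part. It is only measurable, so it is approximated in L¹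
of the positive part, the negative part and Lebesgue measure at once. -/
theorem lintegral_ψ_add_le {s : SignedMeasure ℝ} {U : Set ℝ} (hU : IsOpen U)
    (hUv : volume U ≠ ∞) {c₀ : ℝ} (hc₀ : 0 < c₀) {M : ℝ}
    (h : ∀ ξ : ℝ → ℝ, ContDiff ℝ 1 ξ → HasCompactSupport ξ → tsupport ξ ⊆ U → (∀ t, |ξ t| ≤ c₀) →
      signedIntegral s ξ - ∫ t in U, ξ t ^ 2 / 4 ≤ M) :
    (∫⁻ t in U, ENNReal.ofReal (ψ c₀ |s.rnDeriv volume t|)) +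
      ENNReal.ofReal c₀ * (s.singularPart volume).totalVariation U ≤ ENNReal.ofReal M := by
  set P := posM s with hP
  set N := negM s with hN
  set Ps := P.singularPart volume with hPs
  set Ns := N.singularPart volume with hNs
  have hUm := hU.measurableSet
  obtain ⟨A, hA, hPA, hNA⟩ := s.toJordanDecomposition.mutuallySingular
  -- `Zᶜ` is Lebesgue null and carries the singular parts; on it `Aᶜ` carries the positive and `A`
  -- the negative one.
  obtain ⟨Z, hZ, hZs, hZv⟩ := (Measure.mutuallySingular_singularPart P volume).add_left
    (Measure.mutuallySingular_singularPart N volume)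
  set v := s.rnDeriv volume with hv
  have hvm : Measurable v := SignedMeasure.measurable_rnDeriv _ _
  have hvi : Integrable v volume := SignedMeasure.integrable_rnDeriv _ _
  classical
  set ξ₀ : ℝ → ℝ := Zᶜ.piecewise (Aᶜ.piecewise (fun _ => c₀) fun _ => -c₀)
    (fun t => max (-c₀) (min c₀ (2 * v t))) with hξ₀
  have hξm : Measurable ξ₀ :=
    (measurable_const.piecewise hA.compl measurable_const).piecewise hZ.compl
      (measurable_const.max (measurable_const.min (hvm.const_mul 2)))
  have hξle : ∀ t, |ξ₀ t| ≤ c₀ := by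
    intro t
    rw [hξ₀]
    by_cases h1 : t ∈ Zᶜ
    · rw [piecewise_eq_of_mem _ _ _ h1]
      by_cases h2 : t ∈ Aᶜ
      · rw [piecewise_eq_of_mem _ _ _ h2, abs_of_pos hc₀]
      · rw [piecewise_eq_of_notMem _ _ _ h2, abs_neg, abs_of_pos hc₀]
    · rw [piecewise_eq_of_notMem _ _ _ h1, abs_le]
      exact ⟨le_max_left _ _, max_le (by linarith) (min_le_left _ _)⟩
  have hPs0 : ∀ᵐ t ∂Ps, ξ₀ t = c₀ := by
    have h1 : Ps A = 0 := le_antisymm ((Measure.singularPart_le P volume A).trans hPA.le) zero_le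
    have h2 : Ps Z = 0 := (add_eq_zero.1 hZs).1
    filter_upwards [measure_eq_zero_iff_ae_notMem.1 h1, measure_eq_zero_iff_ae_notMem.1 h2]
      with t ht1 ht2
    rw [hξ₀, piecewise_eq_of_mem _ _ _ ht2, piecewise_eq_of_mem _ _ _ ht1]
  have hNs0 : ∀ᵐ t ∂Ns, ξ₀ t = -c₀ := by
    have h1 : Ns Aᶜ = 0 :=
      le_antisymm ((Measure.singularPart_le N volume _).trans hNA.le) zero_le
    have h2 : Ns Z = 0 := (add_eq_zero.1 hZs).2
    filter_upwards [measure_eq_zero_iff_ae_notMem.1 h1, measure_eq_zero_iff_ae_notMem.1 h2]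
      with t ht1 ht2
    rw [hξ₀, piecewise_eq_of_mem _ _ _ ht2, piecewise_eq_of_notMem _ _ _ ht1]
  have hv0 : ∀ᵐ t, ξ₀ t = max (-c₀) (min c₀ (2 * v t)) := by
    filter_upwards [measure_eq_zero_iff_ae_notMem.1 hZv] with t ht
    rw [hξ₀, piecewise_eq_of_notMem _ _ _ ht]
  have hsq : ∀ {ξ : ℝ → ℝ}, Measurable ξ → (∀ t, |ξ t| ≤ c₀) →
      IntegrableOn (fun t => ξ t ^ 2 / 4) U := by
    intro ξ hm hle
    refine integrableOn_of_abs_le hUv ((hm.pow_const 2).div_const 4) (C := c₀ ^ 2 / 4) fun t => ?_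
    rw [abs_of_nonneg (by positivity), ← sq_abs]
    have := abs_nonneg (ξ t)
    have := hle t
    gcongr
  obtain ⟨hPi, hPe⟩ := setIntegral_eq_singularPart_add P hUm hξm hξle
  obtain ⟨hNi, hNe⟩ := setIntegral_eq_singularPart_add N hUm hξm hξle
  have hψ : ∀ᵐ t ∂(volume.restrict U), (P.rnDeriv volume t).toReal * ξ₀ t -
      (N.rnDeriv volume t).toReal * ξ₀ t - ξ₀ t ^ 2 / 4 = ψ c₀ |v t| := by
    filter_upwards [ae_restrict_of_ae hv0] with t ht
    rw [← clip_mul_sub hc₀, ← ht, hv, SignedMeasure.rnDeriv_def]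
    ring
  have hψi : IntegrableOn (fun t => ψ c₀ |v t|) U :=
    ((hPi.sub hNi).sub (hsq hξm hξle)).congr hψ
  have hψ0 : ∀ t, 0 ≤ ψ c₀ |v t| := fun t => by
    simpa using mul_sub_le_ψ (c₀ := c₀) (ξ := 0) (by simpa using hc₀.le) (v t)
  have hJ : (∫ t in U, ξ₀ t ∂P) - (∫ t in U, ξ₀ t ∂N) - ∫ t in U, ξ₀ t ^ 2 / 4 =
      (∫ t in U, ψ c₀ |v t|) + c₀ * (Ps.real U + Ns.real U) := by
    have e1 : ∫ t in U, ξ₀ t ∂Ps = c₀ * Ps.real U := by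
      rw [integral_congr_ae (ae_restrict_of_ae hPs0), setIntegral_const, smul_eq_mul, mul_comm]
    have e2 : ∫ t in U, ξ₀ t ∂Ns = -(c₀ * Ns.real U) := by
      rw [integral_congr_ae (ae_restrict_of_ae hNs0), setIntegral_const, smul_eq_mul]
      ring
    have e3 := integral_sub (hPi.sub hNi) (hsq hξm hξle)
    have e4 := integral_sub hPi hNi
    simp only [Pi.sub_apply] at e3
    rw [hPe, hNe, ← hPs, ← hNs, e1, e2, ← integral_congr_ae hψ, e3, e4]
    ring
  have hM : (∫ t in U, ψ c₀ |v t|) + c₀ * (Ps.real U + Ns.real U) ≤ M := by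
    rw [← hJ]
    refine le_of_forall_pos_le_add fun η hη => ?_
    -- The errors are `δ` for each Jordan part and at most `c₀ δ` for the quadratic term.
    set δ := η / (2 + c₀) with hδ
    have hδ0 : 0 < δ := by positivity
    have : IsFiniteMeasure (volume.restrict U) := ⟨by simpa using hUv.lt_top⟩
    obtain ⟨ξ, h1, h2, h3, h4, h5⟩ := exists_contDiff_lintegral_sub_le
      (P + N + volume.restrict U) hU hc₀ hξm hξle hδ0
    have hm := h1.continuous.measurable
    rw [Measure.restrict_add, Measure.restrict_add, lintegral_add_measure,
      lintegral_add_measure, Measure.restrict_restrict hUm, inter_self] at h5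
    have hP1 := setIntegral_sub_le_of_lintegral (measure_ne_top P U) hm hξm h4 hξle hδ0.le
      ((le_self_add.trans le_self_add).trans h5)
    have hN1 := setIntegral_sub_le_of_lintegral (measure_ne_top N U) hm hξm h4 hξle hδ0.le
      ((le_add_self.trans le_self_add).trans h5)
    have hV1 : |(∫ t in U, ξ t ^ 2 / 4) - ∫ t in U, ξ₀ t ^ 2 / 4| ≤ c₀ * δ := by
      refine setIntegral_sub_le_of_lintegral hUv ((hm.pow_const 2).div_const 4)
        ((hξm.pow_const 2).div_const 4) (C := c₀ ^ 2 / 4) (fun t => ?_) (fun t => ?_)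
        (by positivity) ?_
      · rw [abs_of_nonneg (by positivity), ← sq_abs]
        have := abs_nonneg (ξ t)
        have := h4 t
        gcongr
      · rw [abs_of_nonneg (by positivity), ← sq_abs]
        have := abs_nonneg (ξ₀ t)
        have := hξle t
        gcongr
      · calc ∫⁻ t in U, ‖ξ t ^ 2 / 4 - ξ₀ t ^ 2 / 4‖ₑ
            ≤ ∫⁻ t in U, ENNReal.ofReal c₀ * ‖ξ t - ξ₀ t‖ₑ := by
              refine lintegral_mono fun t => ?_
              rw [← ofReal_norm, ← ofReal_norm, ← ENNReal.ofReal_mul hc₀.le]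
              refine ENNReal.ofReal_le_ofReal ?_
              rw [show ξ t ^ 2 / 4 - ξ₀ t ^ 2 / 4 = ((ξ t + ξ₀ t) / 4) * (ξ t - ξ₀ t) by ring,
                norm_mul]
              gcongr
              have e1 := abs_le.1 (h4 t)
              have e2 := abs_le.1 (hξle t)
              rw [Real.norm_eq_abs, abs_le]
              constructor <;> linarith
          _ = ENNReal.ofReal c₀ * ∫⁻ t in U, ‖ξ t - ξ₀ t‖ₑ :=
              lintegral_const_mul _ (hm.sub hξm).enorm
          _ ≤ ENNReal.ofReal c₀ * ENNReal.ofReal δ := by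
              gcongr
              exact le_add_self.trans h5
          _ = _ := (ENNReal.ofReal_mul hc₀.le).symm
    have hξ := h ξ h1 h2 h3 h4
    have hz : ∀ t, t ∉ U → ξ t = 0 := fun t ht =>
      image_eq_zero_of_notMem_tsupport fun h => ht (h3 h)
    rw [signedIntegral, ← setIntegral_eq_integral_of_forall_compl_eq_zero (s := U) (μ := posM s) hz,
      ← setIntegral_eq_integral_of_forall_compl_eq_zero (s := U) (μ := negM s) hz] at hξ
    have hηδ : (2 + c₀) * δ = η := by rw [hδ]; field_simp
    have := abs_le.1 hP1
    have := abs_le.1 hN1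
    have := abs_le.1 hV1
    linarith
  rw [SignedMeasure.singularPart_totalVariation, ← ofReal_integral_eq_lintegral_ofReal hψi
    (.of_forall hψ0)]
  refine le_trans (le_of_eq ?_) (ENNReal.ofReal_le_ofReal hM)
  rw [ENNReal.ofReal_add (integral_nonneg hψ0) (by positivity), ENNReal.ofReal_mul hc₀.le,
    ← measureReal_add_apply, ofReal_measureReal]

/-! ### Lower semicontinuity away from the concentration points. -/

namespace BoundedSeq

variable {a b c₀ : ℝ} {c : ℝ≥0∞} {B : Finset ℝ} {u : ℝ → EReal} {v : ℕ → ℝ → ℝ} {k₀ : ℕ → ℝ}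

theorem eventually_bounded_of_isCompact (h : BoundedSeq a b c₀ c B u v k₀) (R : BVInfRep a b u)
    {S : Set ℝ} (hS : IsCompact S) (hSU : S ⊆ R.finitePart \ B) :
    ∃ M : ℝ, ∀ᶠ k in atTop, ∀ y ∈ S, |k₀ k + cumul (density a b (v k)) y| ≤ M := by
  refine hS.induction_on (p := fun S => ∃ M : ℝ, ∀ᶠ k in atTop, ∀ y ∈ S,
    |k₀ k + cumul (density a b (v k)) y| ≤ M) ⟨0, by simp⟩ ?_ ?_ ?_
  · rintro s t hst ⟨M, hM⟩
    exact ⟨M, hM.mono fun k hk y hy => hk y (hst hy)⟩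
  · rintro s t ⟨M, hM⟩ ⟨M', hM'⟩
    refine ⟨max M M', ?_⟩
    filter_upwards [hM, hM'] with k h1 h2 y hy
    rcases hy with hy | hy
    · exact (h1 y hy).trans (le_max_left _ _)
    · exact (h2 y hy).trans (le_max_right _ _)
  · intro x hx
    have hU : IsOpen (R.finitePart \ B) := R.isOpen_finitePart.sdiff B.finite_toSet.isClosed
    obtain ⟨δ, hδ, hball⟩ := Metric.isOpen_iff.1 hU x (hSU hx)
    have hI : Icc (x - δ / 2) (x + δ / 2) ⊆ R.finitePart \ B := by
      refine Subset.trans (fun y hy => ?_) hball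
      rw [Metric.mem_ball, Real.dist_eq, abs_lt]
      constructor <;> linarith [hy.1, hy.2]
    obtain ⟨M, hM⟩ := h.eventually_bounded (p := x - δ / 2) (q := x + δ / 2) (by linarith)
      (fun y hy => ⟨R.finitePart_subset (hI hy).1, (hI hy).2⟩) (by
        filter_upwards [ae_restrict_mono (fun y hy => (hI (Ioo_subset_Icc_self hy)).1)
          R.ae_eq_on_finitePart] with y hy
        simp [hy])
    exact ⟨_, mem_nhdsWithin_of_mem_nhds (Icc_mem_nhds (by linarith) (by linarith)), M, hM⟩

/-- After integration by parts only convergence of the functions is needed. The constants `k₀` drop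
out because `ξ'` has integral zero, and the local bound on the support of `ξ` allows dominated
convergence. -/
theorem tendsto_integral_mul_deriv (h : BoundedSeq a b c₀ c B u v k₀) (R : BVInfRep a b u)
    {ξ : ℝ → ℝ} (hξ : ContDiff ℝ 1 ξ) (hc : HasCompactSupport ξ)
    (hs : tsupport ξ ⊆ R.finitePart \ B) :
    Tendsto (fun k => signedIntegral (density a b (v k)) ξ) atTop
      (𝓝 (signedIntegral (distribDeriv a b R.w) ξ)) := by
  have hsab : tsupport ξ ⊆ Ioo a b := fun x hx => R.finitePart_subset (hs hx).1
  have h0 : ∫ t, deriv ξ t = 0 := by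
    exact integral_eq_zero_of_hasDerivAt_of_integrable
      (fun t => (hξ.differentiable one_ne_zero t).hasDerivAt)
      ((hξ.continuous_deriv le_rfl).integrable_of_hasCompactSupport hc.deriv)
      (hξ.continuous.integrable_of_hasCompactSupport hc)
  have hdi : Integrable (deriv ξ) :=
    (hξ.continuous_deriv le_rfl).integrable_of_hasCompactSupport hc.deriv
  have e1 : ∀ k, signedIntegral (density a b (v k)) ξ =
      -∫ t in tsupport ξ, (k₀ k + cumul (density a b (v k)) t) * deriv ξ t := by
    intro k
    rw [setIntegral_mul_deriv_eq Subset.rfl, ← neg_eq_iff_eq_neg,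
      ← integral_cumul_mul_deriv _ hξ hc]
    simp_rw [add_mul]
    rw [integral_add (hdi.const_mul _) (integrable_cumul_mul_deriv _ hξ hc), integral_const_mul, h0,
      mul_zero, zero_add]
  have e2 : signedIntegral (distribDeriv a b R.w) ξ = -∫ t in tsupport ξ, R.w t * deriv ξ t := by
    rw [setIntegral_mul_deriv_eq Subset.rfl, ← neg_eq_iff_eq_neg,
      ← R.isBV_w.hasDistribDeriv ξ hξ hc hsab, setIntegral_mul_deriv_eq hsab]
  simp_rw [e1, e2]
  refine Tendsto.neg ?_
  obtain ⟨M, hM⟩ := h.eventually_bounded_of_isCompact R hc.isCompact hs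
  refine tendsto_integral_filter_of_dominated_convergence (fun t => M * ‖deriv ξ t‖) ?_ ?_ ?_ ?_
  · refine .of_forall fun k => ?_
    exact (((measurable_cumul _).const_add _).mul
      (hξ.continuous_deriv le_rfl).measurable).aestronglyMeasurable
  · filter_upwards [hM] with k hk
    filter_upwards [ae_restrict_mem (isClosed_tsupport ξ).measurableSet] with t ht
    rw [norm_mul]
    gcongr
    exact hk t ht
  · exact (hdi.norm.const_mul M).integrableOn
  · filter_upwards [ae_restrict_mono hsab h.conv,
      ae_restrict_mono (fun x hx => (hs hx).1) R.ae_eq_on_finitePart] with t h1 h2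
    rw [h2, EReal.tendsto_coe] at h1
    exact h1.mul_const _

/-- Duality on the finite part minus `B` uses up the budget left after paying `2c₀` for each point
of `B`; these payments then cover the jumps in `B`, including all those with an infinite side. -/
theorem energy_le (h : BoundedSeq a b c₀ c B u v k₀) (R : BVInfRep a b u) : R.energy c₀ ≤ c := by
  set U := R.finitePart \ (B : Set ℝ) with hU
  have hUo : IsOpen U := R.isOpen_finitePart.sdiff B.finite_toSet.isClosed
  have hUab : U ⊆ Ioo a b := fun x hx => R.finitePart_subset hx.1
  have hUv : volume U ≠ ∞ := ne_top_of_le_ne_top (by simp) (measure_mono hUab)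
  have hcB : 2 * ENNReal.ofReal c₀ * B.card ≤ c := by
    obtain ⟨k, hk⟩ := (h.bound ∅ isCompact_empty (empty_subset _)).exists
    exact le_add_self.trans hk
  have hcard : 2 * ENNReal.ofReal c₀ * B.card ≠ ∞ := ne_top_of_le_ne_top h.hc hcB
  have hdual := lintegral_ψ_add_le (s := distribDeriv a b R.w) hUo hUv h.hc₀
    (M := (c - 2 * ENNReal.ofReal c₀ * B.card).toReal) fun ξ hξ hc hs hle => by
      -- For a fixed test function the inequality holds along the sequence by `mul_sub_le_ψ` and
      -- passes to the limit.
      have hlim := (h.tendsto_integral_mul_deriv R hξ hc hs).sub_const (∫ t in U, ξ t ^ 2 / 4)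
      refine le_of_tendsto hlim ?_
      filter_upwards [h.bound _ hc.isCompact (hs.trans fun x hx => ⟨hUab hx, hx.2⟩)] with k hk
      have hz : ∀ t, t ∉ tsupport ξ → ξ t = 0 := fun t ht => image_eq_zero_of_notMem_tsupport ht
      have hS : ∀ t ∉ Ioo a b, ξ t = 0 := fun t ht => hz t fun h' => ht (hUab (hs h'))
      rw [signedIntegral_density (h.meas k) (h.int k) hξ hc,
        setIntegral_eq_integral_of_forall_compl_eq_zero (fun t ht => by rw [hS t ht, zero_mul]),
        setIntegral_eq_integral_of_forall_compl_eq_zero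
          (fun t ht => by rw [hz t fun h' => ht (hs h')]; simp),
        ← setIntegral_eq_integral_of_forall_compl_eq_zero (s := tsupport ξ)
          (fun t ht => by rw [hz t ht, zero_mul]),
        ← setIntegral_eq_integral_of_forall_compl_eq_zero (s := tsupport ξ)
          (f := fun t => ξ t ^ 2 / 4) (fun t ht => by rw [hz t ht]; simp)]
      have hvi : IntegrableOn (v k) (tsupport ξ) := (h.int k).mono_set (hs.trans hUab)
      have i1 : IntegrableOn (fun t => ξ t * v k t) (tsupport ξ) :=
        hvi.bdd_mul hξ.continuous.aestronglyMeasurable (.of_forall hle)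
      have i2 : IntegrableOn (fun t => ξ t ^ 2 / 4) (tsupport ξ) :=
        ((hξ.continuous.pow 2).div_const 4).continuousOn.integrableOn_compact hc.isCompact
      rw [← integral_sub i1 i2]
      have h1 : (∫⁻ t in tsupport ξ, ENNReal.ofReal (ψ c₀ |v k t|)) ≤
          c - 2 * ENNReal.ofReal c₀ * B.card := ENNReal.le_sub_of_add_le_right hcard hk
      have h2 : c - 2 * ENNReal.ofReal c₀ * B.card ≠ ∞ := ne_top_of_le_ne_top h.hc tsub_le_self
      refine le_trans ?_ (ENNReal.toReal_mono h2 h1)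
      have hψ0 : ∀ t, 0 ≤ ψ c₀ |v k t| := fun t => by
        simpa using mul_sub_le_ψ (c₀ := c₀) (ξ := 0) (by simpa using h.hc₀.le) (v k t)
      have hψm : Measurable fun t => ψ c₀ |v k t| :=
        (continuous_ψ c₀).measurable.comp (h.meas k).abs
      have hψi : IntegrableOn (fun t => ψ c₀ |v k t|) (tsupport ξ) := by
        refine ⟨hψm.aestronglyMeasurable, ?_⟩
        rw [hasFiniteIntegral_iff_ofReal (.of_forall hψ0)]
        exact h1.trans_lt h2.lt_top
      rw [← integral_eq_lintegral_of_nonneg_ae (.of_forall hψ0) hψm.aestronglyMeasurable]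
      exact integral_mono (i1.sub i2) hψi fun t => mul_sub_le_ψ (hle t) _
  rw [ENNReal.ofReal_toReal (ne_top_of_le_ne_top h.hc tsub_le_self)] at hdual
  -- Near a point off `B` the trichotomy applies: a constant infinite limit excludes a jump, and
  -- finiteness on both sides puts the point in the finite part.
  have hJ : jumpSet a b u \ R.finitePart ⊆ B := by
    intro x hx
    by_contra hxB
    have hxU : x ∈ Ioo a b \ (B : Set ℝ) := ⟨hx.1.1, hxB⟩
    obtain ⟨δ, hδ, hball⟩ := Metric.isOpen_iff.1
      (isOpen_Ioo.sdiff B.finite_toSet.isClosed) x hxU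
    rw [Real.ball_eq_Ioo] at hball
    have hr : x < x + δ := by linarith
    have hl : x - δ < x := by linarith
    obtain ⟨i, hi⟩ := R.exists_right hx.1.1
    obtain ⟨j, hj⟩ := R.exists_left hx.1.1
    obtain ⟨kw, hkw⟩ := R.isBV_w.exists_ae_eq h.hab
    have tr := R.tendsto_right hx.1.1 hi hkw
    have tl := R.tendsto_left hx.1.1 hj hkw
    have hmr : Ioo x (x + δ) ⊆ Ioo (x - δ) (x + δ) := Ioo_subset_Ioo_left hl.le
    have hml : Ioo (x - δ) x ⊆ Ioo (x - δ) (x + δ) := Ioo_subset_Ioo_right hr.le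
    have er := eventually_essRight hi.2 (ae_restrict_mono (Ioo_subset_Ioo_left hi.1) (R.eq_ae i))
    have el := eventually_essLeft hj.1 (ae_restrict_mono (Ioo_subset_Ioo_right hj.2) (R.eq_ae j))
    have hconst : ∀ z : EReal, ¬ ∀ᵐ t ∂(volume.restrict (Ioo (x - δ) (x + δ))), u t = z := by
      intro z hz
      have t1 : Tendsto u (essRight x) (𝓝 z) := tendsto_const_nhds.congr'
        ((eventually_essRight hr (ae_restrict_mono hmr hz)).mono fun _ => Eq.symm)
      have t2 : Tendsto u (essLeft x) (𝓝 z) := tendsto_const_nhds.congr'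
        ((eventually_essLeft hl (ae_restrict_mono hml hz)).mono fun _ => Eq.symm)
      exact (mem_jumpSet_iff hx.1.1 t1 t2).1 hx.1 rfl
    rcases h.trichotomy hball with h1 | h1 | ⟨h1, -⟩
    · exact hconst _ h1
    · exact hconst _ h1
    · obtain ⟨t, ht1, ht2⟩ := (er.and (eventually_essRight hr (ae_restrict_mono hmr h1))).exists
      obtain ⟨t', ht1', ht2'⟩ := (el.and (eventually_essLeft hl (ae_restrict_mono hml h1))).exists
      refine hx.2 (R.mem_finitePart ?_ ?_ hi hj)
      · rcases R.α_mem i with h3 | h3 | h3 <;> simp [h3] at ht1 ⊢ <;> simp [ht1] at ht2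
      · rcases R.α_mem j with h3 | h3 | h3 <;> simp [h3] at ht1' ⊢ <;> simp [ht1'] at ht2'
  have hF : (∫⁻ t in R.finitePart, ENNReal.ofReal (ψ c₀ |acDeriv a b R.w t|)) =
      ∫⁻ t in U, ENNReal.ofReal (ψ c₀ |acDeriv a b R.w t|) := by
    rw [hU]
    refine (setLIntegral_congr (sdiff_ae_eq_self.2 ?_)).symm
    exact measure_mono_null inter_subset_right (B.finite_toSet.measure_zero _)
  calc R.energy c₀ = (∫⁻ t in U, ENNReal.ofReal (ψ c₀ |acDeriv a b R.w t|)) +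
        (surfaceEnergy a b c₀ u + ENNReal.ofReal c₀ *
          R.singDeriv.totalVariation (R.finitePart \ jumpSet a b u)) := by
        rw [BVInfRep.energy, hF, add_assoc]
    _ ≤ (∫⁻ t in U, ENNReal.ofReal (ψ c₀ |acDeriv a b R.w t|)) +
        (2 * ENNReal.ofReal c₀ * B.card + ENNReal.ofReal c₀ * singVar a b R.w U) := by
        exact add_le_add le_rfl (R.surfaceEnergy_add_le h.hab c₀ B hJ)
    _ = ((∫⁻ t in U, ENNReal.ofReal (ψ c₀ |acDeriv a b R.w t|)) +
        ENNReal.ofReal c₀ * singVar a b R.w U) + 2 * ENNReal.ofReal c₀ * B.card := by ring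
    _ ≤ c := by
        rw [← tsub_add_cancel_of_le hcB]
        gcongr
        exact hdual

end BoundedSeq

/-! ### The optimal eigendeformation -/

theorem abs_gStar_le {c₀ : ℝ} (hc₀ : 0 < c₀) (a b : ℝ) (u : ℝ → ℝ) (t : ℝ) :
    |gStar a b c₀ u t| ≤ |acDeriv a b u t| := by
  unfold gStar
  split_ifs with h
  · rcases lt_trichotomy (acDeriv a b u t) 0 with h0 | h0 | h0
    · rw [abs_of_neg h0] at h
      rw [sign_neg h0, abs_of_neg h0]
      norm_num
      rw [abs_le]; constructor <;> linarith
    · rw [h0, abs_zero] at h; linarith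
    · rw [abs_of_pos h0] at h
      rw [sign_pos h0, abs_of_pos h0]
      norm_num
      rw [abs_le]; constructor <;> linarith
  · simp

/-- Thresholding leaves a bounded elastic strain, so square integrability is automatic on a bounded
interval. -/
theorem abs_sub_gStar_le {c₀ : ℝ} (hc₀ : 0 < c₀) (a b : ℝ) (u : ℝ → ℝ) (t : ℝ) :
    |acDeriv a b u t - gStar a b c₀ u t| ≤ c₀ / 2 := by
  unfold gStar
  split_ifs with h
  · rw [sub_sub_cancel, abs_mul, abs_of_pos (half_pos hc₀)]
    refine mul_le_of_le_one_left (half_pos hc₀).le ?_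
    rcases lt_trichotomy (acDeriv a b u t) 0 with h0 | h0 | h0
    · simp [sign_neg h0]
    · simp [h0]
    · simp [sign_pos h0]
  · simpa using h

/-- Equality in `ψ_le_add`: soft thresholding at `c₀ / 2` is the pointwise minimiser. -/
theorem ofReal_ψ_eq {c₀ : ℝ} (hc₀ : 0 < c₀) (a b : ℝ) (u : ℝ → ℝ) (t : ℝ) :
    ‖acDeriv a b u t - gStar a b c₀ u t‖ₑ ^ 2 + ENNReal.ofReal c₀ * ‖gStar a b c₀ u t‖ₑ =
      ENNReal.ofReal (ψ c₀ |acDeriv a b u t|) := by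
  rw [← ofReal_norm, ← ofReal_norm, ← ENNReal.ofReal_pow (norm_nonneg _),
    ← ENNReal.ofReal_mul hc₀.le, ← ENNReal.ofReal_add (by positivity) (by positivity)]
  congr 1
  simp only [Real.norm_eq_abs, sq_abs]
  unfold gStar ψ
  split_ifs with h h' h'
  · linarith
  · rcases lt_trichotomy (acDeriv a b u t) 0 with h0 | h0 | h0
    · rw [abs_of_neg h0] at h ⊢
      rw [sign_neg h0]
      norm_num
      rw [abs_of_neg (by linarith)]; ring
    · rw [h0, abs_zero] at h; linarith
    · rw [abs_of_pos h0] at h ⊢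
      rw [sign_pos h0]
      norm_num
      rw [abs_of_pos (by linarith)]; ring
  · simp
  · have : |acDeriv a b u t| = c₀ / 2 := le_antisymm (not_lt.1 h) (not_lt.1 h')
    rw [sub_zero, abs_zero, mul_zero, add_zero, ← sq_abs, this]; ring

theorem measurable_gStar (a b c₀ : ℝ) (u : ℝ → ℝ) : Measurable (gStar a b c₀ u) := by
  have h := measurable_acDeriv a b u
  have hs : Measurable fun t => ((SignType.sign (acDeriv a b u t) : SignType) : ℝ) := by
    have : (fun s : ℝ => ((SignType.sign s : SignType) : ℝ)) =
        fun s => if 0 < s then 1 else if s < 0 then -1 else 0 := by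
      funext s
      rcases lt_trichotomy s 0 with h0 | h0 | h0
      · simp [h0, h0.not_gt]
      · simp [h0]
      · simp [h0]
    have hm : Measurable fun s : ℝ => ((SignType.sign s : SignType) : ℝ) := by
      rw [this]
      exact Measurable.ite measurableSet_Ioi measurable_const
        (Measurable.ite measurableSet_Iio measurable_const measurable_const)
    exact hm.comp h
  exact Measurable.ite (measurableSet_lt measurable_const h.abs) (h.sub (hs.mul_const _))
    measurable_const

theorem integrable_gStar {c₀ : ℝ} (hc₀ : 0 < c₀) (a b : ℝ) (u : ℝ → ℝ) :
    Integrable (gStar a b c₀ u) :=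
  (integrable_acDeriv a b u).mono (measurable_gStar a b c₀ u).aestronglyMeasurable
    (.of_forall (abs_gStar_le hc₀ a b u))

theorem memLp_sub_gStar {c₀ : ℝ} (hc₀ : 0 < c₀) (a b : ℝ) (u : ℝ → ℝ) (ν : Measure ℝ)
    [IsFiniteMeasure ν] : MemLp (fun t => acDeriv a b u t - gStar a b c₀ u t) 2 ν :=
  MemLp.of_bound ((measurable_acDeriv a b u).sub (measurable_gStar a b c₀ u)).aestronglyMeasurable
    (c₀ / 2) (.of_forall (abs_sub_gStar_le hc₀ a b u))

theorem lintegral_sub_gStar {c₀ : ℝ} (hc₀ : 0 < c₀) (a b : ℝ) (u : ℝ → ℝ) (ν : Measure ℝ) :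
    (∫⁻ t, ‖acDeriv a b u t - gStar a b c₀ u t‖ₑ ^ 2 ∂ν) +
      ENNReal.ofReal c₀ * (∫⁻ t, ‖gStar a b c₀ u t‖ₑ ∂ν) =
      ∫⁻ t, ENNReal.ofReal (ψ c₀ |acDeriv a b u t|) ∂ν := by
  have hg := measurable_gStar a b c₀ u
  rw [← lintegral_const_mul _ hg.enorm, ← lintegral_add_right _ (hg.enorm.const_mul _)]
  exact lintegral_congr fun t => ofReal_ψ_eq hc₀ a b u t

theorem lintegral_ψ_le {c₀ : ℝ} (hc₀ : 0 < c₀) (v : ℝ → ℝ) {g : ℝ → ℝ} {ν : Measure ℝ}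
    (hg : AEStronglyMeasurable g ν) : ∫⁻ t, ENNReal.ofReal (ψ c₀ |v t|) ∂ν ≤
      (∫⁻ t, ‖v t - g t‖ₑ ^ 2 ∂ν) + ENNReal.ofReal c₀ * ∫⁻ t, ‖g t‖ₑ ∂ν := by
  rw [← lintegral_const_mul'' _ hg.enorm, ← lintegral_add_right' _ (hg.enorm.const_mul _)]
  exact lintegral_mono fun t => ofReal_ψ_le hc₀ _ _

/-! ### The reduced limit energies -/

theorem F_le_E {a b c₀ : ℝ} (hc₀ : 0 < c₀) (K : ℝ≥0∞) (u : ℝ → ℝ) (γ : SignedMeasure ℝ) :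
    F a b c₀ u ≤ E a b c₀ K u γ := by
  refine le_iInf₂ fun g hg => ?_
  unfold F
  gcongr
  exact lintegral_ψ_le hc₀ _ hg.2.2.1.aestronglyMeasurable

theorem E_gStar_le {a b c₀ : ℝ} (hc₀ : 0 < c₀) {K : ℝ≥0∞} {u : ℝ → ℝ} (hu : IsBV a b u)
    (hK : eLpNorm u ∞ (volume.restrict (Ioo a b)) ≤ K) :
    E a b c₀ K u (singDeriv a b u + density a b (gStar a b c₀ u)) ≤ F a b c₀ u := by
  refine (iInf₂_le (gStar a b c₀ u) ⟨hu, hK, (integrable_gStar hc₀ a b u).integrableOn, rfl,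
    memLp_sub_gStar hc₀ a b u _⟩).trans ?_
  rw [lintegral_sub_gStar hc₀]
  exact le_rfl

theorem redE_eq_E_gStar {a b c₀ : ℝ} (hc₀ : 0 < c₀) {K : ℝ≥0∞} {u : ℝ → ℝ} (hu : IsBV a b u)
    (hK : eLpNorm u ∞ (volume.restrict (Ioo a b)) ≤ K) :
    redE a b c₀ K u = E a b c₀ K u (singDeriv a b u + density a b (gStar a b c₀ u)) :=
  le_antisymm (iInf₂_le (gStar a b c₀ u) (integrable_gStar hc₀ a b u).integrableOn)
    ((E_gStar_le hc₀ hu hK).trans (le_iInf₂ fun _ _ => F_le_E hc₀ _ _ _))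

theorem redE_eq_F {a b c₀ : ℝ} (hc₀ : 0 < c₀) {K : ℝ≥0∞} {u : ℝ → ℝ} (hu : IsBV a b u)
    (hK : eLpNorm u ∞ (volume.restrict (Ioo a b)) ≤ K) : redE a b c₀ K u = F a b c₀ u := by
  rw [redE_eq_E_gStar hc₀ hu hK]
  exact le_antisymm (E_gStar_le hc₀ hu hK) (F_le_E hc₀ _ _ _)

theorem redE_eq_top {a b c₀ : ℝ} {K : ℝ≥0∞} {u : ℝ → ℝ}
    (h : ¬(IsBV a b u ∧ eLpNorm u ∞ (volume.restrict (Ioo a b)) ≤ K)) : redE a b c₀ K u = ∞ := by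
  simp only [redE, E, iInf_eq_top]
  exact fun _ _ _ h' => absurd ⟨h'.1, h'.2.1⟩ h

/-- Unfolding produces two representations, one from `redEInf` and one from `EInf`. Only the second
enters the value, so it serves in the lower estimate; the upper estimate takes both equal and `g =
g*`. -/
theorem redEInf_eq {a b c₀ : ℝ} (hc₀ : 0 < c₀) (u : ℝ → EReal) :
    redEInf a b c₀ u = ⨅ R : BVInfRep a b u, R.energy c₀ := by
  refine le_antisymm (le_iInf fun R => ?_) ?_
  · have hF := R.isOpen_finitePart.measurableSet
    have hg := integrable_gStar hc₀ a b R.w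
    have : IsFiniteMeasure (volume.restrict R.finitePart) :=
      ⟨by simpa using (measure_mono R.finitePart_subset).trans_lt (by simp)⟩
    refine (iInf_le _ R).trans ((iInf₂_le (gStar a b c₀ R.w) hg.integrableOn).trans ?_)
    refine (iInf_le _ R).trans ((iInf₂_le (gStar a b c₀ R.w) ⟨hg.integrableOn, ?_,
      memLp_sub_gStar hc₀ a b _ _⟩).trans ?_)
    · rw [lintegral_sub_gStar hc₀]
      exact le_rfl
    · ext A hA
      rw [VectorMeasure.restrict_apply _ hF hA, _root_.add_apply, _root_.add_apply,
        BVInfRep.singDeriv, VectorMeasure.restrict_apply _ hF hA,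
        VectorMeasure.restrict_apply _ hF (hA.inter hF), inter_assoc, inter_self,
        density_apply hg.integrableOn (hA.inter hF), inter_assoc,
        inter_eq_left.2 R.finitePart_subset, withDensityᵥ_apply hg.integrableOn hA,
        Measure.restrict_restrict hA]
  · refine le_iInf fun R => le_iInf₂ fun g hg => le_iInf fun R' => le_iInf₂ fun g' hg' =>
      (iInf_le _ R').trans ?_
    unfold BVInfRep.energy
    gcongr
    exact lintegral_ψ_le hc₀ _ hg'.1.aestronglyMeasurable

/-- The representation of a real-valued function by itself. -/
def IsBV.rep {a b : ℝ} (hab : a < b) {u : ℝ → ℝ} (hu : IsBV a b u) : BVInfRep a b (toExt u) where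
  m := 1
  x := ![a, b]
  strictMono_x := by
    intro i j hij
    fin_cases i <;> fin_cases j <;> simp_all
  x_zero := rfl
  x_last := rfl
  α := fun _ => 0
  α_mem := fun _ => Or.inr (Or.inl rfl)
  w := u
  isBV_w := hu
  eq_ae := fun i => .of_forall fun t => by simp [toExt]

theorem IsBV.finitePart_rep {a b : ℝ} (hab : a < b) {u : ℝ → ℝ} (hu : IsBV a b u) :
    (hu.rep hab).finitePart = Ioo a b := by
  have : ⋃ (i : Fin (hu.rep hab).m) (_ : (hu.rep hab).α i = 0),
      Icc ((hu.rep hab).x i.castSucc) ((hu.rep hab).x i.succ) = Icc a b := by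
    refine (iUnion_congr fun i => ?_).trans (iUnion_const (ι := Fin 1) _)
    have hi : i = (0 : Fin 1) := Subsingleton.elim (α := Fin 1) _ _
    subst hi
    have : Nonempty ((hu.rep hab).α (0 : Fin 1) = 0) := ⟨rfl⟩
    exact iUnion_const _
  rw [BVInfRep.finitePart, this, interior_Icc]

theorem IsBV.energy_rep {a b : ℝ} (hab : a < b) {u : ℝ → ℝ} (hu : IsBV a b u) (c₀ : ℝ) :
    (hu.rep hab).energy c₀ = F a b c₀ u := by
  rw [BVInfRep.energy, BVInfRep.singDeriv_totalVariation_sdiff _ hab, hu.finitePart_rep hab]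
  rfl

/-- A real-valued function leaves no room for an infinite `α` on any piece. -/
theorem BVInfRep.isBV_of_toExt {a b : ℝ} {u : ℝ → ℝ} (R : BVInfRep a b (toExt u)) :
    IsBV a b u := by
  have hα : ∀ i, R.α i = 0 := by
    intro i
    have hlt : R.x i.castSucc < R.x i.succ := R.strictMono_x Fin.castSucc_lt_succ
    obtain ⟨t, ht⟩ := (eventually_essRight hlt (R.eq_ae i)).exists
    rcases R.α_mem i with h3 | h3 | h3 <;> simp [h3, toExt] at ht ⊢
  refine (isBV_congr ?_).2 R.isBV_w
  have h := ae_of_forall_partition (x := R.x) (P := fun t => u t = R.w t) fun i => by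
    filter_upwards [R.eq_ae i] with t ht
    rwa [hα, add_zero, toExt, EReal.coe_eq_coe_iff] at ht
  rwa [R.x_zero, R.x_last] at h

/-! ### The lower bound -/

/-- Compactness and lower semicontinuity together. The bound for every representation is what later
gives independence of the representation. -/
theorem energy_le_of_redEeps_lt {a b c₀ : ℝ} (hab : a < b) (hc₀ : 0 < c₀) {c K : ℝ≥0∞}
    (hc : c ≠ ∞) {ε : ℕ → ℝ} (hε : ∀ n, 0 < ε n) (hε0 : Tendsto ε atTop (𝓝 0)) {u : ℕ → ℝ → ℝ}
    {u₀ : ℝ → EReal} (h : ∀ k, redEeps a b c₀ K (ε k) (u k) < c)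
    (hu : ∀ᵐ t ∂(volume.restrict (Ioo a b)), Tendsto (fun k => (u k t : EReal)) atTop (𝓝 (u₀ t))) :
    Nonempty (BVInfRep a b u₀) ∧ ∀ R : BVInfRep a b u₀, R.energy c₀ ≤ c := by
  choose hW hK T hT hle using fun k => exists_of_redEeps_lt hc₀ (hε k) (h k)
  obtain ⟨B, φ, hφ, hB, hbound⟩ := exists_subseq_finset hab hc₀ hc hε0
    (fun k => acDeriv a b (u k)) T hT hle
  choose k₀ hk₀ using fun k => ((hW k).isBV hab).exists_ae_eq hab
  have hs : BoundedSeq a b c₀ c B u₀ (fun k => acDeriv a b (u (φ k))) (fun k => k₀ (φ k)) :=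
    { hab := hab
      hc₀ := hc₀
      hc := hc
      meas := fun k => measurable_acDeriv _ _ _
      int := fun k => (integrable_acDeriv _ _ _).integrableOn
      mem := hB
      bound := hbound
      conv := by
        filter_upwards [hu, ae_all_iff.2 hk₀] with t ht hk
        refine (ht.comp hφ.tendsto_atTop).congr fun k => ?_
        rw [Function.comp_apply, hk, (hW (φ k)).distribDeriv_eq hab] }
  exact ⟨hs.nonempty_rep, hs.energy_le⟩

theorem redEepsInf_of_ae {a b c₀ ε : ℝ} {u : ℝ → EReal}
    (h : ∀ᵐ t ∂(volume.restrict (Ioo a b)), u t ≠ ⊥ ∧ u t ≠ ⊤) :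
    redEepsInf a b c₀ ε u = redEeps a b c₀ ∞ ε fun t => (u t).toReal := by
  simp only [redEepsInf, EepsInf, if_pos h, redEeps]

theorem ae_of_redEepsInf_ne_top {a b c₀ ε : ℝ} {u : ℝ → EReal} (h : redEepsInf a b c₀ ε u ≠ ∞) :
    ∀ᵐ t ∂(volume.restrict (Ioo a b)), u t ≠ ⊥ ∧ u t ≠ ⊤ := by
  by_contra h'
  simp [redEepsInf, EepsInf, if_neg h'] at h

theorem energy_le_of_redEepsInf_lt {a b c₀ : ℝ} (hab : a < b) (hc₀ : 0 < c₀) {c : ℝ≥0∞}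
    (hc : c ≠ ∞) {ε : ℕ → ℝ} (hε : ∀ n, 0 < ε n) (hε0 : Tendsto ε atTop (𝓝 0)) {u : ℕ → ℝ → EReal}
    {u₀ : ℝ → EReal} (h : ∃ᶠ k in atTop, redEepsInf a b c₀ (ε k) (u k) < c)
    (hu : ∀ᵐ t ∂(volume.restrict (Ioo a b)), Tendsto (fun k => u k t) atTop (𝓝 (u₀ t))) :
    Nonempty (BVInfRep a b u₀) ∧ ∀ R : BVInfRep a b u₀, R.energy c₀ ≤ c := by
  obtain ⟨φ, hφ, hlt⟩ := extraction_of_frequently_atTop h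
  have hfin := fun k => ae_of_redEepsInf_ne_top (hlt k).ne_top
  refine energy_le_of_redEeps_lt (K := ∞) hab hc₀ hc (fun k => hε (φ k))
    (hε0.comp hφ.tendsto_atTop) (u := fun k t => (u (φ k) t).toReal)
    (fun k => by rw [← redEepsInf_of_ae (hfin k)]; exact hlt k) ?_
  filter_upwards [hu, ae_all_iff.2 hfin] with t ht hk
  refine (ht.comp hφ.tendsto_atTop).congr fun k => ?_
  rw [Function.comp_apply, EReal.coe_toReal (hk k).2 (hk k).1]

theorem redEInf_le_liminf {a b c₀ : ℝ} (hab : a < b) (hc₀ : 0 < c₀) {ε : ℕ → ℝ}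
    (hε : ∀ n, 0 < ε n) (hε0 : Tendsto ε atTop (𝓝 0)) {u : ℕ → ℝ → EReal}
    {u₀ : ℝ → EReal}
    (hu : ∀ᵐ t ∂(volume.restrict (Ioo a b)), Tendsto (fun k => u k t) atTop (𝓝 (u₀ t))) :
    redEInf a b c₀ u₀ ≤ liminf (fun n => redEepsInf a b c₀ (ε n) (u n)) atTop := by
  refine le_of_forall_gt fun c hc => ?_
  obtain ⟨d, hd, hdc⟩ := exists_between hc
  obtain ⟨⟨R⟩, hR⟩ := energy_le_of_redEepsInf_lt hab hc₀ hdc.ne_top hε hε0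
    (frequently_lt_of_liminf_lt (by isBoundedDefault) hd) hu
  rw [redEInf_eq hc₀]
  exact ((iInf_le _ R).trans (hR R)).trans_lt hdc

/-- Convergence in L¹ gives almost everywhere convergence along a subsequence, under which the bound
by `K` is preserved. -/
theorem redE_le_liminf {a b c₀ : ℝ} (hab : a < b) (hc₀ : 0 < c₀) (K : ℝ≥0∞) {ε : ℕ → ℝ}
    (hε : ∀ n, 0 < ε n) (hε0 : Tendsto ε atTop (𝓝 0)) {u : ℕ → L1 a b} {u₀ : L1 a b}
    (hu : Tendsto u atTop (𝓝 u₀)) :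
    redE a b c₀ K u₀ ≤ liminf (fun n => redEeps a b c₀ K (ε n) (u n)) atTop := by
  refine le_of_forall_gt fun c hc => ?_
  obtain ⟨d, hd, hdc⟩ := exists_between hc
  obtain ⟨φ, hφ, hlt⟩ := extraction_of_frequently_atTop
    (frequently_lt_of_liminf_lt (by isBoundedDefault) hd)
  have hm : TendstoInMeasure (volume.restrict (Ioo a b)) (fun n => (u (φ n) : ℝ → ℝ)) atTop u₀ :=
    tendstoInMeasure_of_tendsto_Lp (hu.comp hφ.tendsto_atTop)
  obtain ⟨ns, hns, hae⟩ := hm.exists_seq_tendsto_ae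
  have hφ' := hφ.tendsto_atTop.comp hns.tendsto_atTop
  obtain ⟨⟨R⟩, hR⟩ := energy_le_of_redEeps_lt (u₀ := toExt u₀) hab hc₀ hdc.ne_top
    (fun k => hε (φ (ns k))) (hε0.comp hφ') (u := fun k => u (φ (ns k))) (fun k => hlt (ns k))
    (by
      filter_upwards [hae] with t ht
      exact EReal.tendsto_coe.2 ht)
  have hbv := R.isBV_of_toExt
  have hKu : eLpNorm u₀ ∞ (volume.restrict (Ioo a b)) ≤ K := by
    have hb : ∀ k, ∀ᵐ t ∂(volume.restrict (Ioo a b)), ‖u (φ (ns k)) t‖ₑ ≤ K := by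
      intro k
      have h1 := (exists_of_redEeps_lt hc₀ (hε (φ (ns k))) (hlt (ns k))).2.1
      rw [eLpNorm_exponent_top] at h1
      filter_upwards [enorm_ae_le_eLpNormEssSup (u (φ (ns k))) (volume.restrict (Ioo a b))]
        with t ht
      exact ht.trans h1
    rw [eLpNorm_exponent_top]
    refine eLpNormEssSup_le_of_ae_enorm_bound ?_
    filter_upwards [hae, ae_all_iff.2 hb] with t ht hk
    exact le_of_tendsto ((continuous_enorm.tendsto _).comp ht) (.of_forall hk)
  rw [redE_eq_F hc₀ hbv hKu, ← hbv.energy_rep hab]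
  exact (hR _).trans_lt hdc

/-! ### Upper bounds for the nonlocal term -/

/-- Fubini: a point `t` belongs to the windows of exactly those `x` in an interval of length `2ε`.
-/
theorem lintegral_window (ε : ℝ) {S : Set ℝ} {r : ℝ → ℝ≥0∞} (hr : Measurable r) :
    ∫⁻ x, ∫⁻ t in Ioo (x - ε) (x + ε) ∩ S, r t = ENNReal.ofReal (2 * ε) * ∫⁻ t in S, r t := by
  have hm : MeasurableSet {p : ℝ × ℝ | p.1 - ε < p.2 ∧ p.2 < p.1 + ε} := by
    exact (measurableSet_lt (f := fun p : ℝ × ℝ => p.1 - ε) (g := fun p => p.2) (by fun_prop)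
      (by fun_prop)).inter (measurableSet_lt (f := fun p : ℝ × ℝ => p.2) (g := fun p => p.1 + ε)
      (by fun_prop) (by fun_prop))
  have h1 : ∀ x, ∫⁻ t in Ioo (x - ε) (x + ε) ∩ S, r t = ∫⁻ t in S,
      {p : ℝ × ℝ | p.1 - ε < p.2 ∧ p.2 < p.1 + ε}.indicator (fun p => r p.2) (x, t) := by
    intro x
    rw [← Measure.restrict_restrict measurableSet_Ioo, ← lintegral_indicator measurableSet_Ioo]
    rfl
  simp_rw [h1]
  rw [lintegral_lintegral_swap (f := fun x t =>
      {p : ℝ × ℝ | p.1 - ε < p.2 ∧ p.2 < p.1 + ε}.indicator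
      (fun p => r p.2) (x, t)) ((hr.comp measurable_snd).indicator hm).aemeasurable,
    ← lintegral_const_mul _ hr]
  refine lintegral_congr fun t => ?_
  have h2 : (fun x => {p : ℝ × ℝ | p.1 - ε < p.2 ∧ p.2 < p.1 + ε}.indicator (fun p => r p.2) (x, t))
      = (Ioo (t - ε) (t + ε)).indicator fun _ => r t := by
    funext x
    simp only [indicator, mem_ofPred_eq, mem_Ioo]
    congr 1
    rw [eq_iff_iff]
    constructor <;> rintro ⟨h, h'⟩ <;> constructor <;> linarith
  rw [h2, lintegral_indicator_const measurableSet_Ioo, Real.volume_Ioo, mul_comm]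
  congr 2; ring

theorem lintegral_measure_Ioc_le (ρ : Measure ℝ) [SFinite ρ] (p q : ℝ) (δ : ℝ) :
    ∫⁻ t in Ioo p q, ρ (Ioc t (t + δ)) ≤ ENNReal.ofReal δ * ρ (Ioc p (q + δ)) := by
  have hm : MeasurableSet {p : ℝ × ℝ | p.1 < p.2 ∧ p.2 ≤ p.1 + δ} := by
    exact (measurableSet_lt (f := fun p : ℝ × ℝ => p.1) (g := fun p => p.2) (by fun_prop)
      (by fun_prop)).inter (measurableSet_le (f := fun p : ℝ × ℝ => p.2) (g := fun p => p.1 + δ)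
      (by fun_prop) (by fun_prop))
  have h1 : ∀ t, ρ (Ioc t (t + δ)) = ∫⁻ y,
      {p : ℝ × ℝ | p.1 < p.2 ∧ p.2 ≤ p.1 + δ}.indicator (fun _ => 1) (t, y) ∂ρ := by
    intro t
    rw [← lintegral_indicator_one measurableSet_Ioc]
    rfl
  simp_rw [h1]
  rw [lintegral_lintegral_swap (f := fun t y => {p : ℝ × ℝ | p.1 < p.2 ∧ p.2 ≤ p.1 + δ}.indicator
      (fun _ => (1 : ℝ≥0∞)) (t, y)) (measurable_const.indicator hm).aemeasurable,
    ← lintegral_indicator_one measurableSet_Ioc, ← lintegral_const_mul _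
      (measurable_one.indicator measurableSet_Ioc)]
  refine lintegral_mono fun y => ?_
  by_cases hy : y ∈ Ioc p (q + δ)
  · rw [indicator_of_mem hy]
    calc ∫⁻ t in Ioo p q, {p : ℝ × ℝ | p.1 < p.2 ∧ p.2 ≤ p.1 + δ}.indicator (fun _ => 1) (t, y)
        ≤ ∫⁻ t, (Ico (y - δ) y).indicator (fun _ => 1) t := by
          refine (setLIntegral_le_lintegral _ _).trans (lintegral_mono fun t => ?_)
          simp only [indicator, mem_ofPred_eq, mem_Ico]
          split_ifs with h h'
          · exact le_rfl
          · exact absurd ⟨by linarith [h.2], h.1⟩ h'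
          · simp
          · simp
      _ = ENNReal.ofReal δ * 1 := by
          rw [lintegral_indicator_const measurableSet_Ico, Real.volume_Ico,
            sub_sub_cancel, mul_comm]
  · rw [indicator_of_notMem hy, mul_zero, nonpos_iff_eq_zero]
    refine (setLIntegral_congr_fun measurableSet_Ioo fun t ht => ?_).trans lintegral_zero
    simp only [indicator, mem_ofPred_eq]
    rw [if_neg]
    rintro ⟨h, h'⟩
    exact hy ⟨ht.1.trans h, by linarith [ht.2]⟩

/-- A window clipped at an end still has length at least `ε`, so its average is overestimated by at
most a factor 2. The mass within `2ε` of that end, counted once more, absorbs it. -/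
theorem average_window_le {a b ε : ℝ} (hεab : 2 * ε ≤ b - a) {x : ℝ}
    (hx : x ∈ Ioo a b) (r : ℝ → ℝ≥0∞) :
    ⨍⁻ t in Ioo (x - ε) (x + ε) ∩ Ioo a b, r t ∂volume ≤
      (ENNReal.ofReal (2 * ε))⁻¹ * ((∫⁻ t in Ioo (x - ε) (x + ε) ∩ Ioo a b, r t) +
        (∫⁻ t in Ioo (x - ε) (x + ε) ∩ Ioo a (a + 2 * ε), r t) +
        ∫⁻ t in Ioo (x - ε) (x + ε) ∩ Ioo (b - 2 * ε) b, r t) := by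
  set I := Ioo (x - ε) (x + ε) ∩ Ioo a b with hI
  rw [setLAverage_eq, ENNReal.div_eq_inv_mul]
  have hhalf : ∀ {J}, J ⊆ I → volume J = ENNReal.ofReal ε →
      (volume I)⁻¹ ≤ (ENNReal.ofReal (2 * ε))⁻¹ * 2 := by
    intro J hJ hv
    rw [ENNReal.ofReal_mul (by norm_num), ENNReal.mul_inv (by simp) (by simp),
      mul_comm _ (2 : ℝ≥0∞),
      ← mul_assoc]
    simp only [ENNReal.ofReal_ofNat]
    rw [ENNReal.mul_inv_cancel (by simp) (by simp), one_mul, ENNReal.inv_le_inv, ← hv]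
    exact measure_mono hJ
  by_cases h1 : x < a + ε
  · have h2 : I = Ioo (x - ε) (x + ε) ∩ Ioo a (a + 2 * ε) := by
      ext t; simp only [hI, mem_inter_iff, mem_Ioo]
      constructor <;> rintro ⟨⟨_, _⟩, _, _⟩ <;> refine ⟨⟨?_, ?_⟩, ?_, ?_⟩ <;> linarith
    have h3 := hhalf (J := Ioo x (x + ε)) (fun t ht => by
      simp only [hI, mem_inter_iff, mem_Ioo]
      obtain ⟨_, _⟩ := ht; obtain ⟨_, _⟩ := hx
      refine ⟨⟨?_, ?_⟩, ?_, ?_⟩ <;> linarith) (by rw [Real.volume_Ioo]; congr 1; ring)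
    rw [← h2]
    calc (volume I)⁻¹ * ∫⁻ t in I, r t ≤ ((ENNReal.ofReal (2 * ε))⁻¹ * 2) * ∫⁻ t in I, r t := by
          gcongr
      _ = (ENNReal.ofReal (2 * ε))⁻¹ * ((∫⁻ t in I, r t) + ∫⁻ t in I, r t) := by ring
      _ ≤ _ := mul_le_mul_right le_self_add _
  by_cases h1' : b - ε < x
  · have h2 : I = Ioo (x - ε) (x + ε) ∩ Ioo (b - 2 * ε) b := by
      ext t; simp only [hI, mem_inter_iff, mem_Ioo]
      constructor <;> rintro ⟨⟨_, _⟩, _, _⟩ <;> refine ⟨⟨?_, ?_⟩, ?_, ?_⟩ <;> linarith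
    have h3 := hhalf (J := Ioo (x - ε) x) (fun t ht => by
      simp only [hI, mem_inter_iff, mem_Ioo]
      obtain ⟨_, _⟩ := ht; obtain ⟨_, _⟩ := hx
      refine ⟨⟨?_, ?_⟩, ?_, ?_⟩ <;> linarith) (by rw [Real.volume_Ioo]; congr 1; ring)
    rw [← h2]
    calc (volume I)⁻¹ * ∫⁻ t in I, r t ≤ ((ENNReal.ofReal (2 * ε))⁻¹ * 2) * ∫⁻ t in I, r t := by
          gcongr
      _ = (ENNReal.ofReal (2 * ε))⁻¹ * ((∫⁻ t in I, r t) + ∫⁻ t in I, r t) := by ring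
      _ ≤ _ := by gcongr; exact le_self_add
  · have h2 : I = Ioo (x - ε) (x + ε) :=
      inter_eq_left.2 (Ioo_subset_Ioo (by linarith) (by linarith))
    have h3 : volume I = ENNReal.ofReal (2 * ε) := by
      rw [h2, Real.volume_Ioo]; congr 1; ring
    rw [h3]
    gcongr
    exact le_self_add.trans le_self_add

theorem lintegral_average_window_le {a b ε : ℝ} (hε : 0 < ε) (hεab : 2 * ε ≤ b - a)
    {r : ℝ → ℝ≥0∞} (hr : Measurable r) :
    ∫⁻ x in Ioo a b, ⨍⁻ t in Ioo (x - ε) (x + ε) ∩ Ioo a b, r t ∂volume ≤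
      (∫⁻ t in Ioo a b, r t) + (∫⁻ t in Ioo a (a + 2 * ε), r t) +
        ∫⁻ t in Ioo (b - 2 * ε) b, r t := by
  have hε0 : ENNReal.ofReal (2 * ε) ≠ 0 := by simpa using hε
  calc ∫⁻ x in Ioo a b, ⨍⁻ t in Ioo (x - ε) (x + ε) ∩ Ioo a b, r t ∂volume
      ≤ ∫⁻ x in Ioo a b, (ENNReal.ofReal (2 * ε))⁻¹ *
        ((∫⁻ t in Ioo (x - ε) (x + ε) ∩ Ioo a b, r t) +
        (∫⁻ t in Ioo (x - ε) (x + ε) ∩ Ioo a (a + 2 * ε), r t) +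
        ∫⁻ t in Ioo (x - ε) (x + ε) ∩ Ioo (b - 2 * ε) b, r t) :=
        setLIntegral_mono' measurableSet_Ioo fun x hx => average_window_le hεab hx r
    _ ≤ ∫⁻ x, (ENNReal.ofReal (2 * ε))⁻¹ *
        ((∫⁻ t in Ioo (x - ε) (x + ε) ∩ Ioo a b, r t) +
        (∫⁻ t in Ioo (x - ε) (x + ε) ∩ Ioo a (a + 2 * ε), r t) +
        ∫⁻ t in Ioo (x - ε) (x + ε) ∩ Ioo (b - 2 * ε) b, r t) := setLIntegral_le_lintegral _ _
    _ = _ := by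
        have m := fun p q => measurable_lintegral_window p q ε hr
        have m3 : Measurable fun x => (∫⁻ t in Ioo (x - ε) (x + ε) ∩ Ioo a b, r t) +
            (∫⁻ t in Ioo (x - ε) (x + ε) ∩ Ioo a (a + 2 * ε), r t) +
            ∫⁻ t in Ioo (x - ε) (x + ε) ∩ Ioo (b - 2 * ε) b, r t :=
          ((m _ _).add (m _ _)).add (m _ _)
        rw [lintegral_const_mul _ m3, lintegral_add_right _ (m _ _), lintegral_add_right _ (m _ _),
          lintegral_window ε hr,
          lintegral_window ε hr, lintegral_window ε hr, ← mul_add, ← mul_add, ← mul_assoc,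
          ENNReal.inv_mul_cancel hε0 ENNReal.ofReal_ne_top, one_mul]

/-- Points whose window may see a forward interval meeting `B` are estimated by `f ≤ c₀`. At all
others `f t ≤ c₀ t` and two applications of Fubini, one for the window and one for the forward
interval, reduce the term to masses of `ρ`. -/
theorem nonlocal_le {a b c₀ ε δ : ℝ} (hε : 0 < ε) (hδ : 0 < δ) (hεab : 2 * ε ≤ b - a)
    {g : ℝ → ℝ} (ρ : Measure ℝ) [IsFiniteMeasure ρ] (B : Finset ℝ)
    (hg : ∀ t, (∀ y ∈ B, y ∉ Ioc t (t + δ)) →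
      ‖g t‖ₑ ≤ (ENNReal.ofReal δ)⁻¹ * ρ (Ioc t (t + δ))) :
    nonlocal a b c₀ ε g ≤ ENNReal.ofReal c₀ * (ρ univ + ρ (Ioc a (a + 2 * ε + δ)) +
      ρ (Ioc (b - 2 * ε) (b + δ)) + B.card * ENNReal.ofReal (2 + δ / ε)) := by
  set C := ENNReal.ofReal c₀
  set r : ℝ → ℝ≥0∞ := fun t => (ENNReal.ofReal δ)⁻¹ * ρ (Ioc t (t + δ)) with hr
  have hδ0 : ENNReal.ofReal δ ≠ 0 := by simpa using hδ
  have hε0 : ENNReal.ofReal ε ≠ 0 := by simpa using hε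
  have hm : MeasurableSet {p : ℝ × ℝ | p.1 < p.2 ∧ p.2 ≤ p.1 + δ} := by
    exact (measurableSet_lt (f := fun p : ℝ × ℝ => p.1) (g := fun p => p.2) (by fun_prop)
      (by fun_prop)).inter (measurableSet_le (f := fun p : ℝ × ℝ => p.2) (g := fun p => p.1 + δ)
      (by fun_prop) (by fun_prop))
  have hrm : Measurable r := (measurable_measure_prodMk_left (ν := ρ) hm).const_mul _
  have hint : ∀ p q, ∫⁻ t in Ioo p q, r t ≤ ρ (Ioc p (q + δ)) := by
    intro p q
    have hrm' : Measurable fun t => ρ (Ioc t (t + δ)) := measurable_measure_prodMk_left (ν := ρ) hm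
    rw [hr, lintegral_const_mul _ hrm']
    calc (ENNReal.ofReal δ)⁻¹ * ∫⁻ t in Ioo p q, ρ (Ioc t (t + δ))
        ≤ (ENNReal.ofReal δ)⁻¹ * (ENNReal.ofReal δ * ρ (Ioc p (q + δ))) := by
          gcongr; exact lintegral_measure_Ioc_le _ _ _ _
      _ = _ := by rw [← mul_assoc, ENNReal.inv_mul_cancel hδ0 (by simp), one_mul]
  -- A point `t` of the window of `x` has `y ∈ (t, t + δ]` only if `x` lies in this interval of
  -- length `2ε + δ`.
  set D : Set ℝ := ⋃ y ∈ B, Ioo (y - ε - δ) (y + ε) with hD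
  have hDm : MeasurableSet D := B.measurableSet_biUnion fun _ _ => measurableSet_Ioo
  have hDv : volume D ≤ B.card * ENNReal.ofReal (2 * ε + δ) := by
    refine (measure_biUnion_finset_le _ _).trans (le_of_eq ?_)
    simp_rw [Real.volume_Ioo, show ∀ y : ℝ, y + ε - (y - ε - δ) = 2 * ε + δ by intro y; ring]
    simp
  have hpt : ∀ x ∈ Ioo a b,
      f c₀ (ENNReal.ofReal ε * ⨍⁻ t in Ioo (x - ε) (x + ε) ∩ Ioo a b, ‖g t‖ₑ ∂volume) ≤
        D.indicator (fun _ => C) x +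
          C * ENNReal.ofReal ε * ⨍⁻ t in Ioo (x - ε) (x + ε) ∩ Ioo a b, r t ∂volume := by
    intro x hx
    by_cases hxD : x ∈ D
    · rw [indicator_of_mem hxD]
      exact (f_le _ _).trans le_self_add
    · rw [indicator_of_notMem hxD, zero_add, mul_assoc]
      refine (f_le_mul _ _).trans (mul_le_mul_right (mul_le_mul_right ?_ _) _)
      rw [setLAverage_eq, setLAverage_eq]
      gcongr ?_ / _
      refine setLIntegral_mono' (measurableSet_Ioo.inter measurableSet_Ioo) fun t ht => hg t ?_
      intro y hy hyt
      refine hxD (mem_biUnion hy ⟨?_, ?_⟩) <;> linarith [ht.1.1, ht.1.2, hyt.1, hyt.2]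
  calc nonlocal a b c₀ ε g ≤ (ENNReal.ofReal ε)⁻¹ * ∫⁻ x in Ioo a b,
        (D.indicator (fun _ => C) x +
          C * ENNReal.ofReal ε * ⨍⁻ t in Ioo (x - ε) (x + ε) ∩ Ioo a b, r t ∂volume) := by
        rw [nonlocal]
        refine mul_le_mul_right ?_ _
        exact setLIntegral_mono' measurableSet_Ioo hpt
    _ ≤ (ENNReal.ofReal ε)⁻¹ * (C * (B.card * ENNReal.ofReal (2 * ε + δ)) +
          C * ENNReal.ofReal ε * (ρ univ + ρ (Ioc a (a + 2 * ε + δ)) +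
            ρ (Ioc (b - 2 * ε) (b + δ)))) := by
        gcongr
        rw [lintegral_add_left (measurable_const.indicator hDm), lintegral_const_mul _
          (measurable_average_window a b ε hrm)]
        gcongr
        · refine (setLIntegral_le_lintegral _ _).trans ?_
          rw [lintegral_indicator_const hDm]
          gcongr
        · refine (lintegral_average_window_le hε hεab hrm).trans ?_
          gcongr
          · exact (hint _ _).trans (measure_mono (subset_univ _))
          · exact hint _ _
          · exact hint _ _
    _ = _ := by
        have e1 : ENNReal.ofReal (2 * ε + δ) = ENNReal.ofReal ε * ENNReal.ofReal (2 + δ / ε) := by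
          rw [← ENNReal.ofReal_mul hε.le]; congr 1; field_simp
        rw [e1]
        have e2 := ENNReal.inv_mul_cancel hε0 (by simp)
        calc _ = ((ENNReal.ofReal ε)⁻¹ * ENNReal.ofReal ε) * (C * ((B.card : ℝ≥0∞) *
              ENNReal.ofReal (2 + δ / ε)) + C * (ρ univ + ρ (Ioc a (a + 2 * ε + δ)) +
            ρ (Ioc (b - 2 * ε) (b + δ)))) := by ring
          _ = _ := by rw [e2, one_mul, ← mul_add, add_comm]

/-! ### The derivative outside of the interval -/

theorem restrict_compl_eq_zero {U : Set ℝ} (hU : MeasurableSet U) {μ : SignedMeasure ℝ}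
    (hμ : μ.restrict U = μ) : μ.restrict Uᶜ = 0 := by
  ext A hA
  rw [VectorMeasure.restrict_apply _ hU.compl hA, ← hμ, VectorMeasure.restrict_apply _ hU
    (hA.inter hU.compl), inter_assoc, compl_inter_self, inter_empty]
  simp

theorem distribDeriv_mem (a b : ℝ) (u : ℝ → ℝ) : distribDeriv a b u ∈ radonMeasures a b := by
  unfold distribDeriv
  split_ifs with h
  · exact h.choose_spec.1
  · ext A hA
    rw [VectorMeasure.restrict_zero]

theorem rnDeriv_ae_eq_zero_of_restrict_eq_zero {s : SignedMeasure ℝ} {U : Set ℝ}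
    (hU : MeasurableSet U) (h0 : s.restrict U = 0) :
    ∀ᵐ t ∂(volume.restrict U), s.rnDeriv volume t = 0 := by
  have h := rnDeriv_restrict_signed s volume hU
  rw [h0] at h
  have h0 := SignedMeasure.rnDeriv_def (0 : SignedMeasure ℝ) volume
  filter_upwards [h, ae_restrict_of_ae (Measure.rnDeriv_zero (volume : Measure ℝ))] with t ht h1
  rw [← ht, h0]
  simp [SignedMeasure.toJordanDecomposition_zero, h1]

theorem acDeriv_ae_eq_zero (a b : ℝ) (u : ℝ → ℝ) :
    ∀ᵐ t ∂(volume.restrict (Ioo a b)ᶜ), acDeriv a b u t = 0 :=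
  rnDeriv_ae_eq_zero_of_restrict_eq_zero measurableSet_Ioo.compl
    (restrict_compl_eq_zero measurableSet_Ioo (distribDeriv_mem a b u))

theorem singVar_compl (a b : ℝ) (u : ℝ → ℝ) : singVar a b u (Ioo a b)ᶜ = 0 := by
  have h1 := singularPart_restrict_signed (distribDeriv a b u) volume
    (measurableSet_Ioo (a := a) (b := b)).compl
  have h2 := totalVariation_singularPart_restrict (distribDeriv a b u) volume
    (measurableSet_Ioo (a := a) (b := b)).compl
  rw [restrict_compl_eq_zero measurableSet_Ioo (distribDeriv_mem a b u)] at h1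
  rw [← h1] at h2
  have h3 := congrArg (fun ν : Measure ℝ => ν univ) h2
  simp only [Measure.restrict_apply_univ] at h3
  rw [singVar, singDeriv, ← h3]
  simp [SignedMeasure.singularPart_zero, SignedMeasure.totalVariation_zero]

theorem lintegral_eq_setLIntegral_Ioo {a b : ℝ} {Φ : ℝ → ℝ≥0∞}
    (h : ∀ᵐ t ∂(volume.restrict (Ioo a b)ᶜ), Φ t = 0) :
    ∫⁻ t, Φ t = ∫⁻ t in Ioo a b, Φ t := by
  rw [← lintegral_add_compl Φ (measurableSet_Ioo (a := a) (b := b)), lintegral_congr_ae h,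
    lintegral_zero, add_zero]

theorem enorm_apply_le_totalVariation (s : SignedMeasure ℝ) (A : Set ℝ) :
    ‖s A‖ₑ ≤ s.totalVariation A := by
  by_cases hA : MeasurableSet A
  · conv_lhs => rw [eq_posM_sub_negM s]
    rw [_root_.sub_apply, Measure.toSignedMeasure_apply_measurable hA,
      Measure.toSignedMeasure_apply_measurable hA, SignedMeasure.totalVariation, Measure.add_apply]
    refine enorm_sub_le.trans ?_
    rw [Real.enorm_of_nonneg measureReal_nonneg, Real.enorm_of_nonneg measureReal_nonneg,
      ofReal_measureReal, ofReal_measureReal]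
  · rw [s.not_measurable hA]; simp

/-! ### Smoothing -/

/-- The difference quotient `μ((t, t+δ]) / δ`. -/
def diffQuot (δ : ℝ) (μ : SignedMeasure ℝ) (t : ℝ) : ℝ := δ⁻¹ * (cumul μ (t + δ) - cumul μ t)

theorem measurable_diffQuot (δ : ℝ) (μ : SignedMeasure ℝ) : Measurable (diffQuot δ μ) :=
  (((measurable_cumul μ).comp (measurable_id.add_const δ)).sub (measurable_cumul μ)).const_mul _

theorem abs_diffQuot_le {δ : ℝ} (hδ : 0 < δ) (μ : SignedMeasure ℝ) (t : ℝ) :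
    |diffQuot δ μ t| ≤ δ⁻¹ * (2 * ((posM μ).real univ + (negM μ).real univ)) := by
  rw [diffQuot, abs_mul, abs_of_pos (inv_pos.2 hδ)]
  gcongr
  rw [two_mul]
  exact (abs_sub _ _).trans (add_le_add (abs_cumul_le _ _) (abs_cumul_le _ _))

theorem integrableOn_diffQuot {δ : ℝ} (hδ : 0 < δ) (μ : SignedMeasure ℝ) {U : Set ℝ}
    (hU : volume U ≠ ∞) : IntegrableOn (diffQuot δ μ) U :=
  integrableOn_of_abs_le hU (measurable_diffQuot δ μ) (abs_diffQuot_le hδ μ)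

theorem diffQuot_eq {δ : ℝ} (hδ : 0 < δ) (μ : SignedMeasure ℝ) (t : ℝ) :
    diffQuot δ μ t = δ⁻¹ * μ (Ioc t (t + δ)) := by
  rw [diffQuot, cumul_sub μ (by linarith)]

/-- The forward average over an interval of length `δ` of the function `k + μ((-∞, t])`. -/
def smoothing (δ k : ℝ) (μ : SignedMeasure ℝ) (t : ℝ) : ℝ :=
  δ⁻¹ * ∫ s in t..(t + δ), (k + cumul μ s)

theorem intervalIntegrable_cumul (k : ℝ) (μ : SignedMeasure ℝ) (p q : ℝ) :
    IntervalIntegrable (fun s => k + cumul μ s) volume p q := by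
  refine intervalIntegrable_const.add ⟨?_, ?_⟩ <;>
  exact integrableOn_of_abs_le (by simp) (measurable_cumul μ) (abs_cumul_le μ)

/-- The derivative of the forward average is exactly the difference quotient: shift one integral by
`δ` and recombine adjacent intervals. -/
theorem smoothing_sub {δ : ℝ} (k : ℝ) (μ : SignedMeasure ℝ) (p t : ℝ) :
    smoothing δ k μ t - smoothing δ k μ p = ∫ s in p..t, diffQuot δ μ s := by
  have hI := intervalIntegrable_cumul k μ
  have h1 : ∫ s in p..t, diffQuot δ μ s =
      δ⁻¹ * ((∫ s in p..t, (k + cumul μ (s + δ))) - ∫ s in p..t, (k + cumul μ s)) := by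
    rw [← intervalIntegral.integral_sub _ (hI _ _), ← intervalIntegral.integral_const_mul]
    · refine intervalIntegral.integral_congr fun s _ => ?_
      simp only [diffQuot]; ring
    · have := (hI (p + δ) (t + δ)).comp_add_right δ
      simpa using this
  rw [h1, intervalIntegral.integral_comp_add_right (fun s => k + cumul μ s)]
  simp only [smoothing]
  rw [← mul_sub]
  congr 1
  have e1 := intervalIntegral.integral_add_adjacent_intervals (hI p t) (hI t (t + δ))
  have e2 := intervalIntegral.integral_add_adjacent_intervals (hI p (p + δ)) (hI (p + δ) (t + δ))
  linarith

theorem isW11_smoothing {a b δ : ℝ} (hab : a < b) (hδ : 0 < δ) (k : ℝ) (μ : SignedMeasure ℝ) :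
    IsW11 a b (smoothing δ k μ) ∧
      ∀ᵐ t ∂(volume.restrict (Ioo a b)), acDeriv a b (smoothing δ k μ) t = diffQuot δ μ t := by
  have hh : IntegrableOn (diffQuot δ μ) (Ioo a b) := integrableOn_diffQuot hδ μ (by simp)
  have heq : ∀ t ∈ Ioo a b, smoothing δ k μ t =
      smoothing δ k μ a + cumul (density a b (diffQuot δ μ)) t := by
    intro t ht
    rw [cumul, density_apply hh measurableSet_Iic, ← sub_eq_iff_eq_add', smoothing_sub,
      intervalIntegral.integral_of_le ht.1.le]
    congr 2; ext s
    simp only [mem_Ioc, mem_inter_iff, mem_Iic, mem_Ioo]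
    exact ⟨fun h => ⟨h.2, h.1, h.2.trans_lt ht.2⟩, fun h => ⟨h.2.1, h.1⟩⟩
  have hae : ∀ᵐ t ∂(volume.restrict (Ioo a b)), smoothing δ k μ t =
      smoothing δ k μ a + cumul (density a b (diffQuot δ μ)) t :=
    (ae_restrict_mem measurableSet_Ioo).mono heq
  have hint : IntegrableOn (smoothing δ k μ) (Ioo a b) :=
    (isBV_of_cumul (density_mem_radonMeasures a b _) _ hae).1
  have hd := hasDistribDeriv_of_ae_eq _ hae
  exact ⟨⟨hint, _, hh, hd⟩, (isBV_and_acDeriv_of_hasDistribDeriv_density hab hint hh hd).2.1⟩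

theorem abs_smoothing_le {δ k C : ℝ} (hδ : 0 < δ) {μ : SignedMeasure ℝ} {t : ℝ}
    (h : ∀ s ∈ Ioc t (t + δ), |k + cumul μ s| ≤ C) : |smoothing δ k μ t| ≤ C := by
  have h1 := intervalIntegral.norm_integral_le_of_norm_le_const (a := t) (b := t + δ)
    (f := fun s => k + cumul μ s) (C := C) (by rwa [uIoc_of_le (by linarith)])
  rw [smoothing, abs_mul, abs_of_pos (inv_pos.2 hδ), inv_mul_le_iff₀ hδ, mul_comm]
  rwa [add_sub_cancel_left, abs_of_pos hδ] at h1

theorem smoothing_eq {δ k : ℝ} (hδ : 0 < δ) {μ : SignedMeasure ℝ} {t : ℝ} {u : ℝ → ℝ}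
    (h : ∀ᵐ s ∂(volume.restrict (Ioo t (t + δ))), u s = k + cumul μ s) :
    smoothing δ k μ t = δ⁻¹ * ∫ s in Ioo t (t + δ), u s := by
  rw [smoothing, intervalIntegral.integral_of_le (by linarith), integral_Ioc_eq_integral_Ioo,
    integral_congr_ae h]

/-- The average looks to the right only, so right continuity gives convergence at every point, jump
points included. -/
theorem tendsto_average {u : ℝ → ℝ} {k : ℝ} {μ : SignedMeasure ℝ} {t q : ℝ} (htq : t < q)
    (h : ∀ᵐ s ∂(volume.restrict (Ioo t q)), u s = k + cumul μ s) {δ : ℕ → ℝ} (hδ : ∀ n, 0 < δ n)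
    (hδ0 : Tendsto δ atTop (𝓝 0)) :
    Tendsto (fun n => (δ n)⁻¹ * ∫ s in Ioo t (t + δ n), u s) atTop (𝓝 (k + cumul μ t)) := by
  rw [Metric.tendsto_atTop]
  intro η hη
  have h1 := (Metric.tendsto_nhds.1 ((tendsto_cumul_right μ t).const_add k)) (η / 2) (half_pos hη)
  obtain ⟨r, hr, hr'⟩ := mem_nhdsGT_iff_exists_Ioo_subset.1 h1
  have hev : ∀ᶠ n in atTop, δ n < min (r - t) (q - t) :=
    hδ0.eventually_lt_const (lt_min (sub_pos.2 hr) (sub_pos.2 htq))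
  obtain ⟨N, hN⟩ := eventually_atTop.1 hev
  refine ⟨N, fun n hn => ?_⟩
  have h2 := lt_min_iff.1 (hN n hn)
  have h3 := hδ n
  have hsub : ∀ᵐ s ∂(volume.restrict (Ioo t (t + δ n))), u s = k + cumul μ s :=
    ae_restrict_mono (Ioo_subset_Ioo_right (by linarith)) h
  rw [integral_congr_ae hsub]
  have hi : IntegrableOn (fun s => k + cumul μ s) (Ioo t (t + δ n)) :=
    ((intervalIntegrable_iff_integrableOn_Ioo_of_le (by linarith)).1
      (intervalIntegrable_cumul k μ t (t + δ n)))
  have e1 : (δ n)⁻¹ * ∫ _ in Ioo t (t + δ n), (k + cumul μ t) = k + cumul μ t := by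
    rw [setIntegral_const, smul_eq_mul, Measure.real, Real.volume_Ioo, add_sub_cancel_left,
      ENNReal.toReal_ofReal h3.le, ← mul_assoc, inv_mul_cancel₀ h3.ne', one_mul]
  have hc : IntegrableOn (fun _ => k + cumul μ t) (Ioo t (t + δ n)) :=
    integrableOn_const (by simp)
  rw [Real.dist_eq, ← e1, ← mul_sub, ← integral_sub hi hc, abs_mul, abs_of_pos (inv_pos.2 h3)]
  refine lt_of_le_of_lt ?_ (half_lt_self hη)
  rw [inv_mul_le_iff₀ h3]
  have := norm_setIntegral_le_of_norm_le_const (μ := volume) (s := Ioo t (t + δ n)) (C := η / 2)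
    (f := fun s => k + cumul μ s - (k + cumul μ t)) (by simp) (fun s hs => by
      have := hr' ⟨hs.1, by linarith [hs.2]⟩
      exact (by simpa [Real.dist_eq] using this : |_| < _).le)
  rwa [Measure.real, Real.volume_Ioo, add_sub_cancel_left, ENNReal.toReal_ofReal h3.le, mul_comm]
    at this

/-! ### The energy of the smoothed functions -/

theorem enorm_inv_mul_setIntegral_sq_le {δ C : ℝ} (hδ : 0 < δ) {v : ℝ → ℝ} (hv : Measurable v)
    (hC : ∀ t, |v t| ≤ C) (t : ℝ) :
    ‖δ⁻¹ * ∫ s in Ioc t (t + δ), v s‖ₑ ^ 2 ≤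
      (ENNReal.ofReal δ)⁻¹ * ∫⁻ s in Ioc t (t + δ), ‖v s‖ₑ ^ 2 := by
  set m := δ⁻¹ * ∫ s in Ioc t (t + δ), v s with hm
  have i1 : IntegrableOn v (Ioc t (t + δ)) := integrableOn_of_abs_le (by simp) hv hC
  have i2 : IntegrableOn (fun s => v s ^ 2) (Ioc t (t + δ)) :=
    integrableOn_of_abs_le (by simp) (hv.pow_const 2) (C := C ^ 2) fun s => by
      rw [abs_pow]
      have := abs_nonneg (v s)
      have := hC s
      gcongr
  have i3 : IntegrableOn (fun _ => m ^ 2) (Ioc t (t + δ)) := integrableOn_const (by simp)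
  have i4 : IntegrableOn (fun s => v s ^ 2 - 2 * m * v s) (Ioc t (t + δ)) :=
    i2.sub (i1.const_mul _)
  have hvol : ∫ _ in Ioc t (t + δ), m ^ 2 = δ * m ^ 2 := by
    rw [setIntegral_const, smul_eq_mul, Measure.real, Real.volume_Ioc, add_sub_cancel_left,
      ENNReal.toReal_ofReal hδ.le]
  -- Jensen for the square, by expanding the integral of `(v - m) ^ 2`.
  have h0 : 0 ≤
      (∫ s in Ioc t (t + δ), v s ^ 2) - 2 * m * (∫ s in Ioc t (t + δ), v s) + δ * m ^ 2 := by
    rw [← hvol, ← integral_const_mul, ← integral_sub i2 (i1.const_mul _),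
      ← integral_add i4 i3]
    refine integral_nonneg fun s => ?_
    have := sq_nonneg (v s - m)
    simp only [Pi.zero_apply]
    nlinarith
  have hm' : ∫ s in Ioc t (t + δ), v s = δ * m := by
    rw [hm, ← mul_assoc, mul_inv_cancel₀ hδ.ne', one_mul]
  rw [hm'] at h0
  have h1 : m ^ 2 ≤ δ⁻¹ * ∫ s in Ioc t (t + δ), v s ^ 2 := by
    rw [le_inv_mul_iff₀ hδ]; nlinarith
  have h2 : ENNReal.ofReal (∫ s in Ioc t (t + δ), v s ^ 2) =
      ∫⁻ s in Ioc t (t + δ), ‖v s‖ₑ ^ 2 := by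
    rw [ofReal_integral_eq_lintegral_ofReal i2 (.of_forall fun s => sq_nonneg _)]
    refine lintegral_congr fun s => ?_
    rw [← ofReal_norm, ← ENNReal.ofReal_pow (norm_nonneg _), Real.norm_eq_abs, sq_abs]
  rw [← h2, ← ENNReal.ofReal_inv_of_pos hδ, ← ENNReal.ofReal_mul (by positivity), ← ofReal_norm,
    ← ENNReal.ofReal_pow (norm_nonneg _), Real.norm_eq_abs, sq_abs]
  exact ENNReal.ofReal_le_ofReal h1

/-- Averaging does not increase the L² norm: Jensen on each forward interval, then Fubini. -/
theorem lintegral_diffQuot_sq_le {δ C : ℝ} (hδ : 0 < δ) {v : ℝ → ℝ} (hv : Measurable v)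
    (hvi : Integrable v) (hC : ∀ t, |v t| ≤ C) (a b : ℝ) :
    ∫⁻ t in Ioo a b, ‖diffQuot δ (volume.withDensityᵥ v) t‖ₑ ^ 2 ≤ ∫⁻ t, ‖v t‖ₑ ^ 2 := by
  set ρ := volume.withDensity fun t => ‖v t‖ₑ ^ 2 with hρ
  have hδ0 : ENNReal.ofReal δ ≠ 0 := by simpa using hδ
  calc ∫⁻ t in Ioo a b, ‖diffQuot δ (volume.withDensityᵥ v) t‖ₑ ^ 2
      ≤ ∫⁻ t in Ioo a b, (ENNReal.ofReal δ)⁻¹ * ρ (Ioc t (t + δ)) := by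
        refine lintegral_mono fun t => ?_
        rw [diffQuot_eq hδ, withDensityᵥ_apply hvi measurableSet_Ioc, hρ,
          withDensity_apply _ measurableSet_Ioc]
        exact enorm_inv_mul_setIntegral_sq_le hδ hv hC t
    _ = (ENNReal.ofReal δ)⁻¹ * ∫⁻ t in Ioo a b, ρ (Ioc t (t + δ)) :=
        lintegral_const_mul' _ _ (ENNReal.inv_ne_top.2 hδ0)
    _ ≤ (ENNReal.ofReal δ)⁻¹ * (ENNReal.ofReal δ * ρ (Ioc a (b + δ))) := by
        gcongr; exact lintegral_measure_Ioc_le _ _ _ _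
    _ = ρ (Ioc a (b + δ)) := by
        rw [← mul_assoc, ENNReal.inv_mul_cancel hδ0 (by simp), one_mul]
    _ ≤ ρ univ := measure_mono (subset_univ _)
    _ = _ := by rw [hρ, withDensity_apply _ MeasurableSet.univ, Measure.restrict_univ]

/-- The total variation of the part of `Du` which does not enter the elastic energy. -/
def inelastic (a b c₀ : ℝ) (u : ℝ → ℝ) : Measure ℝ :=
  singVar a b u + volume.withDensity fun t => ‖gStar a b c₀ u t‖ₑ

theorem isFiniteMeasure_inelastic {c₀ : ℝ} (hc₀ : 0 < c₀) (a b : ℝ) (u : ℝ → ℝ) :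
    IsFiniteMeasure (inelastic a b c₀ u) := by
  have : IsFiniteMeasure (volume.withDensity fun t => ‖gStar a b c₀ u t‖ₑ) :=
    isFiniteMeasure_withDensity (integrable_gStar hc₀ a b u).2.ne
  unfold inelastic
  infer_instance

/-- Split `Du = ν + η` with `ν = Dˢu + g*𝓛¹` and `η = (u' - g*)𝓛¹`. Difference quotients are linear,
so with the quotient of `ν` as competitor the elastic strain is the quotient of `η`. Away from `B`
the quotient of `ν` is dominated by that of `ρ`. -/
theorem redEeps_smoothing_le {a b c₀ ε δ : ℝ} (hab : a < b) (hc₀ : 0 < c₀) (hε : 0 < ε)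
    (hδ : 0 < δ) (hεab : 2 * ε ≤ b - a) {K : ℝ≥0∞} {u : ℝ → ℝ} {k : ℝ}
    (hK : eLpNorm (smoothing δ k (distribDeriv a b u)) ∞ (volume.restrict (Ioo a b)) ≤ K)
    (B : Finset ℝ) (ρ : Measure ℝ) [IsFiniteMeasure ρ]
    (hρ : (inelastic a b c₀ u).restrict (B : Set ℝ)ᶜ ≤ ρ) :
    redEeps a b c₀ K ε (smoothing δ k (distribDeriv a b u)) ≤
      (∫⁻ t in Ioo a b, ‖acDeriv a b u t - gStar a b c₀ u t‖ₑ ^ 2) +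
      ENNReal.ofReal c₀ * (ρ univ + ρ (Ioc a (a + 2 * ε + δ)) +
        ρ (Ioc (b - 2 * ε) (b + δ)) + B.card * ENNReal.ofReal (2 + δ / ε)) := by
  set μ := distribDeriv a b u with hμ
  set v : ℝ → ℝ := fun t => acDeriv a b u t - gStar a b c₀ u t with hv
  have hgi := integrable_gStar hc₀ a b u
  have hvi : Integrable v := (integrable_acDeriv a b u).sub hgi
  have hvm : Measurable v := (measurable_acDeriv a b u).sub (measurable_gStar a b c₀ u)
  have hvC : ∀ t, |v t| ≤ c₀ / 2 := abs_sub_gStar_le hc₀ a b u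
  set ν : SignedMeasure ℝ := singDeriv a b u + volume.withDensityᵥ (gStar a b c₀ u) with hν
  set η : SignedMeasure ℝ := volume.withDensityᵥ v with hη
  have hμν : μ = ν + η := by
    have h1 := SignedMeasure.singularPart_add_withDensity_rnDeriv_eq (s := μ) (μ := volume)
    rw [hν, hη, hv, add_assoc]
    rw [show (fun t => acDeriv a b u t - gStar a b c₀ u t) =
        acDeriv a b u - gStar a b c₀ u from rfl,
      withDensityᵥ_sub (integrable_acDeriv a b u) hgi, add_sub_cancel]
    exact h1.symm
  have hquot : ∀ t, diffQuot δ μ t - diffQuot δ ν t = diffQuot δ η t := by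
    intro t
    rw [diffQuot_eq hδ, diffQuot_eq hδ, diffQuot_eq hδ, hμν, _root_.add_apply]
    ring
  obtain ⟨hW, hac⟩ := isW11_smoothing hab hδ k μ
  have hge : ∀ t, (∀ y ∈ B, y ∉ Ioc t (t + δ)) →
      ‖diffQuot δ ν t‖ₑ ≤ (ENNReal.ofReal δ)⁻¹ * ρ (Ioc t (t + δ)) := by
    intro t ht
    rw [diffQuot_eq hδ, enorm_mul, Real.enorm_of_nonneg (inv_pos.2 hδ).le,
      ENNReal.ofReal_inv_of_pos hδ]
    gcongr
    calc ‖ν (Ioc t (t + δ))‖ₑ ≤ inelastic a b c₀ u (Ioc t (t + δ)) := by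
          rw [hν, _root_.add_apply, inelastic, Measure.add_apply,
            withDensityᵥ_apply hgi measurableSet_Ioc, withDensity_apply _ measurableSet_Ioc]
          exact (enorm_add_le _ _).trans (add_le_add (enorm_apply_le_totalVariation _ _)
            (enorm_integral_le_lintegral_enorm _))
      _ = (inelastic a b c₀ u).restrict (B : Set ℝ)ᶜ (Ioc t (t + δ)) := by
          rw [Measure.restrict_apply measurableSet_Ioc, inter_eq_left.2]
          exact fun y hy hyB => ht y hyB hy
      _ ≤ _ := hρ _
  have hdiff : ∀ᵐ t ∂(volume.restrict (Ioo a b)),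
      acDeriv a b (smoothing δ k μ) t - diffQuot δ ν t = diffQuot δ η t := by
    filter_upwards [hac] with t ht
    rw [ht, hquot]
  have hη2 : MemLp (diffQuot δ η) 2 (volume.restrict (Ioo a b)) :=
    MemLp.of_bound (measurable_diffQuot δ η).aestronglyMeasurable _
      (.of_forall (abs_diffQuot_le hδ η))
  refine (iInf₂_le (density a b (diffQuot δ ν)) (density_mem_radonMeasures a b _)).trans ?_
  refine (iInf₂_le (diffQuot δ ν) ⟨hW, hK, integrableOn_diffQuot hδ ν (by simp), rfl,
    (memLp_congr_ae hdiff).2 hη2⟩).trans ?_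
  refine add_le_add ?_ (nonlocal_le hε hδ hεab ρ B hge)
  calc ∫⁻ t in Ioo a b, ‖acDeriv a b (smoothing δ k μ) t - diffQuot δ ν t‖ₑ ^ 2
      = ∫⁻ t in Ioo a b, ‖diffQuot δ η t‖ₑ ^ 2 := by
        refine lintegral_congr_ae ?_
        filter_upwards [hdiff] with t ht
        rw [ht]
    _ ≤ ∫⁻ t, ‖v t‖ₑ ^ 2 := lintegral_diffQuot_sq_le hδ hvm hvi hvC a b
    _ = ∫⁻ t in Ioo a b, ‖v t‖ₑ ^ 2 := by
        refine lintegral_eq_setLIntegral_Ioo ?_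
        filter_upwards [acDeriv_ae_eq_zero a b u] with t ht
        have := abs_gStar_le hc₀ a b u t
        rw [ht, abs_zero, abs_nonpos_iff] at this
        simp [hv, ht, this]

/-! ### Truncation of functions with infinite values -/

theorem distribDeriv_const {a b : ℝ} (hab : a < b) (c : ℝ) :
    distribDeriv a b (fun _ => c) = 0 := by
  refine distribDeriv_eq hab (isBV_const c).1 ?_
    (hasDistribDeriv_of_ae_eq c (.of_forall fun t => ?_))
  · ext A hA
    rw [VectorMeasure.restrict_zero]
  · simp [cumul]

namespace BVInfRep

variable {a b : ℝ} {u : ℝ → EReal} (R : BVInfRep a b u)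

open Classical in
/-- The function `w` on `𝓕(u)`, with the infinite values replaced by `±M`. -/
def truncation (M : ℝ) (t : ℝ) : ℝ :=
  ∑ i, (Ioo (R.x i.castSucc) (R.x i.succ)).indicator
    (if R.α i = 0 then R.w else if R.α i = ⊤ then fun _ => M else fun _ => -M) t

theorem isBV_truncation (hab : a < b) (M : ℝ) : IsBV a b (R.truncation M) := by
  refine isBV_sum hab _ _ fun i _ => IsBV.indicator_Ioo hab ?_ _ _
  split_ifs
  · exact R.isBV_w
  · exact isBV_const _
  · exact isBV_const _

open Classical in
theorem truncation_eq (M : ℝ) {i : Fin R.m} {t : ℝ}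
    (ht : t ∈ Ioo (R.x i.castSucc) (R.x i.succ)) : R.truncation M t =
      (if R.α i = 0 then R.w else if R.α i = ⊤ then fun _ => M else fun _ => -M) t :=
  sum_indicator_partition R.strictMono_x _ ht

theorem truncation_ae_eq (M : ℝ) :
    ∀ᵐ t ∂(volume.restrict R.finitePart), R.truncation M t = R.w t := by
  have h := ae_of_forall_partition (x := R.x)
    (P := fun t => t ∈ R.finitePart → R.truncation M t = R.w t) fun i => by
      filter_upwards [ae_restrict_mem measurableSet_Ioo] with t ht hF
      rw [R.truncation_eq M ht, if_pos (R.α_eq_zero_of_mem_Ioo hF ht)]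
  rw [R.x_zero, R.x_last] at h
  filter_upwards [ae_restrict_mono R.finitePart_subset h,
    ae_restrict_mem R.isOpen_finitePart.measurableSet] with t h1 h2 using h1 h2

/-- A point outside both `B` and the finite part is not a jump, since such a jump would be infinite.
Hence the adjacent pieces carry the same infinity and the truncation is constant across the point.
Off `B` the derivative therefore does not depend on `M`. -/
theorem truncation_restrict_eq (hab : a < b) (M : ℝ) (B : Finset ℝ)
    (hB : (B : Set ℝ) = {x ∈ jumpSet a b u | 2 ≤ jumpAbs u x}) :
    (distribDeriv a b (R.truncation M)).restrict (Ioo a b \ B) =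
      ((distribDeriv a b R.w).restrict R.finitePart).restrict (Ioo a b \ B) := by
  have hF := R.isOpen_finitePart.measurableSet
  have hFF : (distribDeriv a b (R.truncation M)).restrict R.finitePart =
      (distribDeriv a b R.w).restrict R.finitePart :=
    distribDeriv_restrict_eq hab (R.isBV_truncation hab M) R.isBV_w R.isOpen_finitePart
      R.finitePart_subset (R.truncation_ae_eq M)
  have hUo : IsOpen (Ioo a b \ (B : Set ℝ)) := isOpen_Ioo.sdiff B.finite_toSet.isClosed
  refine restrict_eq_of_forall_mem hUo fun x hx => ?_
  by_cases hxF : x ∈ R.finitePart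
  · obtain ⟨r, hr, hball⟩ := Metric.isOpen_iff.1 R.isOpen_finitePart x hxF
    rw [Real.ball_eq_Ioo] at hball
    refine ⟨x - r, x + r, ⟨by linarith, by linarith⟩, ?_⟩
    rw [← hFF]
    ext A hA
    rw [VectorMeasure.restrict_apply _ measurableSet_Ioo hA,
      VectorMeasure.restrict_apply _ measurableSet_Ioo hA,
      VectorMeasure.restrict_apply _ hF (hA.inter measurableSet_Ioo), inter_assoc,
      inter_eq_left.2 hball]
  · obtain ⟨i, hi⟩ := R.exists_right hx.1
    obtain ⟨j, hj⟩ := R.exists_left hx.1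
    have hxJ : x ∉ jumpSet a b u := fun h =>
      hx.2 ((Set.ext_iff.1 hB x).2 ⟨h, by rw [R.jumpAbs_eq_top hab h hxF]; exact le_top⟩)
    have hij := R.α_eq_of_notMem_jumpSet hab hx.1 hxJ hi hj
    have hi0 : R.α i ≠ 0 := fun h => hxF (R.mem_finitePart h (hij ▸ h) hi hj)
    have hpiece : ∀ t ∈ Ioo (R.x j.castSucc) (R.x i.succ), t ≠ x →
        t ∈ Ioo (R.x j.castSucc) (R.x j.succ) ∨ t ∈ Ioo (R.x i.castSucc) (R.x i.succ) := by
      intro t ht hne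
      rcases lt_or_gt_of_ne hne with h | h
      · exact Or.inl ⟨ht.1, h.trans_le hj.2⟩
      · exact Or.inr ⟨hi.1.trans_lt h, ht.2⟩
    have hdisj : R.finitePart ∩ Ioo (R.x j.castSucc) (R.x i.succ) = ∅ := by
      refine eq_empty_of_forall_notMem fun t ht => ?_
      rcases hpiece t ht.2 (fun h => hxF (h ▸ ht.1)) with h | h
      · exact hi0 (hij.trans (R.α_eq_zero_of_mem_Ioo ht.1 h))
      · exact hi0 (R.α_eq_zero_of_mem_Ioo ht.1 h)
    have hsub : Ioo (R.x j.castSucc) (R.x i.succ) ⊆ Ioo a b := by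
      have h1 := (R.mem_Icc_of_mem j (left_mem_Icc.2 (R.strictMono_x Fin.castSucc_lt_succ).le)).1
      have h2 := (R.mem_Icc_of_mem i (right_mem_Icc.2 (R.strictMono_x Fin.castSucc_lt_succ).le)).2
      exact Ioo_subset_Ioo h1 h2
    refine ⟨R.x j.castSucc, R.x i.succ, ⟨hj.1, hi.2⟩, ?_⟩
    have hconst : ∃ c : ℝ, ∀ᵐ t ∂(volume.restrict (Ioo (R.x j.castSucc) (R.x i.succ))),
        R.truncation M t = c := by
      have hxne : ∀ᵐ t ∂(volume.restrict (Ioo (R.x j.castSucc) (R.x i.succ))), t ≠ x :=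
        ae_restrict_of_ae (Measure.ae_ne volume x)
      classical
      refine ⟨if R.α i = ⊤ then M else -M, ?_⟩
      filter_upwards [hxne, ae_restrict_mem measurableSet_Ioo] with t hne ht
      rcases hpiece t ht hne with h | h
      · rw [R.truncation_eq M h, ← hij, if_neg hi0]
        split_ifs <;> rfl
      · rw [R.truncation_eq M h, if_neg hi0]
        split_ifs <;> rfl
    obtain ⟨c, hc⟩ := hconst
    rw [distribDeriv_restrict_eq hab (R.isBV_truncation hab M) (isBV_const c) isOpen_Ioo hsub hc,
      distribDeriv_const hab]
    ext A hA
    rw [VectorMeasure.restrict_zero, VectorMeasure.restrict_apply _ measurableSet_Ioo hA,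
      VectorMeasure.restrict_apply _ hF (hA.inter measurableSet_Ioo), inter_assoc,
      inter_comm (Ioo _ _), hdisj, inter_empty]
    simp

end BVInfRep

/-! ### The parts of the derivative of the truncation. -/

namespace BVInfRep

variable {a b : ℝ} {u : ℝ → EReal} (R : BVInfRep a b u)

theorem acDeriv_truncation (hab : a < b) (M : ℝ) (B : Finset ℝ)
    (hB : (B : Set ℝ) = {x ∈ jumpSet a b u | 2 ≤ jumpAbs u x}) :
    ∀ᵐ t, acDeriv a b (R.truncation M) t = R.finitePart.indicator (acDeriv a b R.w) t := by
  have hF := R.isOpen_finitePart.measurableSet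
  have hU : MeasurableSet (Ioo a b \ (B : Set ℝ)) := measurableSet_Ioo.diff B.measurableSet
  have h1 := rnDeriv_restrict_signed (distribDeriv a b (R.truncation M)) volume hU
  rw [R.truncation_restrict_eq hab M B hB] at h1
  have h2 := rnDeriv_restrict_signed ((distribDeriv a b R.w).restrict R.finitePart) volume hU
  have h3 := rnDeriv_restrict_signed (distribDeriv a b R.w) volume hF
  have h4 := rnDeriv_ae_eq_zero_of_restrict_eq_zero hF.compl
    (restrict_compl_eq_zero hF (μ := (distribDeriv a b R.w).restrict R.finitePart) (by
      ext A hA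
      rw [VectorMeasure.restrict_apply _ hF hA, VectorMeasure.restrict_apply _ hF (hA.inter hF),
        VectorMeasure.restrict_apply _ hF hA, inter_assoc, inter_self]))
  have h5 := acDeriv_ae_eq_zero a b (R.truncation M)
  rw [ae_restrict_iff' hU] at h1 h2
  rw [ae_restrict_iff' hF] at h3
  rw [ae_restrict_iff' hF.compl] at h4
  rw [ae_restrict_iff' measurableSet_Ioo.compl] at h5
  have h6 : ∀ᵐ t, t ∉ (B : Set ℝ) :=
    measure_eq_zero_iff_ae_notMem.1 (B.finite_toSet.measure_zero volume)
  filter_upwards [h1, h2, h3, h4, h5, h6] with t h1 h2 h3 h4 h5 h6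
  by_cases ht : t ∈ Ioo a b
  · rw [acDeriv, ← h1 ⟨ht, h6⟩, h2 ⟨ht, h6⟩]
    by_cases htF : t ∈ R.finitePart
    · rw [h3 htF, indicator_of_mem htF, acDeriv]
    · rw [h4 htF, indicator_of_notMem htF]
  · rw [h5 ht, indicator_of_notMem fun h => ht (R.finitePart_subset h)]

theorem singVar_truncation (hab : a < b) (M : ℝ) (B : Finset ℝ)
    (hB : (B : Set ℝ) = {x ∈ jumpSet a b u | 2 ≤ jumpAbs u x}) :
    (singVar a b (R.truncation M)).restrict (Ioo a b \ B) =
      (singVar a b R.w).restrict (R.finitePart \ B) := by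
  have hF := R.isOpen_finitePart.measurableSet
  have hU : MeasurableSet (Ioo a b \ (B : Set ℝ)) := measurableSet_Ioo.diff B.measurableSet
  have hFU : R.finitePart ∩ (Ioo a b \ (B : Set ℝ)) = R.finitePart \ B := by
    rw [← inter_sdiff_assoc, inter_eq_left.2 R.finitePart_subset]
  rw [singVar, CohesiveFracture.singDeriv, ← totalVariation_singularPart_restrict _ _ hU,
    ← singularPart_restrict_signed _ _ hU, R.truncation_restrict_eq hab M B hB,
    singularPart_restrict_signed _ _ hU, totalVariation_singularPart_restrict _ _ hU,
    singularPart_restrict_signed _ _ hF, totalVariation_singularPart_restrict _ _ hF,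
    Measure.restrict_restrict hU, inter_comm, hFU]
  rfl

theorem gStar_truncation (hab : a < b) (c₀ M : ℝ) (B : Finset ℝ)
    (hB : (B : Set ℝ) = {x ∈ jumpSet a b u | 2 ≤ jumpAbs u x}) (hc₀ : 0 < c₀) :
    ∀ᵐ t, gStar a b c₀ (R.truncation M) t = R.finitePart.indicator (gStar a b c₀ R.w) t := by
  filter_upwards [R.acDeriv_truncation hab M B hB] with t ht
  by_cases htF : t ∈ R.finitePart
  · rw [indicator_of_mem htF] at ht ⊢
    simp only [gStar, ht]
  · rw [indicator_of_notMem htF] at ht ⊢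
    simpa [ht] using abs_gStar_le hc₀ a b (R.truncation M) t

/-- The dominating measure is independent of `M`, so `M` may tend to infinity together with `ε → 0`.
-/
theorem inelastic_truncation_le (hab : a < b) {c₀ : ℝ} (hc₀ : 0 < c₀) (M : ℝ) (B : Finset ℝ)
    (hB : (B : Set ℝ) = {x ∈ jumpSet a b u | 2 ≤ jumpAbs u x}) :
    (inelastic a b c₀ (R.truncation M)).restrict (B : Set ℝ)ᶜ ≤
      (inelastic a b c₀ R.w).restrict (R.finitePart \ B) := by
  have hF := R.isOpen_finitePart.measurableSet
  have hBm : MeasurableSet (B : Set ℝ)ᶜ := B.measurableSet.compl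
  have h1 : (singVar a b (R.truncation M)).restrict (B : Set ℝ)ᶜ ≤
      (singVar a b R.w).restrict (R.finitePart \ B) := by
    rw [← R.singVar_truncation hab M B hB]
    refine Measure.le_iff.2 fun A hA => ?_
    rw [Measure.restrict_apply hA, Measure.restrict_apply hA]
    calc singVar a b (R.truncation M) (A ∩ (B : Set ℝ)ᶜ)
        ≤ singVar a b (R.truncation M) ((A ∩ (Ioo a b \ B)) ∪ (Ioo a b)ᶜ) := by
          refine measure_mono fun t ht => ?_
          by_cases h : t ∈ Ioo a b
          · exact Or.inl ⟨ht.1, h, ht.2⟩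
          · exact Or.inr h
      _ ≤ _ := (measure_union_le _ _).trans (by rw [singVar_compl, add_zero])
  have h2 : (volume.withDensity fun t => ‖gStar a b c₀ (R.truncation M) t‖ₑ).restrict
      (B : Set ℝ)ᶜ = (volume.withDensity fun t => ‖gStar a b c₀ R.w t‖ₑ).restrict
        (R.finitePart \ B) := by
    have e1 : (fun t => ‖gStar a b c₀ (R.truncation M) t‖ₑ) =ᵐ[volume]
        R.finitePart.indicator fun t => ‖gStar a b c₀ R.w t‖ₑ := by
      filter_upwards [R.gStar_truncation hab c₀ M B hB hc₀] with t ht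
      rw [ht]
      by_cases htF : t ∈ R.finitePart
      · rw [indicator_of_mem htF, indicator_of_mem htF]
      · rw [indicator_of_notMem htF, indicator_of_notMem htF, enorm_zero]
    rw [withDensity_congr_ae e1, withDensity_indicator hF, ← restrict_withDensity hF,
      Measure.restrict_restrict hBm, sdiff_eq, inter_comm]
  rw [inelastic, inelastic, Measure.restrict_add, Measure.restrict_add, h2]
  exact add_le_add h1 le_rfl

theorem lintegral_truncation (hab : a < b) {c₀ : ℝ} (hc₀ : 0 < c₀) (M : ℝ) (B : Finset ℝ)
    (hB : (B : Set ℝ) = {x ∈ jumpSet a b u | 2 ≤ jumpAbs u x}) :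
    ∫⁻ t in Ioo a b, ‖acDeriv a b (R.truncation M) t - gStar a b c₀ (R.truncation M) t‖ₑ ^ 2 =
      ∫⁻ t in R.finitePart, ‖acDeriv a b R.w t - gStar a b c₀ R.w t‖ₑ ^ 2 := by
  have hF := R.isOpen_finitePart.measurableSet
  have h : ∀ᵐ t ∂(volume.restrict (Ioo a b)),
      ‖acDeriv a b (R.truncation M) t - gStar a b c₀ (R.truncation M) t‖ₑ ^ 2 =
      R.finitePart.indicator (fun t => ‖acDeriv a b R.w t - gStar a b c₀ R.w t‖ₑ ^ 2) t := by
    filter_upwards [ae_restrict_of_ae (R.acDeriv_truncation hab M B hB),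
      ae_restrict_of_ae (R.gStar_truncation hab c₀ M B hB hc₀)] with t h1 h2
    rw [h1, h2]
    by_cases htF : t ∈ R.finitePart
    · simp only [indicator_of_mem htF]
    · simp [indicator_of_notMem htF]
  rw [lintegral_congr_ae h, lintegral_indicator hF, Measure.restrict_restrict hF,
    inter_eq_left.2 R.finitePart_subset]

end BVInfRep

/-! ### End contributions and bounds up to the boundary. -/

theorem tendsto_measure_Ioc_right (ρ : Measure ℝ) [IsFiniteMeasure ρ] (p : ℝ) {η : ℕ → ℝ}
    (hη : ∀ n, 0 < η n) (hη0 : Tendsto η atTop (𝓝 0)) :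
    Tendsto (fun n => ρ (Ioc p (p + η n))) atTop (𝓝 0) := by
  have h1 : Tendsto (fun n => p + η n) atTop (𝓝[>] p) := by
    refine tendsto_nhdsWithin_iff.2 ⟨by simpa using hη0.const_add p, .of_forall fun n => ?_⟩
    simpa using hη n
  have h2 := ((tendsto_real_Iic_right ρ p).comp h1).sub_const (ρ.real (Iic p))
  rw [sub_self] at h2
  have h3 := ENNReal.tendsto_ofReal h2
  rw [ENNReal.ofReal_zero] at h3
  refine h3.congr fun n => ?_
  have h4 : ρ.real (Iic p) + ρ.real (Ioc p (p + η n)) = ρ.real (Iic (p + η n)) := by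
    rw [← Iic_union_Ioc_eq_Iic (by linarith [hη n] : p ≤ p + η n),
      measureReal_union (Iic_disjoint_Ioc le_rfl) measurableSet_Ioc]
  rw [Function.comp_apply, ← h4, add_sub_cancel_left, ofReal_measureReal]

theorem tendsto_measure_Ioc_left (ρ : Measure ℝ) [IsFiniteMeasure ρ] {q : ℝ}
    (hq : ρ (Ici q) = 0) {η θ : ℕ → ℝ} (hη : ∀ n, 0 < η n) (hη0 : Tendsto η atTop (𝓝 0)) :
    Tendsto (fun n => ρ (Ioc (q - η n) (q + θ n))) atTop (𝓝 0) := by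
  have h1 : Tendsto (fun n => q - η n) atTop (𝓝[<] q) := by
    refine tendsto_nhdsWithin_iff.2 ⟨by simpa using hη0.const_sub q, .of_forall fun n => ?_⟩
    simpa using hη n
  have h2 := ((tendsto_real_Iic_left ρ q).comp h1).const_sub (ρ.real (Iio q))
  rw [sub_self] at h2
  have h3 := ENNReal.tendsto_ofReal h2
  rw [ENNReal.ofReal_zero] at h3
  refine tendsto_of_tendsto_of_tendsto_of_le_of_le tendsto_const_nhds h3 (fun n => zero_le)
    fun n => ?_
  have h4 : ρ.real (Iic (q - η n)) + ρ.real (Ioo (q - η n) q) = ρ.real (Iio q) := by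
    rw [← Iic_union_Ioo_eq_Iio (by linarith [hη n] : q - η n < q),
      measureReal_union ?_ measurableSet_Ioo]
    exact disjoint_left.2 fun t h h' => not_lt.2 h h'.1
  simp only [Function.comp_apply]
  rw [← h4, add_sub_cancel_left, ofReal_measureReal]
  calc ρ (Ioc (q - η n) (q + θ n)) ≤ ρ (Ioo (q - η n) q ∪ Ici q) := by
        refine measure_mono fun t ht => ?_
        rcases lt_or_ge t q with h | h
        · exact Or.inl ⟨ht.1, h⟩
        · exact Or.inr h
    _ ≤ _ := (measure_union_le _ _).trans (by rw [hq, add_zero])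

/-- Forward averages at points near `b` look beyond `b`. There the primitive is constant and equal
to its left limit at `b`, so the almost everywhere bound persists. -/
theorem abs_add_cumul_le {a b k C : ℝ} (hab : a < b) {μ : SignedMeasure ℝ}
    (hμ : μ ∈ radonMeasures a b) (h : ∀ᵐ t ∂(volume.restrict (Ioo a b)), |k + cumul μ t| ≤ C)
    {s : ℝ} (hs : a < s) : |k + cumul μ s| ≤ C := by
  rcases lt_or_ge s b with hsb | hsb
  · refine le_of_tendsto (f := fun t => |k + cumul μ t|) (x := essRight s) ?_
      (eventually_essRight hsb (ae_restrict_mono (Ioo_subset_Ioo_left hs.le) h))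
    exact (((tendsto_cumul_right μ s).const_add k).abs).mono_left inf_le_left
  · have e : cumul μ s = μ (Iio b) := by
      rw [cumul, ← show μ.restrict (Ioo a b) = μ from hμ,
        VectorMeasure.restrict_apply _ measurableSet_Ioo measurableSet_Iic,
        VectorMeasure.restrict_apply _ measurableSet_Ioo measurableSet_Iio]
      congr 1; ext t
      simp only [mem_inter_iff, mem_Iic, mem_Ioo, mem_Iio]
      exact ⟨fun h => ⟨h.2.2, h.2⟩, fun h => ⟨(h.1.trans_le hsb).le, h.2⟩⟩
    rw [e]
    refine le_of_tendsto (f := fun t => |k + cumul μ t|) (x := essLeft b) ?_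
      (eventually_essLeft hab h)
    exact (((tendsto_cumul_left μ b).const_add k).abs).mono_left inf_le_left

/-! ### Limits of smoothed truncations and of their energies. -/

namespace BVInfRep

variable {a b : ℝ} {u : ℝ → EReal} (R : BVInfRep a b u)

/-- With `δ = ε²` the quotient `δ / ε` vanishes, so each large jump costs `2c₀` in the limit. The
two end contributions tend to zero because `ρ` is finite and does not charge `[b, ∞)`. -/
theorem limsup_redEeps_smoothing_le (hab : a < b) {c₀ : ℝ} (hc₀ : 0 < c₀) {ε : ℕ → ℝ}
    (hε : ∀ n, 0 < ε n) (hε0 : Tendsto ε atTop (𝓝 0)) (M k : ℕ → ℝ) {K : ℝ≥0∞}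
    (hK : ∀ n, eLpNorm (smoothing (ε n ^ 2) (k n) (distribDeriv a b (R.truncation (M n)))) ∞
      (volume.restrict (Ioo a b)) ≤ K) :
    limsup (fun n => redEeps a b c₀ K (ε n)
      (smoothing (ε n ^ 2) (k n) (distribDeriv a b (R.truncation (M n))))) atTop ≤
      R.energy c₀ := by
  have hF := R.isOpen_finitePart.measurableSet
  set C := ENNReal.ofReal c₀ with hC
  set B := (R.finite_bigJumps hab).toFinset with hBdef
  have hB : (B : Set ℝ) = {x ∈ jumpSet a b u | 2 ≤ jumpAbs u x} := by
    rw [hBdef, Finite.coe_toFinset]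
  have := isFiniteMeasure_inelastic hc₀ a b R.w
  set ρ := (inelastic a b c₀ R.w).restrict (R.finitePart \ B) with hρ
  set A := ∫⁻ t in R.finitePart, ‖acDeriv a b R.w t - gStar a b c₀ R.w t‖ₑ ^ 2 with hA
  have hbound : ∀ᶠ n in atTop, redEeps a b c₀ K (ε n)
      (smoothing (ε n ^ 2) (k n) (distribDeriv a b (R.truncation (M n)))) ≤
      A + C * (ρ univ + ρ (Ioc a (a + (2 * ε n + ε n ^ 2))) +
        ρ (Ioc (b - 2 * ε n) (b + ε n ^ 2)) + B.card * ENNReal.ofReal (2 + ε n)) := by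
    filter_upwards [hε0.eventually_lt_const (show 0 < (b - a) / 2 by linarith)] with n hn
    have h := redEeps_smoothing_le hab hc₀ (hε n) (pow_pos (hε n) 2) (by linarith) (hK n) B ρ
      (R.inelastic_truncation_le hab hc₀ (M n) B hB)
    rw [R.lintegral_truncation hab hc₀ (M n) B hB, sq (ε n),
      mul_div_cancel_right₀ _ (hε n).ne', add_assoc a] at h
    rwa [sq]
  have hρb : ρ (Ici b) = 0 := by
    rw [hρ, Measure.restrict_apply measurableSet_Ici]
    refine measure_mono_null (t := ∅) (fun t ht => ?_) measure_empty
    exact absurd (R.finitePart_subset ht.2.1).2 (not_lt.2 ht.1)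
  have hlim : Tendsto (fun n => A + C * (ρ univ + ρ (Ioc a (a + (2 * ε n + ε n ^ 2))) +
        ρ (Ioc (b - 2 * ε n) (b + ε n ^ 2)) + B.card * ENNReal.ofReal (2 + ε n))) atTop
      (𝓝 (A + C * (ρ univ + 0 + 0 + B.card * ENNReal.ofReal (2 + 0)))) := by
    have t1 : Tendsto (fun n => 2 * ε n + ε n ^ 2) atTop (𝓝 0) := by
      simpa using (hε0.const_mul 2).add (hε0.pow 2)
    have t2 : Tendsto (fun n => 2 * ε n) atTop (𝓝 0) := by simpa using hε0.const_mul 2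
    refine tendsto_const_nhds.add (ENNReal.Tendsto.const_mul ?_ (Or.inr ENNReal.ofReal_ne_top))
    refine ((tendsto_const_nhds.add (tendsto_measure_Ioc_right ρ a
      (fun n => by have := hε n; positivity) t1)).add (tendsto_measure_Ioc_left ρ hρb
      (fun n => by have := hε n; positivity) t2)).add ?_
    exact ENNReal.Tendsto.const_mul (ENNReal.tendsto_ofReal (hε0.const_add 2))
      (Or.inr (ENNReal.natCast_ne_top _))
  refine (limsup_le_limsup hbound).trans ?_
  rw [hlim.limsup_eq]
  have hρu : ρ univ ≤ singVar a b R.w (R.finitePart \ B) +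
      ∫⁻ t in R.finitePart, ‖gStar a b c₀ R.w t‖ₑ := by
    rw [hρ, Measure.restrict_apply_univ, inelastic, Measure.add_apply,
      withDensity_apply _ (hF.diff B.measurableSet)]
    gcongr
    exact sdiff_subset
  calc A + C * (ρ univ + 0 + 0 + B.card * ENNReal.ofReal (2 + 0))
      ≤ A + C * (singVar a b R.w (R.finitePart \ B) +
        (∫⁻ t in R.finitePart, ‖gStar a b c₀ R.w t‖ₑ) + 0 + 0 +
          B.card * ENNReal.ofReal (2 + 0)) := by gcongr
    _ = (A + C * ∫⁻ t in R.finitePart, ‖gStar a b c₀ R.w t‖ₑ) +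
        (2 * C * B.card + C * singVar a b R.w (R.finitePart \ B)) := by
        simp only [add_zero, ENNReal.ofReal_ofNat]
        ring
    _ ≤ _ := by
        rw [BVInfRep.energy, hA, lintegral_sub_gStar hc₀, add_assoc]
        exact add_le_add le_rfl (R.le_surfaceEnergy_add hab c₀ B hB)

/-- Away from the nodes the forward interval eventually stays in one piece, where the truncation is
`w` or the constant `±M n`. -/
theorem tendsto_smoothing (hab : a < b) {M k : ℕ → ℝ} (hM : Tendsto M atTop atTop)
    (hk : ∀ n, ∀ᵐ t ∂(volume.restrict (Ioo a b)),
      R.truncation (M n) t = k n + cumul (distribDeriv a b (R.truncation (M n))) t)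
    {δ : ℕ → ℝ} (hδ : ∀ n, 0 < δ n) (hδ0 : Tendsto δ atTop (𝓝 0)) :
    ∀ᵐ t ∂(volume.restrict (Ioo a b)), Tendsto (fun n =>
      ((smoothing (δ n) (k n) (distribDeriv a b (R.truncation (M n))) t : ℝ) : EReal)) atTop
        (𝓝 (u t)) := by
  obtain ⟨kw, hkw⟩ := R.isBV_w.exists_ae_eq hab
  have h := ae_of_forall_partition (x := R.x) (P := fun t => Tendsto (fun n =>
      ((smoothing (δ n) (k n) (distribDeriv a b (R.truncation (M n))) t : ℝ) : EReal)) atTop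
        (𝓝 (u t))) fun i => by
    have hsub : Ioo (R.x i.castSucc) (R.x i.succ) ⊆ Ioo a b := by
      have h1 := (R.mem_Icc_of_mem i (left_mem_Icc.2 (R.strictMono_x Fin.castSucc_lt_succ).le)).1
      have h2 := (R.mem_Icc_of_mem i (right_mem_Icc.2 (R.strictMono_x Fin.castSucc_lt_succ).le)).2
      exact Ioo_subset_Ioo h1 h2
    filter_upwards [R.eq_ae i, ae_restrict_mono hsub hkw, ae_restrict_mem measurableSet_Ioo]
      with t h1 h2 ht
    have hloc : ∀ᶠ n in atTop, smoothing (δ n) (k n) (distribDeriv a b (R.truncation (M n))) t =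
        (δ n)⁻¹ * ∫ s in Ioo t (t + δ n), R.truncation (M n) s := by
      filter_upwards [hδ0.eventually_lt_const (sub_pos.2 ht.2)] with n hn
      exact smoothing_eq (hδ n) (ae_restrict_mono ((Ioo_subset_Ioo ht.1.le
        (by linarith)).trans hsub) (hk n))
    classical
    have hpiece : ∀ᶠ n in atTop, smoothing (δ n) (k n) (distribDeriv a b (R.truncation (M n))) t =
        (δ n)⁻¹ * ∫ s in Ioo t (t + δ n), (if R.α i = 0 then R.w else if R.α i = ⊤ then
          fun _ => M n else fun _ => -M n) s := by
      filter_upwards [hloc, hδ0.eventually_lt_const (sub_pos.2 ht.2)] with n hn hn'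
      rw [hn]
      congr 1
      refine setIntegral_congr_fun measurableSet_Ioo fun s hs => ?_
      exact R.truncation_eq (M n) ⟨ht.1.trans hs.1, by linarith [hs.2]⟩
    have hconst : ∀ n (c : ℝ), (δ n)⁻¹ * ∫ _ in Ioo t (t + δ n), c = c := by
      intro n c
      have h3 := hδ n
      rw [setIntegral_const, smul_eq_mul, Measure.real, Real.volume_Ioo, add_sub_cancel_left,
        ENNReal.toReal_ofReal h3.le, ← mul_assoc, inv_mul_cancel₀ h3.ne', one_mul]
    rcases R.α_mem i with h3 | h3 | h3
    · rw [h1, h3, EReal.add_bot]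
      refine Tendsto.congr' (f₁ := fun n => ((-M n : ℝ) : EReal)) ?_ ?_
      · filter_upwards [hpiece] with n hn
        rw [hn]
        simp only [h3, if_neg (show (⊥ : EReal) ≠ 0 by simp),
          if_neg (show (⊥ : EReal) ≠ ⊤ by simp), hconst]
      · exact EReal.tendsto_coe_nhds_bot_iff.2 (tendsto_neg_atTop_atBot.comp hM)
    · rw [h1, h3, add_zero, h2]
      refine EReal.tendsto_coe.2 ((tendsto_average ht.2 (ae_restrict_mono ((Ioo_subset_Ioo_left
        ht.1.le).trans hsub) hkw) hδ hδ0).congr' ?_)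
      filter_upwards [hpiece] with n hn
      simp [hn, h3]
    · rw [h1, h3, EReal.coe_add_top]
      refine Tendsto.congr' (f₁ := fun n => ((M n : ℝ) : EReal)) ?_ ?_
      · filter_upwards [hpiece] with n hn
        rw [hn]
        simp only [h3, if_neg (show (⊤ : EReal) ≠ 0 by simp), if_true, hconst]
      · exact EReal.tendsto_coe_nhds_top_iff.2 hM
  rwa [R.x_zero, R.x_last] at h

end BVInfRep

/-! ### Recovery sequences -/

theorem redEeps_congr {a b c₀ ε : ℝ} {K : ℝ≥0∞} {u₁ u₂ : ℝ → ℝ}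
    (h : ∀ᵐ t ∂(volume.restrict (Ioo a b)), u₁ t = u₂ t) :
    redEeps a b c₀ K ε u₁ = redEeps a b c₀ K ε u₂ := by
  have h1 : acDeriv a b u₁ = acDeriv a b u₂ := by rw [acDeriv, acDeriv, distribDeriv_congr h]
  simp only [redEeps, Eeps, isW11_congr h, eLpNorm_congr_ae h, h1]

theorem redEepsInf_eq_of_ae_eq {a b c₀ ε : ℝ} {u : ℝ → EReal} {v : ℝ → ℝ}
    (h : ∀ᵐ t ∂(volume.restrict (Ioo a b)), u t = v t) :
    redEepsInf a b c₀ ε u = redEeps a b c₀ ∞ ε v := by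
  rw [redEepsInf_of_ae (h.mono fun t ht => by simp [ht])]
  exact redEeps_congr (h.mono fun t ht => by simp [ht])

theorem BVInfRep.exists_recovery {a b : ℝ} {u : ℝ → EReal} (R : BVInfRep a b u) (hab : a < b)
    {c₀ : ℝ} (hc₀ : 0 < c₀) {ε : ℕ → ℝ} (hε : ∀ n, 0 < ε n) (hε0 : Tendsto ε atTop (𝓝 0)) :
    ∃ v : ℕ → ℝ → ℝ, (∀ n, IntegrableOn (v n) (Ioo a b)) ∧
      (∀ᵐ t ∂(volume.restrict (Ioo a b)), Tendsto (fun n => (v n t : EReal)) atTop (𝓝 (u t))) ∧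
      limsup (fun n => redEeps a b c₀ ∞ (ε n) (v n)) atTop ≤ R.energy c₀ := by
  choose k hk using fun n : ℕ => (R.isBV_truncation hab n).exists_ae_eq hab
  have hδ : ∀ n, 0 < ε n ^ 2 := fun n => pow_pos (hε n) 2
  refine ⟨fun n => smoothing (ε n ^ 2) (k n) (distribDeriv a b (R.truncation n)),
    fun n => (isW11_smoothing hab (hδ n) _ _).1.1,
    R.tendsto_smoothing hab tendsto_natCast_atTop_atTop hk hδ (by simpa using hε0.pow 2),
    R.limsup_redEeps_smoothing_le hab hc₀ hε hε0 _ k fun n => le_top⟩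

/-- No comparison of representations is needed: a recovery sequence built from `R'` is tested
against the lower bound for `R`. -/
theorem BVInfRep.energy_le_energy {a b : ℝ} {u : ℝ → EReal} (R R' : BVInfRep a b u) (hab : a < b)
    {c₀ : ℝ} (hc₀ : 0 < c₀) : R.energy c₀ ≤ R'.energy c₀ := by
  -- Any positive sequence tending to zero would do.
  have hε : ∀ n : ℕ, 0 < 1 / ((n : ℝ) + 1) := fun n => by positivity
  have hε0 := tendsto_one_div_add_atTop_nhds_zero_nat (𝕜 := ℝ)
  obtain ⟨v, -, hv, hlim⟩ := R'.exists_recovery hab hc₀ hε hε0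
  refine le_of_forall_gt fun c hc => ?_
  obtain ⟨d, hd, hdc⟩ := exists_between hc
  have hev := (eventually_lt_of_limsup_lt (hlim.trans_lt hd)).frequently
  refine ((energy_le_of_redEepsInf_lt (u := fun n t => (v n t : EReal)) hab hc₀ hdc.ne_top hε hε0
    (hev.mono fun n hn => ?_) hv).2 R).trans_lt hdc
  rwa [redEepsInf_eq_of_ae_eq (.of_forall fun t => rfl)]

theorem BVInfRep.redEInf_eq {a b : ℝ} {u : ℝ → EReal} (R : BVInfRep a b u) (hab : a < b)
    {c₀ : ℝ} (hc₀ : 0 < c₀) : redEInf a b c₀ u = R.energy c₀ := by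
  rw [CohesiveFracture.redEInf_eq hc₀]
  exact le_antisymm (iInf_le _ R) (le_iInf fun R' => R.energy_le_energy R' hab hc₀)

theorem exists_recovery_convAE {a b c₀ : ℝ} (hab : a < b) (hc₀ : 0 < c₀) {ε : ℕ → ℝ}
    (hε : ∀ n, 0 < ε n) (hε0 : Tendsto ε atTop (𝓝 0)) (u₀ : L0 a b) :
    ∃ u : ℕ → L0 a b, convAE a b u u₀ ∧
      limsup (fun n => redEepsInf a b c₀ (ε n) (u n)) atTop ≤ redEInf a b c₀ u₀ := by
  by_cases hR : Nonempty (BVInfRep a b u₀)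
  · obtain ⟨R⟩ := hR
    obtain ⟨v, hvi, hv, hlim⟩ := R.exists_recovery hab hc₀ hε hε0
    have hm : ∀ n, AEStronglyMeasurable (fun t => (v n t : EReal)) (volume.restrict (Ioo a b)) :=
      fun n => continuous_coe_real_ereal.comp_aestronglyMeasurable (hvi n).aestronglyMeasurable
    have hmk := fun n => AEEqFun.coeFn_mk _ (hm n)
    refine ⟨fun n => AEEqFun.mk _ (hm n), ?_, ?_⟩
    · filter_upwards [hv, ae_all_iff.2 hmk] with t h1 h2
      exact h1.congr fun n => (h2 n).symm
    · rw [R.redEInf_eq hab hc₀]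
      refine le_trans (le_of_eq ?_) hlim
      congr 1; ext n
      exact redEepsInf_eq_of_ae_eq (hmk n)
  · refine ⟨fun _ => u₀, .of_forall fun t => tendsto_const_nhds, ?_⟩
    rw [not_nonempty_iff] at hR
    rw [redEInf_eq hc₀, iInf_of_empty]
    exact le_top

/-- Averaging preserves the bound by `K`, which keeps the sequence admissible and dominates it, so
almost everywhere convergence becomes convergence in L¹. -/
theorem exists_recovery_convL1 {a b c₀ : ℝ} (hab : a < b) (hc₀ : 0 < c₀) {K : ℝ} (hK : 0 < K)
    {ε : ℕ → ℝ} (hε : ∀ n, 0 < ε n) (hε0 : Tendsto ε atTop (𝓝 0)) (u₀ : L1 a b) :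
    ∃ u : ℕ → L1 a b, convL1 a b u u₀ ∧
      limsup (fun n => redEeps a b c₀ (ENNReal.ofReal K) (ε n) (u n)) atTop ≤
        redE a b c₀ (ENNReal.ofReal K) u₀ := by
  by_cases h : IsBV a b u₀ ∧ eLpNorm u₀ ∞ (volume.restrict (Ioo a b)) ≤ ENNReal.ofReal K
  swap
  · refine ⟨fun _ => u₀, tendsto_const_nhds, ?_⟩
    rw [redE_eq_top h]
    exact le_top
  obtain ⟨hbv, hKu⟩ := h
  set R := hbv.rep hab with hRdef
  have hδ : ∀ n, 0 < ε n ^ 2 := fun n => pow_pos (hε n) 2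
  have hδ0 : Tendsto (fun n => ε n ^ 2) atTop (𝓝 0) := by simpa using hε0.pow 2
  have hKae : ∀ᵐ t ∂(volume.restrict (Ioo a b)), |u₀ t| ≤ K := by
    rw [eLpNorm_exponent_top] at hKu
    filter_upwards [enorm_ae_le_eLpNormEssSup u₀ (volume.restrict (Ioo a b))] with t ht
    have := ht.trans hKu
    rwa [← ofReal_norm, ENNReal.ofReal_le_ofReal_iff hK.le] at this
  choose k hk using fun n : ℕ => (R.isBV_truncation hab n).exists_ae_eq hab
  set v : ℕ → ℝ → ℝ := fun n =>
    smoothing (ε n ^ 2) (k n) (distribDeriv a b (R.truncation n)) with hv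
  -- For a real-valued function the finite part is all of `(a,b)`, and truncation changes nothing.
  have htr : ∀ n : ℕ, ∀ᵐ t ∂(volume.restrict (Ioo a b)), R.truncation n t = u₀ t := fun n => by
    have := R.truncation_ae_eq n
    rwa [hRdef, hbv.finitePart_rep hab] at this
  have hvK : ∀ n, ∀ t ∈ Ioo a b, |v n t| ≤ K := fun n t ht =>
    abs_smoothing_le (hδ n) fun s hs => abs_add_cumul_le hab (distribDeriv_mem a b _) (by
      filter_upwards [hk n, htr n, hKae] with s h1 h2 h3
      rwa [← h1, h2]) (ht.1.trans hs.1)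
  have hvi : ∀ n, IntegrableOn (v n) (Ioo a b) := fun n => (isW11_smoothing hab (hδ n) _ _).1.1
  have hmem : ∀ n, MemLp (v n) 1 (volume.restrict (Ioo a b)) := fun n =>
    memLp_one_iff_integrable.2 (hvi n)
  refine ⟨fun n => (hmem n).toLp, ?_, ?_⟩
  · have hconv : ∀ᵐ t ∂(volume.restrict (Ioo a b)), Tendsto (fun n => v n t) atTop (𝓝 (u₀ t)) := by
      filter_upwards [R.tendsto_smoothing hab tendsto_natCast_atTop_atTop hk hδ hδ0] with t ht
      exact EReal.tendsto_coe.1 ht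
    rw [convL1, Lp.tendsto_Lp_iff_tendsto_eLpNorm']
    have heq : ∀ n, eLpNorm (⇑((hmem n).toLp : L1 a b) - ⇑u₀) 1 (volume.restrict (Ioo a b)) =
        ∫⁻ t in Ioo a b, ‖v n t - u₀ t‖ₑ := by
      intro n
      rw [eLpNorm_one_eq_lintegral_enorm]
      refine lintegral_congr_ae ?_
      filter_upwards [(hmem n).coeFn_toLp] with t ht
      rw [Pi.sub_apply, ht]
    simp_rw [heq]
    rw [← lintegral_zero (μ := volume.restrict (Ioo a b))]
    refine tendsto_lintegral_of_dominated_convergence' (fun _ => ENNReal.ofReal (2 * K)) ?_ ?_ ?_ ?_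
    · exact fun n => ((hvi n).aestronglyMeasurable.sub (Lp.aestronglyMeasurable u₀)).enorm
    · intro n
      filter_upwards [hKae, ae_restrict_mem measurableSet_Ioo] with t h1 ht
      rw [← ofReal_norm]
      refine ENNReal.ofReal_le_ofReal ((norm_sub_le _ _).trans ?_)
      have := hvK n t ht
      simp only [Real.norm_eq_abs]
      linarith
    · rw [lintegral_const]
      exact ENNReal.mul_ne_top ENNReal.ofReal_ne_top (measure_ne_top _ _)
    · filter_upwards [hconv] with t ht
      have := (continuous_enorm.tendsto _).comp (ht.sub_const (u₀ t))
      simpa [Function.comp_def] using this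
  · rw [redE_eq_F hc₀ hbv hKu, ← hbv.energy_rep hab c₀]
    refine le_trans (le_of_eq ?_) (R.limsup_redEeps_smoothing_le hab hc₀ hε hε0 (fun n => n) k
      (K := ENNReal.ofReal K) fun n => ?_)
    · congr 1; ext n
      exact redEeps_congr (hmem n).coeFn_toLp
    · rw [eLpNorm_exponent_top]
      refine eLpNormEssSup_le_of_ae_enorm_bound ?_
      filter_upwards [ae_restrict_mem measurableSet_Ioo] with t ht
      rw [← ofReal_norm]
      exact ENNReal.ofReal_le_ofReal (hvK n t ht)

end CohesiveFracture

end

open CohesiveFracture in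
theorem corollary2p8 (a b c₀ : ℝ) (hab : a < b) (hc₀ : 0 < c₀) :
    -- the case `K < ∞`
    (∀ K : ℝ, 0 < K →
      GammaConverges (convL1 a b)
          (fun ε u => redEeps a b c₀ (ENNReal.ofReal K) ε u)
          (fun u => redE a b c₀ (ENNReal.ofReal K) u) ∧
        ∀ u : L1 a b,
          (IsBV a b u ∧ eLpNorm u ∞ (volume.restrict (Ioo a b)) ≤ ENNReal.ofReal K →
            IntegrableOn (gStar a b c₀ u) (Ioo a b) ∧
            redE a b c₀ (ENNReal.ofReal K) u =
              E a b c₀ (ENNReal.ofReal K) u (singDeriv a b u + density a b (gStar a b c₀ u)) ∧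
            redE a b c₀ (ENNReal.ofReal K) u = F a b c₀ u) ∧
          (¬(IsBV a b u ∧ eLpNorm u ∞ (volume.restrict (Ioo a b)) ≤ ENNReal.ofReal K) →
            redE a b c₀ (ENNReal.ofReal K) u = ∞)) ∧
    -- the case `K = ∞`
    GammaConverges (convAE a b)
      (fun ε u => redEepsInf a b c₀ ε u)
      (fun u => redEInf a b c₀ u) := by
  refine ⟨fun K hK => ⟨fun ε hε hε0 => ⟨fun u u₀ hu => redE_le_liminf hab hc₀ _ hε hε0 hu,
    exists_recovery_convL1 hab hc₀ hK hε hε0⟩, fun u => ⟨fun hu =>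
      ⟨(integrable_gStar hc₀ a b u).integrableOn, redE_eq_E_gStar hc₀ hu.1 hu.2,
        redE_eq_F hc₀ hu.1 hu.2⟩, redE_eq_top⟩⟩, fun ε hε hε0 => ⟨fun u u₀ hu =>
    redEInf_le_liminf hab hc₀ hε hε0 hu, exists_recovery_convAE hab hc₀ hε hε0⟩⟩
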